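/- **Setting.** Let $d\in\{2,3\}$ and let $\Omega\subset\mathbb R^d$ be a bounded connected polygonal/polyhedral domain with boundary parts $\Gamma_D,\Gamma_N\subset\partial\Omega$ such that $\Gamma_D\cap\Gamma_N$ and $\partial\Omega\setminus(\Gamma_D\cup\Gamma_N)$ have positive surface measure; put $\Gamma_D'=\partial\Omega\setminus\Gamma_D$, $\Gamma_N'=\partial\Omega\setminus\Gamma_N$. Let $c\in\mathbb R$, $\mathcal L=-\Delta+c$, $V_0=\{v\in H^1(\Omega):v|_{\Gamma_D}=0\}$, $W=\{w\in H^1(\Omega):w|_{\Gamma_N'}=0\}$ (with the $H^1$-norm), $$a(v,w)=\int_\Omega\nabla v\cdot\nabla w+c\,vw\,dx,\qquad l(w)=\int_\Omega fw\,dx+\int_{\Gamma_N}\psi w\,ds,\quad f\in L^2(\Omega),\ \psi\in L^2(\Gamma_N).$$ Let $u\in V_0\cap H^2(\Omega)$ satisfy $a(u,w)=l(w)$ for all $w\in W$. Let $\|\cdot\|_S,\|\cdot\|_C$ be semi-norms on $H^1(\Omega)$, the second one bounded by a multiple of $\|\cdot\|_{H^1(\Omega)}$, and assume *conditional stability*: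 for each $E>0$ there is a function $\Xi_E$, smooth and positive on $(0,1)$, with $\Xi_E(s)\to0$ as $s\to0^+$, such that if $x\in V_0$, $\|x\|_C\le E$, $0\le\varepsilon<1$, $r\in W'$, $a(x,w)=r(w)$ for all $w\in W$ and $\|r\|_{W'}\le\varepsilon$, then $\|x\|_S\le\Xi_E(\varepsilon)$. **Method.** Let $\{\mathcal T_h\}$ be a quasi-uniform, shape regular family of conforming simplicial triangulations of $\Omega$, with maximum simplex diameter $h$, for which $\Gamma_D$ and $\Gamma_N$ are unions of boundary faces. Let $V_h=W_h=X_h$ be the continuous piecewise affine functions, $\mathcal F_I$ the set of interior faces and $[\cdot]$ the jump, let $\gamma_D,\gamma_S>0$ and $$a_h(v,w)=a(v,w)-\langle\partial_nv,w\rangle_{\Gamma_N'}-\langle\partial_nw,v\rangle_{\Gamma_D},\qquad s_V=s_V^D+s^S,\qquad s_W=s_W^D+s_W^S,$$ $$s_V^D(v,w)=\gamma_D\langle h^{-1}v,w\rangle_{\Gamma_D}+\gamma_D\langle h\,\partial_nv,\partial_nw\rangle_{\Gamma_N},\qquad s_W^D(v,w)=\gamma_D\langle h^{-1}v,w\rangle_{\Gamma_N'}+\gamma_D\langle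 h\,\partial_nv,\partial_nw\rangle_{\Gamma_D'},$$ $$s^S(v,w)=\gamma_S\langle h[\partial_nv],[\partial_nw]\rangle_{\mathcal F_I},\qquad s_W^S=s^S\ \text{ or }\ s_W^S(v,w)=\gamma_S(\nabla v,\nabla w)_\Omega,$$ $$A_h[(v,y),(v',w')]=a_h(v,w')-s_W(y,w')+a_h(v',y)+s_V(v,v').$$ For perturbations $\delta f\in(H^1(\Omega))'$, $\delta\psi\in L^2(\Gamma_N)$ put $\delta l(w)=\delta f(w)+\int_{\Gamma_N}\delta\psi\,w\,ds$, and let $(u_h,z_h)\in X_h\times X_h$ satisfy, for all $(v,w)\in X_h\times X_h$, $$A_h[(u_h,z_h),(v,w)]=l(w)+\delta l(w)+s_V^D(u,v)+\langle h\,\delta\psi,\partial_nv\rangle_{\Gamma_N}.$$ On $H^2(\Omega)+X_h$ define ($\|\cdot\|_h$ is the elementwise $L^2$-norm) $$\begin{aligned}|(v,w)|_{\mathcal L}={}&\|h\mathcal Lv\|_h+\|h\mathcal Lw\|_h+\|h^{1/2}[\partial_nv]\|_{\mathcal F_I}+\|h^{1/2}[\partial_nw]\|_{\mathcal F_I}+\|h^{-1/2}v\|_{\Gamma_D}\\&+\|h^{1/2}\partial_nv\|_{\Gamma_N}+\|h^{-1/2}w\|_{\Gamma_N'}+\|h^{1/2}\partial_nw\|_{\Gamma_D'},\end{aligned}$$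 with $\|w\|_{H^1(\Omega)}$ added in the second case of $s_W^S$, and $$\|v\|_{*,V}=\|h^{-1}v\|_\Omega+\|h^{-1/2}v\|_{\mathcal F_I\cup\Gamma_D'}+\|h^{1/2}\partial_nv\|_{\Gamma_N'},\qquad\|w\|_{*,W}=\|h^{-1}w\|_\Omega+\|h^{-1/2}w\|_{\mathcal F_I\cup\Gamma_N},$$ $$\eta_V(v_h)=\|h(f-\mathcal Lv_h)\|_h+\|h^{1/2}[\partial_nv_h]\|_{\mathcal F_I}+\|h^{1/2}(\psi-\partial_nv_h)\|_{\Gamma_N}+\|h^{-1/2}v_h\|_{\Gamma_D},$$ $$\eta_\delta(v_h,y_h)=\eta_V(v_h)+s_W(y_h,y_h)^{1/2}+\|\delta l\|_{W'}.$$ **Hypotheses.** There are maps $i_V:H^1(\Omega)\to X_h$, $i_W:W\to X_h\cap W$, $r_V:H^1(\Omega)\to X_h\cap V_0$ and numbers $M,c_s>0$, $t\ge1$, $\kappa\ge0$, $C_V(v)>0$, all numbers independent of $h$, such that for every mesh, all $v_h,\zeta_h,w_h\in X_h$, $v\in H^2(\Omega)$ and $w\in W$: 1. $a_h(u,w_h)=l(w_h)$;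 2. $c_s|(v_h,\zeta_h)|_{\mathcal L}\le\sup_{(v',w')\in X_h\times X_h}A_h[(v_h,\zeta_h),(v',w')]/|(v',w')|_{\mathcal L}$; 3. $a_h(v-i_Vv,w_h)\le M\|v-i_Vv\|_{*,V}|(0,w_h)|_{\mathcal L}$ and $a(u-v_h,w-i_Ww)\le M\|w-i_Ww\|_{*,W}\,\eta_V(v_h)$; 4. $\eta_V(v_h)\le M|(u-v_h,0)|_{\mathcal L}$; 5. $|a_h(v_h,i_Ww)-a(v_h,i_Ww)|\le M\eta_V(v_h)\|w\|_W$; 6. $\|r_Vv_h-v_h\|_S+\|r_Vv_h-v_h\|_C+\|r_Vv_h-v_h\|_{H^1(\Omega)}\le M\eta_V(v_h)$; 7. $|(v-i_Vv,0)|_{\mathcal L}+\|v-i_Vv\|_{*,V}\le C_V(v)h^t$; 8. $|(0,i_Ww)|_{\mathcal L}+\|w-i_Ww\|_{*,W}\le M\|w\|_W$; 9. $\|w_h\|_{H^1(\Omega)}\le Mh^{-\kappa}|(0,w_h)|_{\mathcal L}$. **Claim.** There are constants $c_{\delta,a},C>0$, depending only on the geometry, $c$, $\gamma_D$, $\gamma_S$,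 the choice of $s_W^S$, the mesh family and $M$, such that the following holds. For every $C_\delta(u)>0$ there is $E>0$, independent of $h$, $u_h$, $z_h$, $\delta f$, $\delta\psi$, $h_{min}$ and $h_{max}$, such that whenever $h_{min},h_{max}>0$ satisfy $$h_{min}^{-\kappa}\|\delta l\|_{(H^1(\Omega))'}+h^{1/2}\|\delta\psi\|_{\Gamma_N}\le C_\delta(u)\,h\quad\text{for all mesh sizes } h>h_{min}$$ and $\eta_\delta(u_h,z_h)<c_{\delta,a}^{-1}$ for $h_{min}<h<h_{max}$, then for all $h_{min}<h<h_{max}$ $$\|u-u_h\|_S\le C\big(\Xi_E(c_{\delta,a}\,\eta_\delta(u_h,z_h))+\eta_V(u_h)\big),$$ $$\eta_\delta(u_h,z_h)\le C\big(C_V(u)(1+c_s^{-1})h^t+c_s^{-1}h^{1/2}\|\delta\psi\|_{\Gamma_N}+(1+c_s^{-1}h^{-\kappa})\|\delta l\|_{(H^1(\Omega))'}\big).$$ -/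

import Mathlib

open MeasureTheory Filter Topology Set
open scoped ContDiff

noncomputable section

namespace CauchyFEM

variable {d : ℕ}

/-- Euclidean space of dimension `d`. -/
abbrev E (d : ℕ) := EuclideanSpace ℝ (Fin d)

/-- The surface measure: the `(d-1)`-dimensional Hausdorff measure, normalised so that it is
the usual length for `d = 2` and the usual area for `d = 3`. -/
def surf (d : ℕ) : Measure (E d) := μHE[d - 1]

/-! ### Sobolev spaces and traces -/

/-- Lebesgue measure on `Ω`. -/
abbrev vol (Ω : Set (E d)) : Measure (E d) := volume.restrict Ω

/-- Pairs (function, vector field) in `L²(Ω) × L²(Ω)^d`, with the norm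
`(‖v‖² + ‖G‖²)^{1/2}`. -/
abbrev Pair (Ω : Set (E d)) := WithLp 2 (Lp ℝ 2 (vol Ω) × Lp (E d) 2 (vol Ω))

lemma test_integrable {Ω : Set (E d)} (q : Lp ℝ 2 (vol Ω)) {g : E d → ℝ}
    (hg : Continuous g) (hc : HasCompactSupport g) :
    Integrable (fun x => q x * g x) (vol Ω) :=
  (Lp.memLp q).integrable_mul (q := 2) (hg.memLp_of_hasCompactSupport hc)

lemma test_integrable_vec {Ω : Set (E d)} (q : Lp (E d) 2 (vol Ω)) (i : Fin d) {g : E d → ℝ}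
    (hg : Continuous g) (hc : HasCompactSupport g) :
    Integrable (fun x => (q x) i * g x) (vol Ω) := by
  have h : MemLp (fun x => (q x) i) 2 (vol Ω) := by
    refine MemLp.of_le (Lp.memLp q) ?_ (Eventually.of_forall fun x => PiLp.norm_apply_le _ i)
    exact (EuclideanSpace.proj (𝕜 := ℝ) i).continuous.comp_aestronglyMeasurable
      (Lp.aestronglyMeasurable q)
  exact h.integrable_mul (q := 2) (hg.memLp_of_hasCompactSupport hc)

/-- The `i`-th partial derivative of a smooth function. -/
def pd (φ : E d → ℝ) (i : Fin d) (x : E d) : ℝ := fderiv ℝ φ x (EuclideanSpace.single i 1)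

lemma pd_continuous {φ : E d → ℝ} (h : ContDiff ℝ ∞ φ) (i : Fin d) : Continuous (pd φ i) :=
  (h.continuous_fderiv (by simp)).clm_apply continuous_const

lemma pd_compact {φ : E d → ℝ} (h : HasCompactSupport φ) (i : Fin d) :
    HasCompactSupport (pd φ i) :=
  (h.fderiv (𝕜 := ℝ)).comp_left (g := fun L : E d →L[ℝ] ℝ => L (EuclideanSpace.single i 1)) rfl

/-- `H¹(Ω)`: the pairs `(v, ∇v)` where `v ∈ L²(Ω)` has the weak gradient `∇v ∈ L²(Ω)^d`.
The norm inherited from `Pair Ω` is the usual `H¹`-norm. -/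
def H1 (Ω : Set (E d)) : Submodule ℝ (Pair Ω) where
  carrier := {p | ∀ φ : E d → ℝ, ContDiff ℝ ∞ φ → HasCompactSupport φ → tsupport φ ⊆ Ω →
    ∀ i, ∫ x, p.fst x * pd φ i x ∂(vol Ω) = - ∫ x, (p.snd x) i * φ x ∂(vol Ω)}
  zero_mem' := by
    intro φ _ _ _ i
    have h1 : ∫ x, (0 : Pair Ω).fst x * pd φ i x ∂(vol Ω) = ∫ x, (0 : ℝ) ∂(vol Ω) := by
      refine integral_congr_ae ?_
      filter_upwards [Lp.coeFn_zero ℝ 2 (vol Ω)] with x hx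
      have hx2 : (0 : Pair Ω).fst x = 0 := hx
      rw [hx2, zero_mul]
    have h2 : ∫ x, ((0 : Pair Ω).snd x) i * φ x ∂(vol Ω) = ∫ x, (0 : ℝ) ∂(vol Ω) := by
      refine integral_congr_ae ?_
      filter_upwards [Lp.coeFn_zero (E d) 2 (vol Ω)] with x hx
      have hx2 : (0 : Pair Ω).snd x = 0 := hx
      rw [hx2, PiLp.zero_apply, zero_mul]
    rw [h1, h2]; simp
  add_mem' := by
    intro p q hp hq φ h1 h2 h3 i
    have e1 : ∫ x, (p + q).fst x * pd φ i x ∂(vol Ω)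
        = ∫ x, (p.fst x * pd φ i x + q.fst x * pd φ i x) ∂(vol Ω) := by
      refine integral_congr_ae ?_
      filter_upwards [Lp.coeFn_add p.fst q.fst] with x hx
      have hx2 : (p + q).fst x = p.fst x + q.fst x := hx
      rw [hx2, add_mul]
    have e2 : ∫ x, ((p + q).snd x) i * φ x ∂(vol Ω)
        = ∫ x, ((p.snd x) i * φ x + (q.snd x) i * φ x) ∂(vol Ω) := by
      refine integral_congr_ae ?_
      filter_upwards [Lp.coeFn_add p.snd q.snd] with x hx
      have hx2 : (p + q).snd x = p.snd x + q.snd x := hx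
      rw [hx2, PiLp.add_apply, add_mul]
    rw [e1, e2, integral_add (test_integrable _ (pd_continuous h1 i) (pd_compact h2 i))
      (test_integrable _ (pd_continuous h1 i) (pd_compact h2 i)),
      integral_add (test_integrable_vec _ i h1.continuous h2)
      (test_integrable_vec _ i h1.continuous h2), hp φ h1 h2 h3 i, hq φ h1 h2 h3 i]
    ring
  smul_mem' := by
    intro a p hp φ h1 h2 h3 i
    have e1 : ∫ x, (a • p).fst x * pd φ i x ∂(vol Ω)
        = ∫ x, a * (p.fst x * pd φ i x) ∂(vol Ω) := by
      refine integral_congr_ae ?_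
      filter_upwards [Lp.coeFn_smul a p.fst] with x hx
      have hx2 : (a • p).fst x = a * p.fst x := hx
      rw [hx2, mul_assoc]
    have e2 : ∫ x, ((a • p).snd x) i * φ x ∂(vol Ω)
        = ∫ x, a * ((p.snd x) i * φ x) ∂(vol Ω) := by
      refine integral_congr_ae ?_
      filter_upwards [Lp.coeFn_smul a p.snd] with x hx
      have hx2 : (a • p).snd x = a • p.snd x := hx
      rw [hx2, PiLp.smul_apply, smul_eq_mul, mul_assoc]
    rw [e1, e2, integral_const_mul, integral_const_mul, hp φ h1 h2 h3 i]
    ring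

/-- The function underlying an element of `H¹(Ω)`. -/
def fn {Ω : Set (E d)} (v : H1 Ω) : E d → ℝ := v.1.fst

/-- The weak gradient of an element of `H¹(Ω)`. -/
def grad {Ω : Set (E d)} (v : H1 Ω) : E d → E d := v.1.snd

lemma fn_add {Ω : Set (E d)} (v w : H1 Ω) : fn (v + w) =ᵐ[vol Ω] (fn v) + (fn w) :=
  Lp.coeFn_add v.1.fst w.1.fst

lemma grad_add {Ω : Set (E d)} (v w : H1 Ω) : grad (v + w) =ᵐ[vol Ω] (grad v) + (grad w) :=
  Lp.coeFn_add v.1.snd w.1.snd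

lemma fn_smul {Ω : Set (E d)} (a : ℝ) (v : H1 Ω) : fn (a • v) =ᵐ[vol Ω] a • (fn v) :=
  Lp.coeFn_smul a v.1.fst

lemma grad_smul {Ω : Set (E d)} (a : ℝ) (v : H1 Ω) : grad (a • v) =ᵐ[vol Ω] a • (grad v) :=
  Lp.coeFn_smul a v.1.snd

lemma fn_zero {Ω : Set (E d)} : fn (0 : H1 Ω) =ᵐ[vol Ω] 0 := Lp.coeFn_zero ℝ 2 (vol Ω)

lemma grad_zero {Ω : Set (E d)} : grad (0 : H1 Ω) =ᵐ[vol Ω] 0 :=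
  Lp.coeFn_zero (E d) 2 (vol Ω)

/-- `H²(Ω)`: an element `v ∈ H¹(Ω)` together with its (uniquely determined) weak partial
derivatives `∂₁v, …, ∂_dv`, which are required to lie in `H¹(Ω)` as well. -/
def H2 (Ω : Set (E d)) : Submodule ℝ (H1 Ω × (Fin d → H1 Ω)) where
  carrier := {p | ∀ i, fn (p.2 i) =ᵐ[vol Ω] fun x => (grad p.1 x) i}
  zero_mem' := by
    intro i
    filter_upwards [fn_zero (Ω := Ω), grad_zero (Ω := Ω)] with x h1 h2
    simp [h1, h2]
  add_mem' := by
    intro p q hp hq i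
    filter_upwards [hp i, hq i, fn_add (p.2 i) (q.2 i), grad_add p.1 q.1]
      with x h1 h2 h3 h4
    simp [h1, h2, h3, h4]
  smul_mem' := by
    intro a p hp i
    filter_upwards [hp i, fn_smul a (p.2 i), grad_smul a p.1] with x h1 h2 h3
    simp [h1, h2, h3]

/-- The `H¹` function underlying an element of `H²(Ω)`. -/
def toH1 {Ω : Set (E d)} (φ : H2 Ω) : H1 Ω := φ.1.1

/-- The partial derivative `∂ᵢφ ∈ H¹(Ω)` of `φ ∈ H²(Ω)`. -/
def dx {Ω : Set (E d)} (φ : H2 Ω) (i : Fin d) : H1 Ω := φ.1.2 i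

/-- The Laplacian of `φ ∈ H²(Ω)`. -/
def lap {Ω : Set (E d)} (φ : H2 Ω) (x : E d) : ℝ := ∑ i, (grad (dx φ i) x) i

/-- `g ∈ L²(A)` is the trace of `v ∈ H¹(Ω)` on the surface piece `A`: there are smooth
functions `φₙ` which converge to `v` in `H¹(Ω)` and to `g` in `L²(A)`. -/
def IsTrace (Ω A : Set (E d)) (v : H1 Ω) (g : E d → ℝ) : Prop :=
  MemLp g 2 ((surf d).restrict A) ∧
  ∃ φ : ℕ → E d → ℝ, (∀ n, ContDiff ℝ ∞ (φ n)) ∧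
    Tendsto (fun n => eLpNorm (φ n - (fn v)) 2 (vol Ω)) atTop (𝓝 0) ∧
    Tendsto (fun n => eLpNorm (gradient (φ n) - (grad v)) 2 (vol Ω)) atTop (𝓝 0) ∧
    Tendsto (fun n => eLpNorm (φ n - g) 2 ((surf d).restrict A)) atTop (𝓝 0)

open Classical in
/-- The trace of `v` on `A`, as a function determined up to null sets of `A`.  When the trace
vanishes the representative is chosen to be identically zero. -/
def trace (Ω A : Set (E d)) (v : H1 Ω) : E d → ℝ :=
  if IsTrace Ω A v 0 then 0
  else if h : ∃ g, IsTrace Ω A v g then h.choose else 0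

lemma tendsto_add_zero {u v w : ℕ → ENNReal} (hu : Tendsto u atTop (𝓝 0))
    (hv : Tendsto v atTop (𝓝 0)) (h : ∀ n, w n ≤ u n + v n) : Tendsto w atTop (𝓝 0) := by
  refine tendsto_of_tendsto_of_tendsto_of_le_of_le tendsto_const_nhds
    (h := fun n => u n + v n) ?_ (fun n => zero_le) h
  simpa using hu.add hv

lemma gradient_continuous {φ : E d → ℝ} (h : ContDiff ℝ ∞ φ) : Continuous (gradient φ) :=
  (InnerProductSpace.toDual ℝ (E d)).symm.continuous.comp (h.continuous_fderiv (by simp))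

lemma fn_meas {Ω : Set (E d)} (v : H1 Ω) : AEStronglyMeasurable (fn v) (vol Ω) :=
  Lp.aestronglyMeasurable v.1.fst

lemma grad_meas {Ω : Set (E d)} (v : H1 Ω) : AEStronglyMeasurable (grad v) (vol Ω) :=
  Lp.aestronglyMeasurable v.1.snd

/-- The subspace of `H¹(Ω)` of functions whose trace on `A` vanishes. -/
def H1van (Ω A : Set (E d)) : Submodule ℝ (H1 Ω) where
  carrier := {v | IsTrace Ω A v 0}
  zero_mem' := by
    refine ⟨MemLp.zero, fun _ => 0, fun _ => contDiff_const, ?_, ?_, ?_⟩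
    · have : eLpNorm ((fun _ => 0 : E d → ℝ) - fn (0 : H1 Ω)) 2 (vol Ω) = 0 := by
        rw [eLpNorm_congr_ae (g := 0), eLpNorm_zero]
        filter_upwards [fn_zero (Ω := Ω)] with x hx
        simp [hx]
      exact Tendsto.congr (fun _ => this.symm) tendsto_const_nhds
    · have : eLpNorm (gradient (fun _ => 0 : E d → ℝ) - grad (0 : H1 Ω)) 2 (vol Ω) = 0 := by
        rw [eLpNorm_congr_ae (g := 0), eLpNorm_zero]
        filter_upwards [grad_zero (Ω := Ω)] with x hx
        simp [hx]
      exact Tendsto.congr (fun _ => this.symm) tendsto_const_nhds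
    · have : ((fun _ => 0 : E d → ℝ) - 0) = 0 := by ext; simp
      simp [this]
  add_mem' := by
    rintro v w ⟨_, φ, hφ, a1, a2, a3⟩ ⟨_, χ, hχ, b1, b2, b3⟩
    refine ⟨MemLp.zero, fun n => φ n + χ n, fun n => (hφ n).add (hχ n), ?_, ?_, ?_⟩
    · refine tendsto_add_zero a1 b1 fun n => ?_
      rw [eLpNorm_congr_ae (g := (φ n - (fn v)) + (χ n - (fn w)))]
      · exact eLpNorm_add_le ((hφ n).continuous.aestronglyMeasurable.sub (fn_meas v))
          ((hχ n).continuous.aestronglyMeasurable.sub (fn_meas w)) (by norm_num)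
      · filter_upwards [fn_add v w] with x hx
        simp only [Pi.sub_apply, Pi.add_apply, hx]; ring
    · refine tendsto_add_zero a2 b2 fun n => ?_
      rw [eLpNorm_congr_ae (g := (gradient (φ n) - (grad v)) + (gradient (χ n) - (grad w)))]
      · exact eLpNorm_add_le ((gradient_continuous (hφ n)).aestronglyMeasurable.sub (grad_meas v))
          ((gradient_continuous (hχ n)).aestronglyMeasurable.sub (grad_meas w)) (by norm_num)
      · filter_upwards [grad_add v w] with x hx
        have e : gradient (φ n + χ n) x = gradient (φ n) x + gradient (χ n) x := by
          simp only [gradient]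
          rw [fderiv_add ((hφ n).differentiable (by simp) x)
            ((hχ n).differentiable (by simp) x), map_add]
        simp only [Pi.sub_apply, Pi.add_apply, hx, e]; abel
    · refine tendsto_add_zero a3 b3 fun n => ?_
      simp only [sub_zero]
      exact eLpNorm_add_le (hφ n).continuous.aestronglyMeasurable
        (hχ n).continuous.aestronglyMeasurable (by norm_num)
  smul_mem' := by
    rintro a v ⟨_, φ, hφ, a1, a2, a3⟩
    refine ⟨MemLp.zero, fun n => a • φ n, fun n => contDiff_const.smul (hφ n), ?_, ?_, ?_⟩
    · have : ∀ n, eLpNorm (a • φ n - fn (a • v)) 2 (vol Ω)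
          = ‖a‖ₑ * eLpNorm (φ n - (fn v)) 2 (vol Ω) := fun n => by
        rw [← eLpNorm_const_smul]
        refine eLpNorm_congr_ae ?_
        filter_upwards [fn_smul a v] with x hx
        simp only [Pi.sub_apply, Pi.smul_apply, hx, smul_sub]
      simp only [this]
      simpa using ENNReal.Tendsto.const_mul a1 (Or.inr enorm_ne_top)
    · have : ∀ n, eLpNorm (gradient (a • φ n) - grad (a • v)) 2 (vol Ω)
          = ‖a‖ₑ * eLpNorm (gradient (φ n) - (grad v)) 2 (vol Ω) := fun n => by
        rw [← eLpNorm_const_smul]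
        refine eLpNorm_congr_ae ?_
        filter_upwards [grad_smul a v] with x hx
        have e : gradient (a • φ n) x = a • gradient (φ n) x := by
          simp only [gradient]
          rw [fderiv_const_smul ((hφ n).differentiable (by simp) x), map_smul]
        simp only [Pi.sub_apply, Pi.smul_apply, hx, e, smul_sub]
      simp only [this]
      simpa using ENNReal.Tendsto.const_mul a2 (Or.inr enorm_ne_top)
    · simp only [sub_zero, eLpNorm_const_smul] at a3 ⊢
      simpa using ENNReal.Tendsto.const_mul a3 (Or.inr enorm_ne_top)

/-! ### The elliptic Cauchy problem -/

/-- The geometry of the Cauchy problem: a domain `Ω`, the Dirichlet part `ΓD` and the Neumann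
part `ΓN` of its boundary.  (That `Ω`, `ΓD`, `ΓN` are polyhedral is contained in the
definition of the meshes below.) -/
structure Domain (d : ℕ) where
  Ω : Set (E d)
  ΓD : Set (E d)
  ΓN : Set (E d)
  isOpen : IsOpen Ω
  isConnected : IsConnected Ω
  regular : interior (closure Ω) = Ω
  subD : ΓD ⊆ frontier Ω
  subN : ΓN ⊆ frontier Ω
  overlap : surf d (ΓD ∩ ΓN) ≠ 0
  free : surf d (frontier Ω \ (ΓD ∪ ΓN)) ≠ 0

namespace Domain

variable (G : Domain d)

/-- `V₀`: functions in `H¹(Ω)` with zero trace on `ΓD`. -/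
def V0 : Submodule ℝ (H1 G.Ω) := H1van G.Ω G.ΓD

/-- `W`: functions in `H¹(Ω)` with zero trace on `∂Ω \ ΓN`. -/
def W : Submodule ℝ (H1 G.Ω) := H1van G.Ω (frontier G.Ω \ G.ΓN)

/-- `a(v,w) = ∫_Ω ∇v·∇w + c v w`. -/
def a (c : ℝ) (v w : H1 G.Ω) : ℝ :=
  ∫ x in G.Ω, (inner ℝ ((grad v) x) ((grad w) x) + c * ((fn v) x * (fn w) x))

/-- `∫_{ΓN} q w ds`, with the trace of `w`. -/
def neumannTerm (q : E d → ℝ) (w : H1 G.Ω) : ℝ :=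
  ∫ x in G.ΓN, q x * trace G.Ω G.ΓN w x ∂(surf d)

/-- `l(w) = ∫_Ω f w + ∫_{ΓN} ψ w ds`. -/
def l (f : Lp ℝ 2 (vol G.Ω)) (ψ : E d → ℝ) (w : H1 G.Ω) : ℝ :=
  (∫ x in G.Ω, f x * (fn w) x) + G.neumannTerm ψ w

/-- The norm of `L²(ΓN)`. -/
def normN (q : E d → ℝ) : ℝ := √(∫ x in G.ΓN, q x ^ 2 ∂(surf d))

/-- The conditional stability property: for each `E₀ > 0` the function `Ξ E₀` is smooth and
positive, tends to zero at `0+`, and bounds `‖x‖_S` for every `x ∈ V₀` with `‖x‖_C ≤ E₀` that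
solves `a(x,·) = r` on `W` with `‖r‖_{W'} ≤ ε < 1`. -/
def ConditionallyStable (c : ℝ) (normS normC : Seminorm ℝ (H1 G.Ω)) (Ξ : ℝ → ℝ → ℝ) : Prop :=
  ∀ E₀ > 0,
    ContDiffOn ℝ ∞ (Ξ E₀) (Ioo 0 1) ∧
    (∀ s ∈ Ioo (0 : ℝ) 1, 0 < Ξ E₀ s) ∧
    Tendsto (Ξ E₀) (𝓝[>] 0) (𝓝 0) ∧
    ∀ x ∈ G.V0, normC x ≤ E₀ → ∀ ε, 0 ≤ ε → ε < 1 →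
      ∀ r : G.W →L[ℝ] ℝ, (∀ w : G.W, G.a c x w = r w) → ‖r‖ ≤ ε → normS x ≤ Ξ E₀ ε

end Domain

/-! ### Simplicial meshes and piecewise affine functions -/

/-- A conforming simplicial triangulation of `Ω`: a finite simplicial complex, each simplex of
which is a face of a `d`-dimensional one, and which covers the closure of `Ω`. -/
structure Mesh (Ω : Set (E d)) extends Geometry.SimplicialComplex ℝ (E d) where
  finite : faces.Finite
  pure : ∀ s ∈ faces, ∃ t ∈ faces, s ⊆ t ∧ t.card = d + 1
  covers : toSimplicialComplex.space = closure Ω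

/-- The closed simplex with vertex set `s`. -/
abbrev hull (s : Finset (E d)) : Set (E d) := convexHull ℝ (s : Set (E d))

/-- The outward unit normal, on the facet `F` of the simplex `s`. -/
def outwardNormal (s F : Finset (E d)) : E d :=
  let y := (vectorSpan ℝ (F : Set (E d)))ᗮ.starProjection
    (F.centroid ℝ id - s.centroid ℝ id)
  ‖y‖⁻¹ • y

/-- The (constant) gradient of a piecewise affine function on the simplex `s`. -/
def cellGrad {Ω : Set (E d)} (v : H1 Ω) (s : Finset (E d)) : E d :=
  ⨍ y in interior (hull s), (grad v) y

/-- The affine function with which a piecewise affine `v` coincides on the simplex `s`. -/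
def cellVal {Ω : Set (E d)} (v : H1 Ω) (s : Finset (E d)) (x : E d) : ℝ :=
  ⨍ y in interior (hull s), ((fn v) y + inner ℝ (cellGrad v s) (x - y))

namespace Mesh

open Classical

variable {Ω : Set (E d)} (T : Mesh Ω)

/-- The elements: the `d`-dimensional simplices. -/
def cells : Finset (Finset (E d)) := T.finite.toFinset.filter fun s => s.card = d + 1

/-- The elements that have `F` as a face. -/
def adj (F : Finset (E d)) : Finset (Finset (E d)) := T.cells.filter fun s => F ⊆ s

/-- The interior facets: those shared by two elements. -/
def intFacets : Finset (Finset (E d)) :=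
  T.finite.toFinset.filter fun F => F.card = d ∧ (T.adj F).card = 2

/-- The boundary facets: those that belong to one element only. -/
def bdryFacets : Finset (Finset (E d)) :=
  T.finite.toFinset.filter fun F => F.card = d ∧ (T.adj F).card = 1

/-- The boundary facets in `Γ`. -/
def on (Γ : Set (E d)) : Finset (Finset (E d)) := T.bdryFacets.filter fun F => hull F ⊆ Γ

/-- The boundary facets in the complement of `Γ`, where `Γ` is a union of boundary facets. -/
def off (Γ : Set (E d)) : Finset (Finset (E d)) := T.bdryFacets.filter fun F => ¬ hull F ⊆ Γ

/-- The part `Γ` of the boundary is a union of boundary facets of the mesh. -/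
def Fits (Γ : Set (E d)) : Prop := Γ = ⋃ F ∈ T.on Γ, hull F

/-- The mesh size: the maximum simplex diameter. -/
def h : ℝ := sSup ((fun s => Metric.diam (hull s)) '' (T.cells : Set (Finset (E d))))

/-- The space of continuous piecewise affine functions, as a subspace of `H¹(Ω)`. -/
def X : Submodule ℝ (H1 Ω) where
  carrier := {v | ∃ g : E d → ℝ, ContinuousOn g (closure Ω) ∧
    (∀ s ∈ T.cells, ∃ A : E d →ᵃ[ℝ] ℝ, EqOn g A (hull s)) ∧ (fn v) =ᵐ[vol Ω] g}
  zero_mem' := ⟨0, continuousOn_const, fun _ _ => ⟨0, fun _ _ => rfl⟩, fn_zero⟩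
  add_mem' := by
    rintro v w ⟨g, hg, hA, hv⟩ ⟨k, hk, hB, hw⟩
    refine ⟨g + k, hg.add hk, fun s hs => ?_, ?_⟩
    · obtain ⟨A, hA⟩ := hA s hs
      obtain ⟨B, hB⟩ := hB s hs
      exact ⟨A + B, fun x hx => by simp [hA hx, hB hx]⟩
    · filter_upwards [hv, hw, fn_add v w] with x h1 h2 h3
      simp [h1, h2, h3]
  smul_mem' := by
    rintro a v ⟨g, hg, hA, hv⟩
    refine ⟨a • g, hg.const_smul a, fun s hs => ?_, ?_⟩
    · obtain ⟨A, hA⟩ := hA s hs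
      exact ⟨a • A, fun x hx => by simp [hA hx]⟩
    · filter_upwards [hv, fn_smul a v] with x h1 h2
      simp [h1, h2]

/-- Values of `v ∈ X_h` on a facet (all adjacent elements give the same value). -/
def faceVal (v : H1 Ω) (F : Finset (E d)) (x : E d) : ℝ :=
  ((T.adj F).card : ℝ)⁻¹ * ∑ s ∈ T.adj F, cellVal v s x

/-- For `v ∈ X_h`, the sum of the outward normal derivatives from the elements adjacent to `F`:
the jump of the normal derivative on an interior facet, and the normal derivative `∂ₙv` on a
boundary facet. -/
def normalFlux (v : H1 Ω) (F : Finset (E d)) : ℝ :=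
  ∑ s ∈ T.adj F, inner ℝ (cellGrad v s) (outwardNormal s F)

/-- The outward unit normal of `Ω` on a boundary facet. -/
def bdryNormal (F : Finset (E d)) : E d := ∑ s ∈ T.adj F, outwardNormal s F

/-- `∑_{F ∈ 𝓐} ∫_F p q ds`, the `L²`-product over a set of facets. -/
def ip (A : Finset (Finset (E d))) (p q : Finset (E d) → E d → ℝ) : ℝ :=
  ∑ F ∈ A, ∫ x in hull F, p F x * q F x ∂(surf d)

/-- The associated `L²`-norm over a set of facets. -/
def nrm (A : Finset (Finset (E d))) (p : Finset (E d) → E d → ℝ) : ℝ := √(ip A p p)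

/-- The space `H²(Ω) + X_h`; the pair `(φ, v)` stands for the function `φ + v`. -/
abbrev Broken := H2 Ω × T.X

variable {T}

/-- The function `φ + v` in `H¹(Ω)`. -/
def bfn (b : T.Broken) : H1 Ω := toH1 b.1 + b.2

/-- Values (traces) on facets. -/
def bval (b : T.Broken) (F : Finset (E d)) (x : E d) : ℝ :=
  trace Ω (hull F) (toH1 b.1) x + T.faceVal b.2 F x

/-- Normal derivative on boundary facets. -/
def bdn (b : T.Broken) (F : Finset (E d)) (x : E d) : ℝ :=
  (∑ i, trace Ω (hull F) (dx b.1 i) x * (T.bdryNormal F) i) + T.normalFlux b.2 F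

/-- Jump of the normal derivative on interior facets (zero for the `H²` part). -/
def bjump (b : T.Broken) (F : Finset (E d)) (_ : E d) : ℝ := T.normalFlux b.2 F

/-- The elementwise operator `𝓛 = -Δ + c` (the affine pieces of the discrete part are
harmonic). -/
def bop (c : ℝ) (b : T.Broken) (x : E d) : ℝ := - lap b.1 x + c * fn (bfn b) x

/-- A discrete function as an element of `H²(Ω) + X_h`. -/
def disc (v : T.X) : T.Broken := (0, v)

/-- A function of `H²(Ω)` as an element of `H²(Ω) + X_h`. -/
def smooth (φ : H2 Ω) : T.Broken := (φ, 0)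

end Mesh

/-! ### The stabilised finite element method -/

/-- The two choices of the adjoint stabilisation: the continuous interior penalty term, or
the `H¹`-seminorm. -/
inductive AdjointStab
  | cip
  | grad

/-- Parameters of the method: reaction coefficient `c`, penalty parameters `γD`, `γS` and the
adjoint stabilisation. -/
structure Params where
  c : ℝ
  γD : ℝ
  γS : ℝ
  γD_pos : 0 < γD
  γS_pos : 0 < γS
  adj : AdjointStab

namespace Method

open Mesh

variable (G : Domain d) (P : Params) (T : Mesh G.Ω)

/-- `a_h(v,w) = a(v,w) - ⟨∂ₙv, w⟩_{∂Ω∖ΓN} - ⟨∂ₙw, v⟩_{ΓD}`. -/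
def ah (v w : T.Broken) : ℝ :=
  G.a P.c (bfn v) (bfn w) - ip (T.off G.ΓN) (bdn v) (bval w) - ip (T.on G.ΓD) (bdn w) (bval v)

/-- The data part `s_V^D` of the primal stabilisation. -/
def sVD (v w : T.Broken) : ℝ :=
  P.γD * (T.h⁻¹ * ip (T.on G.ΓD) (bval v) (bval w)) + P.γD * (T.h * ip (T.on G.ΓN) (bdn v) (bdn w))

/-- The continuous interior penalty term (for affine elements the jumps of the elementwise
Laplacian vanish, and only the jumps of the normal derivative remain). -/
def cip (v w : T.Broken) : ℝ := P.γS * (T.h * ip T.intFacets (bjump v) (bjump w))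

/-- The primal stabilisation `s_V`. -/
def sV (v w : T.Broken) : ℝ := sVD G P T v w + cip G P T v w

/-- The boundary part `s_W^D` of the adjoint stabilisation. -/
def sWD (v w : T.Broken) : ℝ :=
  P.γD * (T.h⁻¹ * ip (T.off G.ΓN) (bval v) (bval w)) + P.γD * (T.h * ip (T.off G.ΓD) (bdn v) (bdn w))

/-- The interior part `s_W^S` of the adjoint stabilisation. -/
def sWS (v w : T.Broken) : ℝ :=
  match P.adj with
  | .cip => cip G P T v w
  | .grad => P.γS * ∫ x in G.Ω, inner ℝ (grad (bfn v) x) (grad (bfn w) x)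

/-- The adjoint stabilisation `s_W`. -/
def sW (v w : T.Broken) : ℝ := sWD G P T v w + sWS G P T v w

/-- `A_h[(u,z),(v,w)]`. -/
def Ah (u z v w : T.Broken) : ℝ :=
  ah G P T u w - sW G P T z w + ah G P T v z + sV G P T u v

/-- The semi-norm `|(v,w)|_𝓛`. -/
def normL (v w : T.Broken) : ℝ :=
  T.h * √(∫ x in G.Ω, bop P.c v x ^ 2) + T.h * √(∫ x in G.Ω, bop P.c w x ^ 2)
  + √T.h * nrm T.intFacets (bjump v) + √T.h * nrm T.intFacets (bjump w)
  + (√T.h)⁻¹ * nrm (T.on G.ΓD) (bval v) + √T.h * nrm (T.on G.ΓN) (bdn v)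
  + (√T.h)⁻¹ * nrm (T.off G.ΓN) (bval w) + √T.h * nrm (T.off G.ΓD) (bdn w)
  + (match P.adj with
    | .cip => 0
    | .grad => ‖(bfn w)‖)

/-- The norm `‖v‖_{*,V}` on `H²(Ω) + X_h`. -/
def starV (v : T.Broken) : ℝ :=
  T.h⁻¹ * √(∫ x in G.Ω, fn (bfn v) x ^ 2) + (√T.h)⁻¹ * nrm (T.intFacets ∪ T.off G.ΓD) (bval v)
  + √T.h * nrm (T.off G.ΓN) (bdn v)

/-- The norm `‖w - y‖_{*,W}` of the difference of `w ∈ H¹(Ω)` and `y ∈ X_h`. -/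
def starW (w : H1 G.Ω) (y : T.X) : ℝ :=
  T.h⁻¹ * √(∫ x in G.Ω, fn (w - (y : H1 G.Ω)) x ^ 2)
  + (√T.h)⁻¹ * nrm (T.intFacets ∪ T.on G.ΓN)
      (fun F x => trace G.Ω (hull F) w x - T.faceVal y F x)

/-- The a posteriori quantity `η_V(v)`. -/
def ηV (f : Lp ℝ 2 (vol G.Ω)) (ψ : E d → ℝ) (v : T.X) : ℝ :=
  T.h * √(∫ x in G.Ω, (f x - bop P.c (disc v) x) ^ 2)
  + √T.h * nrm T.intFacets (bjump (disc v))
  + √T.h * nrm (T.on G.ΓN) (fun F x => ψ x - bdn (disc v) F x)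
  + (√T.h)⁻¹ * nrm (T.on G.ΓD) (bval (disc v))

/-- `η_δ(v,z) = η_V(v) + |z|_{s_W} + ‖δl‖_{W'}`. -/
def ηδ (f : Lp ℝ 2 (vol G.Ω)) (ψ : E d → ℝ) (δl : H1 G.Ω →L[ℝ] ℝ) (v z : T.X) : ℝ :=
  ηV G P T f ψ v + √(sW G P T (disc z) (disc z)) + ‖δl.comp G.W.subtypeL‖

/-- `(uh, zh)` solves the method with perturbed data: for all `(v,w) ∈ X_h × X_h`,
`A_h[(uh,zh),(v,w)] = l(w) + δl(w) + s_V^D(u,v) + ⟨h δψ, ∂ₙv⟩_{ΓN}`. -/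
def Solves (f : Lp ℝ 2 (vol G.Ω)) (ψ : E d → ℝ) (u : H2 G.Ω)
    (δl : H1 G.Ω →L[ℝ] ℝ) (δψ : E d → ℝ) (uh zh : T.X) : Prop :=
  ∀ v w : T.X, Ah G P T (disc uh) (disc zh) (disc v) (disc w)
    = G.l f ψ w + δl w + sVD G P T (smooth u) (disc v)
      + T.h * ip (T.on G.ΓN) (fun _ => δψ) (bdn (disc v))

/-- A quasi-uniform, shape regular family of meshes that are compatible with the boundary
parts. -/
def QuasiUniform {ι : Type*} (𝒯 : ι → Mesh G.Ω) : Prop :=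
  (∀ i, (𝒯 i).Fits G.ΓD ∧ (𝒯 i).Fits G.ΓN) ∧
  ∃ ρ > 0, ∀ i, ∀ s ∈ (𝒯 i).cells, ∃ x, Metric.ball x (ρ * (𝒯 i).h) ⊆ hull s

/-- `u ∈ V₀ ∩ H²(Ω)` solves `a(u,w) = l(w)` for all `w ∈ W`. -/
def IsSolution (f : Lp ℝ 2 (vol G.Ω)) (ψ : E d → ℝ) (u : H2 G.Ω) : Prop :=
  toH1 u ∈ G.V0 ∧ ∀ w ∈ G.W, G.a P.c (toH1 u) w = G.l f ψ w

/-- The hypotheses on forms and interpolants of the error analysis.  All generic constants,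
which do not depend on the mesh, are bounded by `M`. -/
structure Hypotheses {ι : Type*} (𝒯 : ι → Mesh G.Ω) (M : ℝ)
    (normS normC : Seminorm ℝ (H1 G.Ω))
    (f : Lp ℝ 2 (vol G.Ω)) (ψ : E d → ℝ) (u : H2 G.Ω)
    (iV : ∀ i, H1 G.Ω → (𝒯 i).X) (iW : ∀ i, G.W → (𝒯 i).X) (rV : ∀ i, H1 G.Ω → (𝒯 i).X)
    (cs t κ : ℝ) (CV : H2 G.Ω → ℝ) : Prop where
  /-- The interpolant `i_W` maps into `W_h ∩ W`. -/
  iW_mem : ∀ i w, (iW i w : H1 G.Ω) ∈ G.W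
  /-- The interpolant `r_V` maps into `V_h ∩ V₀`. -/
  rV_mem : ∀ i v, (rV i v : H1 G.Ω) ∈ G.V0
  /-- Galerkin orthogonality, i.e. consistency: `a_h(u, w) = l(w)` on `W_h`. -/
  consistency : ∀ i, ∀ w : (𝒯 i).X,
    ah G P (𝒯 i) (smooth u) (disc w) = G.l f ψ w
  /-- Discrete stability: `c_s |(ν,ζ)|_𝓛 ≤ sup A_h[(ν,ζ),(v,w)] / |(v,w)|_𝓛`. -/
  cs_pos : 0 < cs
  discrete_stability : ∀ i, ∀ ν ζ : (𝒯 i).X, ∀ B : ℝ,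
    (∀ v w : (𝒯 i).X, Ah G P (𝒯 i) (disc ν) (disc ζ) (disc v) (disc w)
      ≤ B * normL G P (𝒯 i) (disc v) (disc w)) →
    cs * normL G P (𝒯 i) (disc ν) (disc ζ) ≤ B
  /-- Continuity of `a_h`. -/
  continuity_ah : ∀ i, ∀ (φ : H2 G.Ω) (w : (𝒯 i).X),
    ah G P (𝒯 i) (φ, - iV i (toH1 φ)) (disc w)
      ≤ M * (starV G (𝒯 i) (φ, - iV i (toH1 φ)) * normL G P (𝒯 i) (disc 0) (disc w))
  /-- Continuity of `a`. -/
  continuity_a : ∀ i, ∀ (v : (𝒯 i).X) (w : G.W),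
    G.a P.c (toH1 u - v) (w - iW i w)
      ≤ M * (starW G (𝒯 i) w (iW i w) * ηV G P (𝒯 i) f ψ v)
  /-- The a posteriori quantity is controlled by the error in the semi-norm. -/
  ηV_le : ∀ i, ∀ v : (𝒯 i).X,
    ηV G P (𝒯 i) f ψ v ≤ M * normL G P (𝒯 i) (u, - v) (disc 0)
  /-- Nonconformity of the form. -/
  nonconformity : ∀ i, ∀ (v : (𝒯 i).X) (w : G.W),
    |ah G P (𝒯 i) (disc v) (disc (iW i w)) - G.a P.c v (iW i w)|
      ≤ M * (ηV G P (𝒯 i) f ψ v * ‖w‖)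
  /-- Nonconformity of the discrete functions. -/
  rV_bound : ∀ i, ∀ v : (𝒯 i).X,
    normS ((rV i v : H1 G.Ω) - v) + normC ((rV i v : H1 G.Ω) - v) + ‖(rV i v : H1 G.Ω) - v‖
      ≤ M * ηV G P (𝒯 i) f ψ v
  /-- Approximability, of order `t ≥ 1`. -/
  one_le_t : 1 ≤ t
  CV_pos : ∀ φ, 0 < CV φ
  iV_approx : ∀ i, ∀ φ : H2 G.Ω,
    normL G P (𝒯 i) (φ, - iV i (toH1 φ)) (disc 0) + starV G (𝒯 i) (φ, - iV i (toH1 φ))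
      ≤ CV φ * (𝒯 i).h ^ t
  /-- Stability of the interpolant `i_W`. -/
  iW_stable : ∀ i, ∀ w : G.W,
    normL G P (𝒯 i) (disc 0) (disc (iW i w)) + starW G (𝒯 i) w (iW i w) ≤ M * ‖w‖
  /-- The `H¹`-norm on `W_h` is bounded by the semi-norm, up to a negative power of `h`. -/
  κ_nonneg : 0 ≤ κ
  norm_le : ∀ i, ∀ w : (𝒯 i).X,
    ‖(w : H1 G.Ω)‖ ≤ M * ((𝒯 i).h ^ (-κ) * normL G P (𝒯 i) (disc 0) (disc w))

end Method

end CauchyFEM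

end

/-!
The error `u - u_h` need not lie in `V₀`, but `x = u - r_V u_h` does, and the residual functional
`w ↦ a(x, w)` on `W` can be computed: inserting `w = (w - i_W w) + i_W w`, the equation for `u`
and the discrete equation for `(u_h, z_h)` leave only terms that are bounded by
`c_{δ,a} η_δ(u_h, z_h) ‖w‖` (`Method.residual_le`). Hence, if `‖x‖_C` stays below a bound `E` that
is uniform in the mesh, conditional stability bounds `‖x‖_S` by `Ξ_E(c_{δ,a} η_δ)`, and
`r_V u_h - u_h` costs another multiple of `η_V(u_h)` (`Method.error_le_of_residual_le`). Discrete
stability, applied to the equation of the discrete error `(u_h - i_V u, z_h)`, bounds that error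
in the semi-norm by the interpolation error and the perturbations (`Method.discrete_error_le`),
which gives the bound of `η_δ` itself (`Method.ηδ_le`).

Two uniform estimates on the meshes do not come from the hypotheses.

* A bound of `‖i_W w‖` in `H¹(Ω)`, which is needed because `δl` enters through its dual norm, and
  also one of `‖i_V u‖`. The hypotheses control the difference to the interpolant only in `L²(Ω)`,
  by a multiple of `h`. On each cell the constant gradient of the interpolant is recovered by
  integration by parts against a cut-off function supported in an inscribed ball
  (`exists_inverse_estimate`).

* A bound of `‖u_h - i_V u‖` in `H¹(Ω)`, for which the semi-norm has to be turned into a norm. For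
  `v ∈ X_h`, `h ‖v‖` is bounded by the jumps of the normal derivative, the values on `Γ_D` and the
  normal derivatives on `Γ_N` (`exists_discrete_poincare`). Since the semi-norm of the discrete
  error is `O(h)` under the smallness assumption on the perturbations, the error is bounded.

The second estimate rests on a Poincaré inequality for cellwise constant functions
(`exists_poincare_cells`) with the jumps over the facets and the values next to `Γ_D ∩ Γ_N` on the
right. A segment that misses all faces of codimension two meets `O(1 / h)` facets, and the two
values at its ends differ by at most the sum of the jumps over these facets
(`Mesh.abs_sub_le_sum_crossed`). Joining each point `x` of a set to `f x` by a segment, where `f`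
is a contraction or a projection, and exchanging summation and integration, one is led to the
volume of the points `x` whose segment crosses a given facet. These lie in the image of the facet
under a Lipschitz one-parameter family of maps, hence in a tube of volume `O(h ^ (d - 1))`
(`Mesh.lintegral_cellSq_le`). Projecting a cell onto its facet in `Γ_D ∩ Γ_N` gives the estimate
on that cell; contractions carry it from a ball to any convex set around its centre
(`Controlled.of_ball`), and connectedness of `Ω` carries it everywhere. The inequality is applied
to the gradients of `v`, whose jumps are purely normal, and then to its values at the centroids.
-/

noncomputable section
namespace CauchyFEM
variable {d : ℕ}

/-! ### Surface and volume measure of simplices -/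

lemma vectorSpan_hull (e : Finset (E d)) :
    vectorSpan ℝ (hull e) = vectorSpan ℝ (e : Set (E d)) := by
  rw [← direction_affineSpan, ← direction_affineSpan, affineSpan_convexHull]

lemma finrank_vectorSpan_lt {e : Finset (E d)} (he : e.Nonempty) :
    Module.finrank ℝ (vectorSpan ℝ (e : Set (E d))) + 1 ≤ e.card := by
  have := he.to_subtype
  have h := finrank_vectorSpan_range_add_one_le ℝ ((↑) : e → E d)
  rwa [Fintype.card_coe, show range ((↑) : e → E d) = (e : Set (E d)) from Subtype.range_coe] at h

lemma dimH_hull_le {e : Finset (E d)} (he : e.Nonempty) :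
    dimH (hull e) + 1 ≤ e.card := by
  rw [Real.Convex.dimH_eq_finrank_vectorSpan (convex_convexHull ℝ _) (convexHull_nonempty_iff.2 he),
    vectorSpan_hull]
  exact_mod_cast finrank_vectorSpan_lt he

lemma muHE_null {X : Type*} [EMetricSpace X] [MeasurableSpace X] [BorelSpace X] {n : ℕ}
    {s : Set X} (h : dimH s < n) : (μHE[n] : Measure X) s = 0 := by
  rw [Measure.euclideanHausdorffMeasure_def, Measure.smul_apply]
  have : (μH[(n : ℝ)] : Measure X) s = 0 := by
    have := hausdorffMeasure_of_dimH_lt (s := s) (d := (n : NNReal)) (by simpa using h)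
    simpa using this
  rw [this, smul_zero]

lemma volume_null {s : Set (E d)} (h : dimH s < d) : volume s = 0 := by
  rw [← EuclideanSpace.euclideanHausdorffMeasure_eq_volume]
  exact muHE_null h

lemma volume_hull_eq_zero {e : Finset (E d)} (he : e.card ≤ d) : volume (hull e) = 0 := by
  rcases e.eq_empty_or_nonempty with rfl | hne
  · simp [hull]
  · refine volume_null ?_
    have h := dimH_hull_le hne
    have h2 : dimH (hull e) + 1 < (d : ENNReal) + 1 := lt_of_le_of_lt h (by norm_cast; omega)
    exact lt_of_add_lt_add_right h2

lemma surf_hull_eq_zero {e : Finset (E d)} (he : e.card < d) : surf d (hull e) = 0 := by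
  rcases e.eq_empty_or_nonempty with rfl | hne
  · simp [hull]
  · refine muHE_null ?_
    have h := dimH_hull_le hne
    have h2 : dimH (hull e) + 1 < ((d - 1 : ℕ) : ENNReal) + 1 :=
      lt_of_le_of_lt h (by norm_cast; omega)
    exact lt_of_add_lt_add_right h2

lemma muHE_submodule {V : Submodule ℝ (E d)} {n : ℕ} (hV : Module.finrank ℝ V = n) (q : E d)
    (t : Set V) : (μHE[n] : Measure (E d)) ((fun τ : V => q + (τ : E d)) '' t) = volume t := by
  have hi : Isometry (fun τ : V => q + (τ : E d)) :=
    (IsometryEquiv.addLeft q).isometry.comp isometry_subtype_coe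
  rw [hi.euclideanHausdorffMeasure_image, ← hV,
    InnerProductSpace.euclideanHausdorffMeasure_eq_volume]

lemma surf_hull_lt_top {e : Finset (E d)} (he : e.card ≤ d) : surf d (hull e) < ⊤ := by
  rcases he.lt_or_eq with h | h
  · rw [surf_hull_eq_zero h]; exact ENNReal.zero_lt_top
  rcases e.eq_empty_or_nonempty with rfl | ⟨p, hp⟩
  · simp [hull]
  have hle := finrank_vectorSpan_lt ⟨p, hp⟩
  set V := vectorSpan ℝ (e : Set (E d)) with hV
  rcases (show Module.finrank ℝ V ≤ d - 1 by omega).lt_or_eq with h1 | h1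
  · have : surf d (hull e) = 0 := by
      refine muHE_null ?_
      rw [Real.Convex.dimH_eq_finrank_vectorSpan (convex_convexHull ℝ _)
        (convexHull_nonempty_iff.2 ⟨p, hp⟩),
        vectorSpan_hull]
      exact_mod_cast h1
    rw [this]; exact ENNReal.zero_lt_top
  · have hb : Bornology.IsBounded (hull e) := isBounded_convexHull.2 e.finite_toSet.isBounded
    obtain ⟨R, hR⟩ := hb.subset_closedBall p
    have hsub : hull e ⊆ (fun τ : V => p + (τ : E d)) '' Metric.closedBall 0 R := by
      intro x hx
      have hx2 : x - p ∈ V := by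
        have := vsub_mem_vectorSpan ℝ (s := hull e) hx (subset_convexHull ℝ _ hp)
        rwa [vectorSpan_hull] at this
      refine ⟨⟨x - p, hx2⟩, ?_, by simp⟩
      have := hR hx
      simpa [mem_closedBall_iff_norm, dist_eq_norm] using this
    calc surf d (hull e) ≤ surf d ((fun τ : V => p + (τ : E d)) '' Metric.closedBall 0 R) :=
          measure_mono hsub
      _ = volume (Metric.closedBall (0 : V) R) := muHE_submodule h1 p _
      _ < ⊤ := measure_closedBall_lt_top

/-- The volume of the unit ball of dimension `d - 1`. -/
def diskConst (d : ℕ) : ℝ := (volume (Metric.ball (0 : E (d - 1)) 1)).toReal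

lemma diskConst_pos : 0 < diskConst d :=
  ENNReal.toReal_pos (Metric.measure_ball_pos _ _ one_pos).ne' measure_ball_lt_top.ne

lemma surf_disk {V : Submodule ℝ (E d)} (hV : Module.finrank ℝ V = d - 1) (q : E d) {r : ℝ}
    (hr : 0 < r) : surf d ((fun τ : V => q + (τ : E d)) '' Metric.ball 0 r)
      = ENNReal.ofReal (diskConst d * r ^ (d - 1)) := by
  have h0 : volume (Metric.ball (0 : V) 1) = volume (Metric.ball (0 : E (d - 1)) 1) := by
    have e : V ≃ₗᵢ[ℝ] E (d - 1) :=
      (stdOrthonormalBasis ℝ V).repr.trans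
        (LinearIsometryEquiv.piLpCongrLeft 2 ℝ ℝ (finCongr hV))
    rw [← e.measurePreserving.measure_preimage_equiv (f := e.toMeasurableEquiv)
      (Metric.ball (0 : E (d - 1)) 1)]
    congr 1
    ext x; simp
  rw [surf, muHE_submodule hV, Measure.addHaar_ball_of_pos _ _ hr, hV, h0, diskConst, mul_comm,
    ENNReal.ofReal_mul ENNReal.toReal_nonneg, ENNReal.ofReal_toReal measure_ball_lt_top.ne]

/-! ### Shadows: sets swept out by a one-parameter family of maps -/

/-- The set swept out by `H` under the maps `γ(s, ·)`, `0 ≤ s ≤ 1`. -/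
def shadow (γ : ℝ × E d → E d) (H : Set (E d)) : Set (E d) := γ '' (Icc (0 : ℝ) 1 ×ˢ H)

/-- A set of codimension at least two sweeps out a null set. -/
lemma volume_shadow_hull_eq_zero {γ : ℝ × E d → E d} {B : Set (E d)} {L : NNReal}
    (hγ : LipschitzOnWith L γ (Icc (0 : ℝ) 1 ×ˢ B)) {e : Finset (E d)} (he : e.card < d)
    (heB : hull e ⊆ B) : volume (shadow γ (hull e)) = 0 := by
  rcases e.eq_empty_or_nonempty with rfl | hne
  · simp [hull, shadow]
  refine volume_null ?_
  have h1 : dimH (shadow γ (hull e)) ≤ dimH (Icc (0 : ℝ) 1 ×ˢ hull e) :=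
    (hγ.mono (prod_mono_right heB)).dimH_image_le
  refine lt_of_le_of_lt h1 ?_
  rw [Real.Convex.dimH_eq_finrank_vectorSpan ((convex_Icc (0 : ℝ) 1).prod (convex_convexHull ℝ _))
    ((nonempty_Icc.2 zero_le_one).prod (convexHull_nonempty_iff.2 hne))]
  set V := vectorSpan ℝ (e : Set (E d)) with hV
  have h2 : vectorSpan ℝ (Icc (0 : ℝ) 1 ×ˢ hull e)
      ≤ LinearMap.range (LinearMap.prodMap (LinearMap.id : ℝ →ₗ[ℝ] ℝ) V.subtype) := by
    rw [vectorSpan_def, Submodule.span_le]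
    rintro _ ⟨x, hx, y, hy, rfl⟩
    have := vsub_mem_vectorSpan ℝ hx.2 hy.2
    rw [vectorSpan_hull] at this
    exact ⟨(x.1 - y.1, ⟨_, this⟩), rfl⟩
  have h3 := (Submodule.finrank_mono h2).trans (LinearMap.finrank_range_le _)
  rw [Module.finrank_prod, Module.finrank_self] at h3
  have h5 : Module.finrank ℝ V + 1 ≤ e.card := finrank_vectorSpan_lt hne
  exact_mod_cast lt_of_le_of_lt h3 (by omega)

/-- Volume of the unit ball. -/
def ballConst (d : ℕ) : ℝ := (volume (Metric.ball (0 : E d) 1)).toReal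

lemma ballConst_pos : 0 < ballConst d :=
  ENNReal.toReal_pos (Metric.measure_ball_pos _ _ one_pos).ne' measure_ball_lt_top.ne

lemma volume_ball_eq (x : E d) {r : ℝ} (hr : 0 < r) :
    volume (Metric.ball x r) = ENNReal.ofReal (ballConst d * r ^ d) := by
  rw [Measure.addHaar_ball_of_pos _ _ hr, ballConst, mul_comm,
    ENNReal.ofReal_mul ENNReal.toReal_nonneg, ENNReal.ofReal_toReal measure_ball_lt_top.ne]
  simp

lemma volume_closedBall_eq (x : E d) {r : ℝ} (hr : 0 ≤ r) :
    volume (Metric.closedBall x r) = ENNReal.ofReal (ballConst d * r ^ d) := by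
  rw [Measure.addHaar_closedBall _ _ hr, ballConst, mul_comm,
    ENNReal.ofReal_mul ENNReal.toReal_nonneg, ENNReal.ofReal_toReal measure_ball_lt_top.ne]
  simp

/-- A ball of radius `h` sweeps out a tube of volume `O(h ^ (d - 1))`. -/
lemma exists_tube {γ : ℝ × E d → E d} {B : Set (E d)} {L : NNReal}
    (hγ : LipschitzOnWith L γ (Icc (0 : ℝ) 1 ×ˢ B)) (hd : 1 ≤ d) {h D : ℝ} (hh : 0 < h)
    (hD : h ≤ D) {H : Set (E d)} (hHB : H ⊆ B) (hH : ∀ x ∈ H, ∀ y ∈ H, dist x y ≤ h) :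
    ∃ M, MeasurableSet M ∧ shadow γ H ⊆ M ∧
      volume M ≤ ENNReal.ofReal (ballConst d * L ^ d * (1 + 2 * D) * h ^ (d - 1)) := by
  rcases H.eq_empty_or_nonempty with rfl | ⟨q, hq⟩
  · exact ⟨∅, MeasurableSet.empty, by simp [shadow], by simp⟩
  -- cover the path of the single point `q` by `n + 1` balls, where `n` is about `1 / h`
  set n := ⌈h⁻¹⌉₊ with hn
  have hn0 : 0 < n := Nat.ceil_pos.2 (inv_pos.2 hh)
  have hn1 : h⁻¹ ≤ n := Nat.le_ceil _
  have hn2 : (n : ℝ) < h⁻¹ + 1 := Nat.ceil_lt_add_one (inv_pos.2 hh).le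
  refine ⟨⋃ j ∈ Finset.range (n + 1), Metric.closedBall (γ ((j : ℝ) / n, q)) (L * h),
    Finset.measurableSet_biUnion _ fun _ _ => Metric.isClosed_closedBall.measurableSet, ?_, ?_⟩
  · rintro _ ⟨⟨s, x⟩, ⟨hs, hx⟩, rfl⟩
    have hnpos : (0 : ℝ) < n := by exact_mod_cast hn0
    have hj0 : 0 ≤ s * n := mul_nonneg hs.1 hnpos.le
    have hj1 : (⌊s * n⌋₊ : ℝ) ≤ s * n := Nat.floor_le hj0
    have hj2 : s * n < ⌊s * n⌋₊ + 1 := Nat.lt_floor_add_one _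
    have hjn : ⌊s * n⌋₊ ≤ n := by
      have : (⌊s * n⌋₊ : ℝ) ≤ n := hj1.trans (by nlinarith [hs.2])
      exact_mod_cast this
    refine mem_biUnion (x := ⌊s * n⌋₊) (by simp; omega) ?_
    rw [Metric.mem_closedBall]
    have hmem : ((⌊s * n⌋₊ : ℝ) / n, q) ∈ Icc (0 : ℝ) 1 ×ˢ B := by
      refine ⟨⟨by positivity, ?_⟩, hHB hq⟩
      rw [div_le_one hnpos]; exact_mod_cast hjn
    refine (hγ.dist_le_mul (s, x) ⟨hs, hHB hx⟩ _ hmem).trans ?_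
    refine mul_le_mul_of_nonneg_left ?_ L.2
    rw [Prod.dist_eq]
    refine max_le ?_ (hH x hx q hq)
    simp only [Real.dist_eq]
    have e1 : s - ⌊s * n⌋₊ / n = (s * n - ⌊s * n⌋₊) / n := by field_simp
    rw [e1, abs_of_nonneg (by apply div_nonneg <;> linarith), div_le_iff₀ hnpos]
    have : 1 ≤ h * n := by
      have := mul_le_mul_of_nonneg_left hn1 hh.le
      rwa [mul_inv_cancel₀ hh.ne'] at this
    linarith
  · refine (measure_biUnion_finset_le _ _).trans ?_
    rw [Finset.sum_congr rfl fun j _ => volume_closedBall_eq _ (mul_nonneg L.coe_nonneg hh.le),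
      Finset.sum_const, Finset.card_range, nsmul_eq_mul]
    rw [← ENNReal.ofReal_natCast, ← ENNReal.ofReal_mul (by positivity)]
    refine ENNReal.ofReal_le_ofReal ?_
    have hb := (ballConst_pos (d := d)).le
    have h1 : ((n + 1 : ℕ) : ℝ) * h ≤ 1 + 2 * D := by
      push_cast
      have : (n : ℝ) * h ≤ 1 + h := by
        have := mul_le_mul_of_nonneg_right hn2.le hh.le
        rwa [add_mul, inv_mul_cancel₀ hh.ne', one_mul] at this
      linarith
    obtain ⟨k, rfl⟩ : ∃ k, d = k + 1 := ⟨d - 1, by omega⟩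
    simp only [Nat.add_sub_cancel]
    calc ((n + 1 : ℕ) : ℝ) * (ballConst (k + 1) * (L * h) ^ (k + 1))
        = (ballConst (k + 1) * L ^ (k + 1) * h ^ k) * (((n + 1 : ℕ) : ℝ) * h) := by ring
      _ ≤ (ballConst (k + 1) * L ^ (k + 1) * h ^ k) * (1 + 2 * D) :=
          mul_le_mul_of_nonneg_left h1 (by positivity)
      _ = _ := by ring

end CauchyFEM
end

noncomputable section
namespace CauchyFEM
variable {d : ℕ}

/-! ### Simplices and their facets -/

lemma sub_mem_vectorSpan_of_mem_hull {F : Finset (E d)} {x y : E d} (hx : x ∈ hull F)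
    (hy : y ∈ hull F) : x - y ∈ vectorSpan ℝ (F : Set (E d)) := by
  rw [← vectorSpan_hull]; exact vsub_mem_vectorSpan ℝ hx hy

lemma finrank_vectorSpan_eq {F : Finset (E d)} {n : ℕ}
    (hi : AffineIndependent ℝ ((↑) : F → E d)) (hc : F.card = n + 1) :
    Module.finrank ℝ (vectorSpan ℝ (F : Set (E d))) = n := by
  have h := hi.finrank_vectorSpan (n := n) (by simpa using hc)
  rwa [show range ((↑) : F → E d) = (F : Set (E d)) from Subtype.range_coe] at h

open Classical in
/-- The opposite vertex does not lie in the hyperplane of a facet. -/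
lemma sub_notMem_vectorSpan {F : Finset (E d)} {p : E d} (hp : p ∉ F)
    (hi : AffineIndependent ℝ ((↑) : {x // x ∈ insert p F} → E d)) {y : E d}
    (hy : y ∈ hull F) : p - y ∉ vectorSpan ℝ (F : Set (E d)) := by
  intro hmem
  have hne : F.Nonempty := by
    have := convexHull_nonempty_iff.1 ⟨y, hy⟩
    exact_mod_cast this
  have h1 := finrank_vectorSpan_eq hi (Finset.card_insert_of_notMem hp)
  have h2 := finrank_vectorSpan_lt hne
  have h3 : vectorSpan ℝ ((insert p F : Finset (E d)) : Set (E d))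
      ≤ vectorSpan ℝ (F : Set (E d)) := by
    have key : ∀ x ∈ insert p F, x - y ∈ vectorSpan ℝ (F : Set (E d)) := by
      intro x hx
      rcases Finset.mem_insert.1 hx with rfl | hx
      · exact hmem
      · exact sub_mem_vectorSpan_of_mem_hull (subset_convexHull ℝ _ hx) hy
    rw [vectorSpan_def, Submodule.span_le]
    rintro _ ⟨a, ha, b, hb, rfl⟩
    have := Submodule.sub_mem _ (key a ha) (key b hb)
    rw [sub_sub_sub_cancel_right] at this
    exact this
  have h4 := Submodule.finrank_mono h3
  omega

lemma mem_hull_insert [DecidableEq (E d)] {F : Finset (E d)} (hF : F.Nonempty) {p z : E d} :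
    z ∈ hull (insert p F) ↔ ∃ a b : ℝ, 0 ≤ a ∧ 0 ≤ b ∧ a + b = 1 ∧ ∃ y ∈ hull F,
      a • p + b • y = z := by
  rw [hull, Finset.coe_insert, convexHull_insert (by simpa using hF), mem_convexJoin]
  constructor
  · rintro ⟨_, rfl, y, hy, a, b, ha, hb, hab, h⟩
    exact ⟨a, b, ha, hb, hab, y, hy, h⟩
  · rintro ⟨a, b, ha, hb, hab, y, hy, h⟩
    exact ⟨p, rfl, y, hy, a, b, ha, hb, hab, h⟩

/-- A facet of a simplex that contains a ball of radius `r` contains a disk of radius `r`: slice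
the simplex through the centre of the ball parallel to the facet, and project the slice from the
opposite vertex. -/
lemma exists_disk_subset_hull [DecidableEq (E d)] {F : Finset (E d)} (hF : F.Nonempty) {p : E d}
    (hp : ∀ y ∈ hull F, p - y ∉ vectorSpan ℝ (F : Set (E d))) {x : E d} {r : ℝ} (hr : 0 < r)
    (hball : Metric.ball x r ⊆ hull (insert p F)) :
    ∃ q ∈ hull F, ∀ τ ∈ vectorSpan ℝ (F : Set (E d)), ‖τ‖ < r → q + τ ∈ hull F := by
  set V := vectorSpan ℝ (F : Set (E d)) with hV
  obtain ⟨a₀, b₀, ha₀, hb₀, hab₀, y₀, hy₀, hx⟩ := (mem_hull_insert hF).1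
    (hball (Metric.mem_ball_self hr))
  -- the coefficient of `p` is determined modulo the directions of the facet
  have huniq : ∀ (a : ℝ) (y z : E d), y ∈ hull F → z ∈ V →
      a • (p - y₀) + (1 - a) • (y - y₀) = z → a = 0 := by
    intro a y z hy hz h
    by_contra ha
    refine hp y₀ hy₀ ?_
    have : p - y₀ = a⁻¹ • (z - (1 - a) • (y - y₀)) := by
      rw [← h, add_sub_cancel_right, smul_smul, inv_mul_cancel₀ ha, one_smul]
    rw [this]
    exact V.smul_mem _ (V.sub_mem hz (V.smul_mem _ (sub_mem_vectorSpan_of_mem_hull hy hy₀)))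
  have hcoef : ∀ (a b t : ℝ) (y τ : E d), a + b = 1 → y ∈ hull F → τ ∈ V →
      a • p + b • y = x + τ + t • (p - y₀) → a = a₀ + t := by
    intro a b t y τ hab hy hτ h
    by_contra hne
    refine hp y₀ hy₀ ?_
    have e : (a - a₀ - t) • (p - y₀) = τ - b • (y - y₀) := by
      have hb : b = 1 - a := by linarith
      have hb0 : b₀ = 1 - a₀ := by linarith
      rw [← hx, hb, hb0] at h
      rw [hb, sub_smul, sub_smul]
      have : τ = a • p + (1 - a) • y - (a₀ • p + (1 - a₀) • y₀) - t • (p - y₀) := by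
        rw [h]; abel
      rw [this]
      module
    have hne' : a - a₀ - t ≠ 0 := fun h0 => hne (by linarith)
    have : p - y₀ = (a - a₀ - t)⁻¹ • (τ - b • (y - y₀)) := by
      rw [← e, smul_smul, inv_mul_cancel₀ hne', one_smul]
    rw [this]
    exact V.smul_mem _ (V.sub_mem hτ (V.smul_mem _ (sub_mem_vectorSpan_of_mem_hull hy hy₀)))
  have hb₀pos : 0 < b₀ := by
    rcases hb₀.lt_or_eq with h | h
    · exact h
    exfalso
    have hpy : p - y₀ ≠ 0 := fun h0 => hp y₀ hy₀ (h0 ▸ V.zero_mem)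
    have hn : 0 < ‖p - y₀‖ := norm_pos_iff.2 hpy
    set t := r / (2 * ‖p - y₀‖) with ht
    have htpos : 0 < t := by positivity
    have hmem : x + 0 + t • (p - y₀) ∈ Metric.ball x r := by
      rw [mem_ball_iff_norm, add_zero, add_sub_cancel_left, norm_smul, Real.norm_of_nonneg htpos.le,
        ht, div_mul_eq_mul_div, div_lt_iff₀ (by positivity)]
      nlinarith
    obtain ⟨a, b, ha, hb, hab, y, hy, e⟩ := (mem_hull_insert hF).1 (hball hmem)
    have := hcoef a b t y 0 hab hy V.zero_mem e
    linarith
  refine ⟨y₀, hy₀, fun τ hτ hτr => ?_⟩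
  have hmem : x + τ + (0 : ℝ) • (p - y₀) ∈ Metric.ball x r := by
    rw [mem_ball_iff_norm, zero_smul, add_zero, add_sub_cancel_left]; exact hτr
  obtain ⟨a, b, ha, hb, hab, y, hy, e⟩ := (mem_hull_insert hF).1 (hball hmem)
  have haa := hcoef a b 0 y τ hab hy hτ e
  have hbb : b = b₀ := by linarith
  rw [zero_smul, add_zero, ← hx, hbb, show a = a₀ by linarith, add_assoc, add_left_cancel_iff] at e
  have e2 : y₀ + τ = (1 - b₀) • y₀ + b₀ • y := by
    rw [e]; module
  rw [e2]
  exact (convex_convexHull ℝ _) hy₀ hy (by linarith) hb₀ (by ring)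

namespace Mesh
open Classical

variable {Ω : Set (E d)} (T : Mesh Ω)

lemma mem_cells {s : Finset (E d)} : s ∈ T.cells ↔ s ∈ T.faces ∧ s.card = d + 1 := by
  simp [cells]

variable {T}

lemma closure_eq : closure Ω = ⋃ s ∈ T.cells, hull s := by
  rw [← T.covers]
  refine Subset.antisymm ?_ (iUnion₂_subset fun s hs =>
    Geometry.SimplicialComplex.convexHull_subset_space (T.mem_cells.1 hs).1)
  intro x hx
  obtain ⟨s, hs, hxs⟩ := Geometry.SimplicialComplex.mem_space_iff.1 hx
  obtain ⟨t, ht, hst, hc⟩ := T.pure s hs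
  exact mem_biUnion (T.mem_cells.2 ⟨ht, hc⟩) (convexHull_mono (by exact_mod_cast hst) hxs)

lemma hull_subset_closure {s : Finset (E d)} (hs : s ∈ T.cells) : hull s ⊆ closure Ω := by
  rw [closure_eq (T := T)]; exact subset_biUnion_of_mem (u := fun s => hull s) hs

lemma exists_cell {x : E d} (hx : x ∈ closure Ω) : ∃ s ∈ T.cells, x ∈ hull s := by
  rw [closure_eq (T := T)] at hx; simpa using hx

lemma interior_hull_subset (hreg : interior (closure Ω) = Ω) {s : Finset (E d)}
    (hs : s ∈ T.cells) : interior (hull s) ⊆ Ω := by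
  rw [← hreg]; exact interior_mono (hull_subset_closure hs)

lemma isCompact_hull (s : Finset (E d)) : IsCompact (hull s) :=
  s.finite_toSet.isCompact_convexHull ℝ

lemma isCompact_closure (T : Mesh Ω) : IsCompact (closure Ω) := by
  rw [closure_eq (T := T)]
  exact T.cells.isCompact_biUnion fun s _ => isCompact_hull s

lemma measurableSet_hull (s : Finset (E d)) : MeasurableSet (hull s) :=
  (isCompact_hull s).isClosed.measurableSet

lemma mem_hull_inter {s t : Finset (E d)} (hs : s ∈ T.cells) (ht : t ∈ T.cells) {x : E d}
    (hxs : x ∈ hull s) (hxt : x ∈ hull t) : x ∈ hull (s ∩ t) := by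
  have := T.inter_subset_convexHull (T.mem_cells.1 hs).1 (T.mem_cells.1 ht).1 ⟨hxs, hxt⟩
  rwa [← Finset.coe_inter] at this

lemma card_inter_le {s t : Finset (E d)} (hs : s ∈ T.cells) (ht : t ∈ T.cells) (hst : s ≠ t) :
    (s ∩ t).card ≤ d := by
  have h1 := (T.mem_cells.1 hs).2
  have h2 := (T.mem_cells.1 ht).2
  by_contra h
  have h3 : s ∩ t = s := Finset.eq_of_subset_of_card_le Finset.inter_subset_left (by omega)
  have h4 : s ∩ t = t := Finset.eq_of_subset_of_card_le Finset.inter_subset_right (by omega)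
  exact hst (h3.symm.trans h4)

lemma nonempty_of_mem_hull {e : Finset (E d)} {x : E d} (hx : x ∈ hull e) : e.Nonempty := by
  have := convexHull_nonempty_iff.1 ⟨x, hx⟩
  exact_mod_cast this

lemma volume_hull_inter {s t : Finset (E d)} (hs : s ∈ T.cells) (ht : t ∈ T.cells)
    (hst : s ≠ t) : volume (hull s ∩ hull t) = 0 :=
  measure_mono_null (fun _ hx => mem_hull_inter hs ht hx.1 hx.2)
    (volume_hull_eq_zero (card_inter_le hs ht hst))

lemma dist_le_h {s : Finset (E d)} (hs : s ∈ T.cells) {x y : E d} (hx : x ∈ hull s)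
    (hy : y ∈ hull s) : dist x y ≤ T.h := by
  refine (Metric.dist_le_diam_of_mem (isCompact_hull s).isBounded hx hy).trans ?_
  exact le_csSup ((T.cells.finite_toSet.image _).bddAbove) ⟨s, hs, rfl⟩

lemma h_le (T : Mesh Ω) : T.h ≤ Metric.diam (closure Ω) := by
  refine Real.sSup_le ?_ Metric.diam_nonneg
  rintro _ ⟨s, hs, rfl⟩
  exact Metric.diam_mono (hull_subset_closure hs) T.isCompact_closure.isBounded

lemma volume_hull_le {s : Finset (E d)} (hs : s ∈ T.cells) :
    volume (hull s) ≤ ENNReal.ofReal (ballConst d * T.h ^ d) := by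
  rcases (hull s).eq_empty_or_nonempty with h | ⟨x, hx⟩
  · simp [h]
  have hh : 0 ≤ T.h := dist_nonneg.trans (dist_le_h hs hx hx)
  rw [← volume_closedBall_eq x hh]
  exact measure_mono fun y hy => dist_le_h hs hy hx

/-- Volume count: cells of inradius at least `r` that lie in a set `M` are at most
`|M| / (c rᵈ)` in number. -/
lemma card_mul_le {r : ℝ} (hr : 0 < r) (hb : ∀ s ∈ T.cells, ∃ x, Metric.ball x r ⊆ hull s)
    {𝒮 : Finset (Finset (E d))} (h𝒮 : 𝒮 ⊆ T.cells) {M : Set (E d)} (hM : ∀ s ∈ 𝒮, hull s ⊆ M)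
    {m : ℝ} (hm : 0 ≤ m) (hMm : volume M ≤ ENNReal.ofReal m) :
    (𝒮.card : ℝ) * (ballConst d * r ^ d) ≤ m := by
  have h1 : volume (⋃ s ∈ 𝒮, hull s) = ∑ s ∈ 𝒮, volume (hull s) := by
    refine measure_biUnion_finset₀ ?_ fun s _ => (measurableSet_hull s).nullMeasurableSet
    intro s hs t ht hst
    exact volume_hull_inter (h𝒮 hs) (h𝒮 ht) hst
  have h2 : ∑ s ∈ 𝒮, ENNReal.ofReal (ballConst d * r ^ d) ≤ ∑ s ∈ 𝒮, volume (hull s) := by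
    refine Finset.sum_le_sum fun s hs => ?_
    obtain ⟨x, hx⟩ := hb s (h𝒮 hs)
    rw [← volume_ball_eq x hr]
    exact measure_mono hx
  have h3 := (h2.trans_eq h1.symm).trans ((measure_mono (iUnion₂_subset hM)).trans hMm)
  rw [Finset.sum_const, nsmul_eq_mul, ← ENNReal.ofReal_natCast,
    ← ENNReal.ofReal_mul (by positivity)] at h3
  exact (ENNReal.ofReal_le_ofReal_iff hm).1 h3

/-! ### Facets of a mesh and their normals -/

lemma exists_eq_insert {s F : Finset (E d)} (hs : s ∈ T.cells) (hFs : F ⊆ s) (hF : F.card = d) :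
    ∃ p, p ∉ F ∧ s = insert p F := by
  have h1 := (T.mem_cells.1 hs).2
  obtain ⟨p, hp⟩ := Finset.card_eq_one.1 (show (s \ F).card = 1 by
    rw [Finset.card_sdiff_of_subset hFs]; omega)
  have hp' : p ∈ s \ F := by simp [hp]
  refine ⟨p, (Finset.mem_sdiff.1 hp').2, ?_⟩
  rw [← Finset.sdiff_union_of_subset hFs, hp]; rfl

lemma insert_mem_sub_notMem {F : Finset (E d)} {p y : E d} (hp : p ∉ F)
    (hs : insert p F ∈ T.cells) (hy : y ∈ hull F) : p - y ∉ vectorSpan ℝ (F : Set (E d)) :=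
  sub_notMem_vectorSpan hp (T.indep (T.mem_cells.1 hs).1) hy

lemma finrank_facet {s F : Finset (E d)} (hd : 1 ≤ d) (hs : s ∈ T.cells) (hFs : F ⊆ s)
    (hF : F.card = d) : Module.finrank ℝ (vectorSpan ℝ (F : Set (E d))) = d - 1 := by
  have hne : F.Nonempty := Finset.card_pos.1 (by omega)
  exact finrank_vectorSpan_eq (T.indep (T.down_closed (T.mem_cells.1 hs).1 hFs hne)) (by omega)

lemma exists_disk {s F : Finset (E d)} (hd : 1 ≤ d) (hs : s ∈ T.cells) (hFs : F ⊆ s)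
    (hF : F.card = d) {r : ℝ} (hr : 0 < r) {x : E d} (hb : Metric.ball x r ⊆ hull s) :
    ∃ q ∈ hull F, ∀ τ ∈ vectorSpan ℝ (F : Set (E d)), ‖τ‖ < r → q + τ ∈ hull F := by
  obtain ⟨p, hp, rfl⟩ := exists_eq_insert hs hFs hF
  exact exists_disk_subset_hull (Finset.card_pos.1 (by omega))
    (fun y hy => insert_mem_sub_notMem hp hs hy) hr hb

lemma centroid_eq {s : Finset (E d)} (hs : s.Nonempty) :
    s.centroid ℝ id = (s.card : ℝ)⁻¹ • ∑ x ∈ s, x := by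
  rw [Finset.centroid_eq_centerMass _ hs, Finset.centerMass]
  simp only [Finset.centroidWeights_apply, Finset.sum_const, id]
  rw [← Finset.smul_sum, nsmul_eq_mul, mul_inv_cancel₀, inv_one, one_smul]
  exact_mod_cast hs.card_pos.ne'

lemma centroid_mem_hull {s : Finset (E d)} (hs : s.Nonempty) : s.centroid ℝ id ∈ hull s := by
  have := Finset.centroid_mem_convexHull (R := ℝ) s hs
  exact this

/-- The outward normal of the simplex with facet `F` and opposite vertex `p` is a negative
multiple of the component of `p - y` orthogonal to `F`. -/
lemma exists_outwardNormal_eq {F : Finset (E d)} {p y : E d} (hp : p ∉ F) (hF : F.Nonempty)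
    (hpV : p - y ∉ vectorSpan ℝ (F : Set (E d))) (hy : y ∈ hull F) :
    ∃ c : ℝ, 0 < c ∧ outwardNormal (insert p F) F
      = -(c • (vectorSpan ℝ (F : Set (E d)))ᗮ.starProjection (p - y)) ∧
      ‖outwardNormal (insert p F) F‖ = 1 := by
  set V := vectorSpan ℝ (F : Set (E d)) with hV
  have hn0 : (F.card : ℝ) + 1 ≠ 0 := by positivity
  have hn1 : (F.card : ℝ) ≠ 0 := by exact_mod_cast hF.card_pos.ne'
  have e1 : F.centroid ℝ id - (insert p F).centroid ℝ id
      = ((F.card : ℝ) + 1)⁻¹ • (F.centroid ℝ id - p) := by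
    rw [centroid_eq hF, centroid_eq (Finset.insert_nonempty _ _),
      Finset.card_insert_of_notMem hp, Finset.sum_insert hp]
    push_cast
    set S := ∑ x ∈ F, x
    have : ((F.card : ℝ) + 1)⁻¹ • ((F.card : ℝ)⁻¹ • S - p)
      = (((F.card : ℝ) + 1)⁻¹ * (F.card : ℝ)⁻¹) • S - ((F.card : ℝ) + 1)⁻¹ • p := by
      rw [smul_sub, smul_smul]
    rw [this, smul_add]
    have h2 : (F.card : ℝ)⁻¹ = ((F.card : ℝ) + 1)⁻¹ * (F.card : ℝ)⁻¹ + ((F.card : ℝ) + 1)⁻¹ := by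
      field_simp
      ring
    nth_rewrite 1 [h2]
    rw [add_smul]; abel
  have e2 : Vᗮ.starProjection (F.centroid ℝ id - p) = - Vᗮ.starProjection (p - y) := by
    have hz : Vᗮ.starProjection (F.centroid ℝ id - y) = 0 := by
      rw [Submodule.starProjection_apply_eq_zero_iff, Submodule.orthogonal_orthogonal]
      exact sub_mem_vectorSpan_of_mem_hull (centroid_mem_hull hF) hy
    rw [show F.centroid ℝ id - p = (F.centroid ℝ id - y) - (p - y) by abel, map_sub, hz, zero_sub]
  have hne : Vᗮ.starProjection (p - y) ≠ 0 := by
    rw [Ne, Submodule.starProjection_apply_eq_zero_iff, Submodule.orthogonal_orthogonal]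
    exact hpV
  have e3 : Vᗮ.starProjection (F.centroid ℝ id - (insert p F).centroid ℝ id)
      = -(((F.card : ℝ) + 1)⁻¹ • Vᗮ.starProjection (p - y)) := by
    rw [e1, map_smul, e2, smul_neg]
  have hne' : Vᗮ.starProjection (F.centroid ℝ id - (insert p F).centroid ℝ id) ≠ 0 := by
    rw [e3, neg_ne_zero]; exact smul_ne_zero (inv_ne_zero hn0) hne
  set w := Vᗮ.starProjection (F.centroid ℝ id - (insert p F).centroid ℝ id) with hw
  have hwn : 0 < ‖w‖ := norm_pos_iff.2 hne'
  have hdef : outwardNormal (insert p F) F = ‖w‖⁻¹ • w := rfl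
  refine ⟨‖w‖⁻¹ * ((F.card : ℝ) + 1)⁻¹, by positivity, ?_, ?_⟩
  · rw [hdef, ← smul_smul, ← smul_neg, ← e3]
  · rw [hdef, norm_smul, norm_inv, norm_norm, inv_mul_cancel₀ hwn.ne']

lemma outwardNormal_mem {s F : Finset (E d)} :
    outwardNormal s F ∈ (vectorSpan ℝ (F : Set (E d)))ᗮ :=
  Submodule.smul_mem _ _ (Submodule.starProjection_apply_mem _ _)

lemma norm_outwardNormal {s F : Finset (E d)} (hd : 1 ≤ d) (hs : s ∈ T.cells) (hFs : F ⊆ s)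
    (hF : F.card = d) : ‖outwardNormal s F‖ = 1 := by
  obtain ⟨p, hp, rfl⟩ := exists_eq_insert hs hFs hF
  have hne : F.Nonempty := Finset.card_pos.1 (by omega)
  obtain ⟨y, hy⟩ := hne
  have hyh : y ∈ hull F := subset_convexHull ℝ _ hy
  obtain ⟨c, -, -, h⟩ := exists_outwardNormal_eq hp ⟨y, hy⟩ (insert_mem_sub_notMem hp hs hyh) hyh
  exact h

/-- The orthogonal complement of a facet is spanned by the normal: removing the normal component of
a vector leaves a tangential one. -/
lemma sub_inner_normal_mem {s F : Finset (E d)} (hd : 1 ≤ d) (hs : s ∈ T.cells) (hFs : F ⊆ s)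
    (hF : F.card = d) (v : E d) :
    v - (inner ℝ v (outwardNormal s F) : ℝ) • outwardNormal s F
      ∈ vectorSpan ℝ (F : Set (E d)) := by
  set V := vectorSpan ℝ (F : Set (E d)) with hV
  set n := outwardNormal s F with hn
  have hnorm : ‖n‖ = 1 := norm_outwardNormal hd hs hFs hF
  have hnV : n ∈ Vᗮ := outwardNormal_mem
  have h1 : Module.finrank ℝ Vᗮ = 1 := by
    have := Submodule.finrank_add_finrank_orthogonal V
    rw [finrank_facet hd hs hFs hF, finrank_euclideanSpace_fin] at this
    omega
  have hne : (⟨n, hnV⟩ : Vᗮ) ≠ 0 := by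
    intro h
    have : n = 0 := congrArg Subtype.val h
    rw [this, norm_zero] at hnorm; exact zero_ne_one hnorm
  rw [← Submodule.orthogonal_orthogonal V, Submodule.mem_orthogonal]
  intro u hu
  obtain ⟨c, hc⟩ := (finrank_eq_one_iff_of_nonzero' _ hne).1 h1 ⟨u, hu⟩
  have hc' : u = c • n := (congrArg Subtype.val hc).symm
  rw [hc', inner_sub_right, inner_smul_right, real_inner_smul_left, real_inner_smul_left,
    real_inner_self_eq_norm_sq, hnorm, real_inner_comm]
  ring

/-- Two cells that share a facet lie on opposite sides of it. -/
lemma outwardNormal_eq_neg {s t F : Finset (E d)} (hd : 1 ≤ d) (hs : s ∈ T.cells)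
    (ht : t ∈ T.cells) (hst : s ≠ t) (hFs : F ⊆ s) (hFt : F ⊆ t) (hF : F.card = d) {r : ℝ}
    (hr : 0 < r) {x : E d} (hb : Metric.ball x r ⊆ hull s) :
    outwardNormal t F = - outwardNormal s F := by
  obtain ⟨q, hq, hdisk⟩ := exists_disk hd hs hFs hF hr hb
  have hinter : s ∩ t = F := by
    refine (Finset.eq_of_subset_of_card_le (Finset.subset_inter hFs hFt) ?_).symm
    rw [hF]; exact card_inter_le hs ht hst
  obtain ⟨p, hp, hsp⟩ := exists_eq_insert hs hFs hF
  obtain ⟨p', hp', htp⟩ := exists_eq_insert ht hFt hF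
  have hne : F.Nonempty := Finset.card_pos.1 (by omega)
  have hpV : p - q ∉ vectorSpan ℝ (F : Set (E d)) := insert_mem_sub_notMem hp (hsp ▸ hs) hq
  have hpV' : p' - q ∉ vectorSpan ℝ (F : Set (E d)) := insert_mem_sub_notMem hp' (htp ▸ ht) hq
  obtain ⟨c, hc, hcn, hcn1⟩ := exists_outwardNormal_eq hp hne hpV hq
  obtain ⟨c', hc', hcn', hcn1'⟩ := exists_outwardNormal_eq hp' hne hpV' hq
  rw [← hsp] at hcn hcn1
  rw [← htp] at hcn' hcn1'
  set V := vectorSpan ℝ (F : Set (E d)) with hV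
  have hdiff : outwardNormal t F - (inner ℝ (outwardNormal t F) (outwardNormal s F) : ℝ) •
      outwardNormal s F = 0 := by
    have h1 := sub_inner_normal_mem hd hs hFs hF (outwardNormal t F)
    have h2 : outwardNormal t F - (inner ℝ (outwardNormal t F) (outwardNormal s F) : ℝ) •
      outwardNormal s F ∈ Vᗮ := Vᗮ.sub_mem outwardNormal_mem (Vᗮ.smul_mem _ outwardNormal_mem)
    exact (Submodule.mem_bot ℝ).1 ((Submodule.inf_orthogonal_eq_bot V) ▸ ⟨h1, h2⟩)
  set k : ℝ := inner ℝ (outwardNormal t F) (outwardNormal s F) with hk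
  rw [sub_eq_zero] at hdiff
  have habs : |k| = 1 := by
    have := congrArg norm hdiff
    rw [hcn1', norm_smul, hcn1, mul_one, Real.norm_eq_abs] at this
    exact this.symm
  rcases eq_or_eq_neg_of_abs_eq habs with h1 | h1
  swap
  · rw [hdiff, h1, neg_one_smul]
  exfalso
  rw [h1, one_smul, hcn, hcn', neg_inj] at hdiff
  -- the two vertices lie on the same side, hence the two cells overlap near `q`
  set l := c / c' with hl
  have hlpos : 0 < l := by positivity
  have hτ : (p' - q) - l • (p - q) ∈ V := by
    rw [← Submodule.orthogonal_orthogonal V, ← Submodule.starProjection_apply_eq_zero_iff, map_sub,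
      map_smul, hl, div_eq_inv_mul, ← smul_smul, ← hdiff, smul_smul, inv_mul_cancel₀ hc'.ne',
      one_smul, sub_self]
  set τ := (p' - q) - l • (p - q) with hτdef
  obtain ⟨ε, hε, hε1, hεl, hετ⟩ : ∃ ε : ℝ, 0 < ε ∧ ε ≤ 1 ∧ ε * l ≤ 1 / 2 ∧ 2 * ε * ‖τ‖ < r := by
    have : Tendsto (fun ε : ℝ => ε * l) (𝓝[>] 0) (𝓝 0) := by
      have : Tendsto (fun ε : ℝ => ε * l) (𝓝 0) (𝓝 (0 * l)) :=
        (continuous_id.mul continuous_const).tendsto 0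
      rw [zero_mul] at this; exact this.mono_left nhdsWithin_le_nhds
    have h2 : Tendsto (fun ε : ℝ => 2 * ε * ‖τ‖) (𝓝[>] 0) (𝓝 0) := by
      have : Tendsto (fun ε : ℝ => 2 * ε * ‖τ‖) (𝓝 0) (𝓝 (2 * 0 * ‖τ‖)) :=
        ((continuous_const.mul continuous_id).mul continuous_const).tendsto 0
      rw [mul_zero, zero_mul] at this; exact this.mono_left nhdsWithin_le_nhds
    have h3 : Tendsto (fun ε : ℝ => ε) (𝓝[>] 0) (𝓝 0) := tendsto_id.mono_left nhdsWithin_le_nhds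
    obtain ⟨ε, h4, h5, h6, h7⟩ := ((this.eventually
      (gt_mem_nhds (show (0:ℝ) < 1 / 2 by norm_num))).and
      ((h2.eventually (gt_mem_nhds hr)).and ((h3.eventually (gt_mem_nhds one_pos)).and
        self_mem_nhdsWithin))).exists
    exact ⟨ε, h7, h6.le, h4.le, h5⟩
  have hx1 : q + ε • (p' - q) ∈ hull t := by
    have hp't : p' ∈ hull t := subset_convexHull ℝ _ (by rw [htp]; simp)
    have hqt : q ∈ hull t := convexHull_mono (by exact_mod_cast hFt) hq
    have := (convex_convexHull ℝ (t : Set (E d))) hqt hp't (show 0 ≤ 1 - ε by linarith) hε.le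
      (by ring)
    convert this using 1; module
  have hx2 : q + ε • (p' - q) ∈ hull s := by
    have hps : p ∈ hull s := subset_convexHull ℝ _ (by rw [hsp]; simp)
    have hpos : 0 < 1 - ε * l := by linarith
    have hq2 : q + (ε / (1 - ε * l)) • τ ∈ hull F := by
      refine hdisk _ (V.smul_mem _ hτ) ?_
      rw [norm_smul, Real.norm_of_nonneg (by positivity)]
      refine lt_of_le_of_lt ?_ hετ
      refine mul_le_mul_of_nonneg_right ?_ (norm_nonneg _)
      rw [div_le_iff₀ hpos]
      nlinarith
    have hqs : q + (ε / (1 - ε * l)) • τ ∈ hull s := convexHull_mono (by exact_mod_cast hFs) hq2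
    have := (convex_convexHull ℝ (s : Set (E d))) hqs hps hpos.le (mul_pos hε hlpos).le
      (by ring)
    have e : (1 - ε * l) • (q + (ε / (1 - ε * l)) • τ) + (ε * l) • p = q + ε • (p' - q) := by
      rw [smul_add, smul_smul, mul_div_cancel₀ _ hpos.ne', hτdef]
      module
    rwa [e] at this
  have hx3 := mem_hull_inter hs ht hx2 hx1
  rw [hinter] at hx3
  have := sub_mem_vectorSpan_of_mem_hull hx3 hq
  rw [add_sub_cancel_left] at this
  refine hpV' ?_
  have h2 := V.smul_mem ε⁻¹ this
  rwa [smul_smul, inv_mul_cancel₀ hε.ne', one_smul] at h2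

lemma mem_adj {s F : Finset (E d)} : s ∈ T.adj F ↔ s ∈ T.cells ∧ F ⊆ s := by simp [adj]

/-- At most two cells share a facet. -/
lemma adj_eq_pair {s t F : Finset (E d)} (hd : 1 ≤ d) {r : ℝ} (hr : 0 < r)
    (hb : ∀ s ∈ T.cells, ∃ x, Metric.ball x r ⊆ hull s) (hs : s ∈ T.cells) (ht : t ∈ T.cells)
    (hst : s ≠ t) (hFs : F ⊆ s) (hFt : F ⊆ t) (hF : F.card = d) : T.adj F = {s, t} := by
  ext u
  rw [mem_adj, Finset.mem_insert, Finset.mem_singleton]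
  constructor
  · rintro ⟨hu, hFu⟩
    by_contra! h
    obtain ⟨x, hx⟩ := hb s hs
    obtain ⟨y, hy⟩ := hb u hu
    have h1 := outwardNormal_eq_neg hd hs ht hst hFs hFt hF hr hx
    have h2 := outwardNormal_eq_neg hd hs hu h.1.symm hFs hFu hF hr hx
    have h3 := outwardNormal_eq_neg hd hu ht h.2 hFu hFt hF hr hy
    have h4 := norm_outwardNormal hd hs hFs hF
    rw [h1, h2, neg_neg] at h3
    have : outwardNormal s F = 0 := by
      have h5 : (2 : ℝ) • outwardNormal s F = 0 := by
        rw [two_smul]; nth_rewrite 1 [← h3]; rw [neg_add_cancel]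
      simpa using h5
    rw [this, norm_zero] at h4
    exact zero_ne_one h4
  · rintro (rfl | rfl)
    exacts [⟨hs, hFs⟩, ⟨ht, hFt⟩]

end Mesh

end CauchyFEM
end

noncomputable section
namespace CauchyFEM
variable {d : ℕ}
namespace Mesh
open Classical

variable {Ω : Set (E d)} {T : Mesh Ω}

/-! ### Jumps of cellwise constant functions along segments -/

variable (T) in
/-- The ordered pairs of cells that share a facet. -/
def pairs : Finset (Finset (E d) × Finset (E d)) :=
  (T.cells ×ˢ T.cells).filter fun p => (p.1 ∩ p.2).card = d

lemma mem_pairs {p : Finset (E d) × Finset (E d)} :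
    p ∈ T.pairs ↔ (p.1 ∈ T.cells ∧ p.2 ∈ T.cells) ∧ (p.1 ∩ p.2).card = d := by
  simp [pairs]

variable (T) in
/-- The pairs of neighbouring cells whose common facet meets the segment `[x, y]`. -/
def crossed (x y : E d) : Finset (Finset (E d) × Finset (E d)) :=
  T.pairs.filter fun p => (segment ℝ x y ∩ hull (p.1 ∩ p.2)).Nonempty

/-- One-sided version of `abs_sub_le_sum_crossed`. Every level between the two values separates
the cells along the segment into two closed sets; these meet, by connectedness, in a crossed
facet whose jump contains that level. -/
lemma sub_le_sum_crossed {x y : E d} (hseg : segment ℝ x y ⊆ closure Ω)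
    (hgen : ∀ e ∈ T.faces, e.card < d → segment ℝ x y ∩ hull e = ∅) {K K' : Finset (E d)}
    (hK : K ∈ T.cells) (hx : x ∈ hull K) (hK' : K' ∈ T.cells) (hy : y ∈ hull K')
    (q : Finset (E d) → ℝ) :
    q K' - q K ≤ ∑ p ∈ T.crossed x y, |q p.1 - q p.2| := by
  have hcover : Ico (q K) (q K') ⊆ ⋃ p ∈ T.crossed x y, Ico (q p.1) (q p.2) := by
    intro l hl
    set A : Set (E d) := ⋃ s ∈ T.cells.filter fun s => q s ≤ l, hull s with hA
    set B : Set (E d) := ⋃ s ∈ T.cells.filter fun s => ¬ q s ≤ l, hull s with hB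
    have hAc : IsClosed A := (Finset.isCompact_biUnion _ fun s _ => isCompact_hull s).isClosed
    have hBc : IsClosed B := (Finset.isCompact_biUnion _ fun s _ => isCompact_hull s).isClosed
    have hAB : segment ℝ x y ⊆ A ∪ B := by
      intro z hz
      obtain ⟨s, hs, hzs⟩ := exists_cell (T := T) (hseg hz)
      by_cases h : q s ≤ l
      · exact Or.inl (mem_biUnion (Finset.mem_coe.2 (Finset.mem_filter.2 ⟨hs, h⟩)) hzs)
      · exact Or.inr (mem_biUnion (Finset.mem_coe.2 (Finset.mem_filter.2 ⟨hs, h⟩)) hzs)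
    obtain ⟨z, hz, hzA, hzB⟩ := isPreconnected_closed_iff.1 (convex_segment x y).isPreconnected
      A B hAc hBc hAB
      ⟨x, left_mem_segment ℝ x y,
        mem_biUnion (Finset.mem_coe.2 (Finset.mem_filter.2 ⟨hK, hl.1⟩)) hx⟩
      ⟨y, right_mem_segment ℝ x y,
        mem_biUnion (Finset.mem_coe.2 (Finset.mem_filter.2 ⟨hK', not_le.2 hl.2⟩)) hy⟩
    obtain ⟨s, hs, hzs⟩ := mem_iUnion₂.1 hzA
    obtain ⟨t, ht, hzt⟩ := mem_iUnion₂.1 hzB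
    obtain ⟨hs, hsl⟩ := Finset.mem_filter.1 hs
    obtain ⟨ht, htl⟩ := Finset.mem_filter.1 ht
    have hst : s ≠ t := fun h => htl (h ▸ hsl)
    have hzst := mem_hull_inter hs ht hzs hzt
    have hface : s ∩ t ∈ T.faces := T.down_closed (T.mem_cells.1 hs).1 Finset.inter_subset_left
      (nonempty_of_mem_hull hzst)
    have hcard : (s ∩ t).card = d := by
      refine le_antisymm (card_inter_le hs ht hst) (not_lt.1 fun h => ?_)
      have := hgen _ hface h
      exact this.subset ⟨hz, hzst⟩
    refine mem_biUnion (x := (s, t)) (Finset.mem_coe.2 (Finset.mem_filter.2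
      ⟨mem_pairs.2 ⟨⟨hs, ht⟩, hcard⟩, ⟨z, hz, hzst⟩⟩)) ⟨hsl, not_le.1 htl⟩
  have h := (measure_mono (μ := volume) hcover).trans (measure_biUnion_finset_le _ _)
  simp only [Real.volume_Ico] at h
  have h2 : ∑ p ∈ T.crossed x y, ENNReal.ofReal (q p.2 - q p.1)
      ≤ ENNReal.ofReal (∑ p ∈ T.crossed x y, |q p.1 - q p.2|) := by
    rw [ENNReal.ofReal_sum_of_nonneg fun _ _ => abs_nonneg _]
    refine Finset.sum_le_sum fun p _ => ENNReal.ofReal_le_ofReal ?_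
    rw [abs_sub_comm]; exact le_abs_self _
  exact (ENNReal.ofReal_le_ofReal_iff (Finset.sum_nonneg fun _ _ => abs_nonneg _)).1 (h.trans h2)

/-- Along a segment that misses all faces of codimension at least two, a cellwise constant
function varies by at most the sum of its jumps over the crossed facets. -/
lemma abs_sub_le_sum_crossed {x y : E d} (hseg : segment ℝ x y ⊆ closure Ω)
    (hgen : ∀ e ∈ T.faces, e.card < d → segment ℝ x y ∩ hull e = ∅) {K K' : Finset (E d)}
    (hK : K ∈ T.cells) (hx : x ∈ hull K) (hK' : K' ∈ T.cells) (hy : y ∈ hull K')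
    (q : Finset (E d) → ℝ) :
    |q K - q K'| ≤ ∑ p ∈ T.crossed x y, |q p.1 - q p.2| := by
  refine abs_sub_le_iff.2 ⟨?_, sub_le_sum_crossed hseg hgen hK hx hK' hy q⟩
  have h := sub_le_sum_crossed (T := T) (x := y) (y := x) (by rwa [segment_symm])
    (by rwa [segment_symm]) hK' hy hK hx q
  rwa [crossed, segment_symm, ← crossed] at h

/-- Bound for the number of crossed facets, times the mesh size. -/
def crossConst (d : ℕ) (ρ D : ℝ) : ℝ :=
  (2 / ρ) ^ d * ((D + 1) ^ d * (1 + 2 * (2 * D)) * 2 ^ (d - 1) / ρ ^ d)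

lemma crossConst_nonneg {ρ D : ℝ} (hρ : 0 < ρ) (hD : 0 ≤ D) : 0 ≤ crossConst d ρ D := by
  unfold crossConst; positivity

/-- The number of neighbours of a cell is bounded. -/
lemma card_neighbours_le {ρ : ℝ} (hρ : 0 < ρ) (hh : 0 < T.h)
    (hb : ∀ s ∈ T.cells, ∃ x, Metric.ball x (ρ * T.h) ⊆ hull s) (hd : 1 ≤ d) {s : Finset (E d)}
    (hs : s ∈ T.cells) :
    ((T.cells.filter fun t => (s ∩ t).card = d).card : ℝ) ≤ (2 / ρ) ^ d := by
  have hsne : s.Nonempty := Finset.card_pos.1 (by rw [(T.mem_cells.1 hs).2]; omega)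
  obtain ⟨x₀, hx₀⟩ := hsne
  have hx₀' : x₀ ∈ hull s := subset_convexHull ℝ _ hx₀
  have h := card_mul_le (mul_pos hρ hh) hb (Finset.filter_subset (fun t => (s ∩ t).card = d) _)
    (M := Metric.closedBall x₀ (2 * T.h)) ?_ (m := ballConst d * (2 * T.h) ^ d)
    (by have := (ballConst_pos (d := d)).le; positivity)
    (volume_closedBall_eq _ (by positivity)).le
  · have hbc := ballConst_pos (d := d)
    have e : (2 / ρ) ^ d * (ballConst d * (ρ * T.h) ^ d) = ballConst d * (2 * T.h) ^ d := by
      rw [div_pow, mul_pow, mul_pow]; field_simp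
    rw [← e] at h
    exact le_of_mul_le_mul_right h (by positivity)
  · intro t ht z hz
    obtain ⟨ht, hc⟩ := Finset.mem_filter.1 ht
    obtain ⟨p, hp⟩ := Finset.card_pos.1 (show 0 < (s ∩ t).card by omega)
    have hps : p ∈ hull s := subset_convexHull ℝ _ (Finset.mem_inter.1 hp).1
    have hpt : p ∈ hull t := subset_convexHull ℝ _ (Finset.mem_inter.1 hp).2
    rw [Metric.mem_closedBall]
    have := dist_triangle z p x₀
    linarith [dist_le_h ht hz hpt, dist_le_h hs hps hx₀']

/-- A segment crosses `O(1 / h)` facets. -/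
lemma card_crossed_mul_le {ρ D : ℝ} (hρ : 0 < ρ) (hh : 0 < T.h) (hD : T.h ≤ D)
    (hb : ∀ s ∈ T.cells, ∃ x, Metric.ball x (ρ * T.h) ⊆ hull s) (hd : 1 ≤ d) {x y : E d}
    (hxy : dist x y ≤ D) : ((T.crossed x y).card : ℝ) * T.h ≤ crossConst d ρ D := by
  have hD0 : 0 < D := hh.trans_le hD
  set 𝒮 := T.cells.filter fun s => (segment ℝ x y ∩ hull s).Nonempty with h𝒮
  -- the cells that meet the segment lie in a tube
  have hγ : LipschitzOnWith (Real.toNNReal (D + 1))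
      (fun p : ℝ × E d => x + p.1 • (y - x) + p.2) (Icc (0 : ℝ) 1 ×ˢ univ) := by
    refine LipschitzOnWith.of_dist_le_mul fun a _ b _ => ?_
    rw [Real.coe_toNNReal _ (by positivity), dist_eq_norm, dist_eq_norm]
    have e : x + a.1 • (y - x) + a.2 - (x + b.1 • (y - x) + b.2)
        = (a - b).1 • (y - x) + (a - b).2 := by
      simp only [Prod.fst_sub, Prod.snd_sub, sub_smul]; abel
    rw [e]
    refine (norm_add_le _ _).trans ?_
    rw [norm_smul]
    have h1 := norm_fst_le (a - b)
    have h2 := norm_snd_le (a - b)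
    have h3 : ‖y - x‖ ≤ D := by rw [← dist_eq_norm, dist_comm]; exact hxy
    nlinarith [norm_nonneg (a - b), norm_nonneg (a - b).1, norm_nonneg (y - x),
      mul_le_mul h1 h3 (norm_nonneg _) (norm_nonneg _)]
  obtain ⟨M, -, hM, hMv⟩ := exists_tube hγ hd (h := 2 * T.h) (D := 2 * D) (by positivity)
    (by linarith) (H := Metric.closedBall 0 T.h) (subset_univ _) (by
      intro u hu v hv
      have := dist_triangle_right u v 0
      rw [Metric.mem_closedBall] at hu hv
      linarith)
  have hbc := ballConst_pos (d := d)
  have h1 := card_mul_le (mul_pos hρ hh) hb (Finset.filter_subset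
    (fun s => (segment ℝ x y ∩ hull s).Nonempty) _) (M := M) (by
      intro s hs z hz
      obtain ⟨hs, w, hw, hws⟩ := Finset.mem_filter.1 hs
      rw [segment_eq_image'] at hw
      obtain ⟨σ, hσ, rfl⟩ := hw
      refine hM ⟨(σ, z - (x + σ • (y - x))), ⟨hσ, ?_⟩, ?_⟩
      · rw [mem_closedBall_zero_iff, ← dist_eq_norm]
        exact dist_le_h hs hz hws
      · simp) (by have := hh.le; positivity) hMv
  rw [Real.coe_toNNReal _ (by positivity)] at h1
  have h2 : (𝒮.card : ℝ) * T.h ≤ (D + 1) ^ d * (1 + 2 * (2 * D)) * 2 ^ (d - 1) / ρ ^ d := by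
    rw [le_div_iff₀ (by positivity)]
    obtain ⟨k, rfl⟩ : ∃ k, d = k + 1 := ⟨d - 1, by omega⟩
    simp only [Nat.add_sub_cancel] at h1 ⊢
    have hpos : 0 < ballConst (k + 1) * T.h ^ k := by positivity
    refine le_of_mul_le_mul_right ?_ hpos
    calc (𝒮.card : ℝ) * T.h * ρ ^ (k + 1) * (ballConst (k + 1) * T.h ^ k)
        = (𝒮.card : ℝ) * (ballConst (k + 1) * (ρ * T.h) ^ (k + 1)) := by ring
      _ ≤ _ := h1
      _ = _ := by ring
  have h3 : ((T.crossed x y).card : ℝ) ≤ 𝒮.card * (2 / ρ) ^ d := by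
    have hsub : T.crossed x y ⊆ 𝒮.biUnion fun s =>
        (T.cells.filter fun t => (s ∩ t).card = d).image fun t => (s, t) := by
      rintro ⟨s, t⟩ hp
      obtain ⟨hp, z, hz, hzp⟩ := Finset.mem_filter.1 hp
      obtain ⟨⟨hs, ht⟩, hc⟩ := mem_pairs.1 hp
      rw [Finset.mem_biUnion]
      refine ⟨s, Finset.mem_filter.2 ⟨hs, z, hz, ?_⟩,
        Finset.mem_image.2 ⟨t, Finset.mem_filter.2 ⟨ht, hc⟩, rfl⟩⟩
      exact convexHull_mono (by exact_mod_cast Finset.inter_subset_left) hzp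
    have h4 := (Finset.card_le_card hsub).trans Finset.card_biUnion_le
    have h5 : (∑ s ∈ 𝒮, (((T.cells.filter fun t => (s ∩ t).card = d).image
        fun t => (s, t)).card : ℝ)) ≤ ∑ _s ∈ 𝒮, (2 / ρ) ^ d := by
      refine Finset.sum_le_sum fun s hs => ?_
      refine le_trans ?_ (card_neighbours_le hρ hh hb hd (Finset.mem_filter.1 hs).1)
      exact_mod_cast Finset.card_image_le
    rw [Finset.sum_const, nsmul_eq_mul] at h5
    refine le_trans ?_ h5
    exact_mod_cast h4
  calc ((T.crossed x y).card : ℝ) * T.h ≤ 𝒮.card * (2 / ρ) ^ d * T.h :=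
        mul_le_mul_of_nonneg_right h3 hh.le
    _ = (2 / ρ) ^ d * (𝒮.card * T.h) := by ring
    _ ≤ _ := mul_le_mul_of_nonneg_left h2 (by positivity)

/-! ### Transport of cellwise constant functions -/

variable (T) in
/-- The square of the cellwise constant function with values `q`. On the overlaps of the closed
cells, which are null sets, the squares are added up. -/
def cellSq (q : Finset (E d) → ℝ) (x : E d) : ENNReal :=
  ∑ s ∈ T.cells, (hull s).indicator (fun _ => ENNReal.ofReal (q s ^ 2)) x

lemma measurable_cellSq (q : Finset (E d) → ℝ) : Measurable (T.cellSq q) :=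
  Finset.measurable_sum _ fun s _ => measurable_const.indicator (measurableSet_hull s)

lemma le_cellSq (q : Finset (E d) → ℝ) {s : Finset (E d)} (hs : s ∈ T.cells) {x : E d}
    (hx : x ∈ hull s) : ENNReal.ofReal (q s ^ 2) ≤ T.cellSq q x := by
  have := Finset.single_le_sum (f := fun s => (hull s).indicator
    (fun _ => ENNReal.ofReal (q s ^ 2)) x) (fun _ _ => zero_le) hs
  rw [cellSq]
  simpa [indicator_of_mem hx] using this

variable (T) in
/-- The sum of the squared jumps of `q` over the facets. -/
def jumpSq (q : Finset (E d) → ℝ) : ℝ := ∑ p ∈ T.pairs, (q p.1 - q p.2) ^ 2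

lemma jumpSq_nonneg (q : Finset (E d) → ℝ) : 0 ≤ T.jumpSq q :=
  Finset.sum_nonneg fun _ _ => sq_nonneg _

lemma hull_face_subset {e : Finset (E d)} (he : e ∈ T.faces) : hull e ⊆ closure Ω := by
  rw [← T.covers]; exact Geometry.SimplicialComplex.convexHull_subset_space he

lemma ae_unique_cell : ∀ᵐ x ∂(volume : Measure (E d)), ∀ s ∈ T.cells, ∀ t ∈ T.cells,
    x ∈ hull s → x ∈ hull t → s = t := by
  rw [Filter.eventually_all_finset]
  intro s hs
  rw [Filter.eventually_all_finset]
  intro t ht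
  by_cases hst : s = t
  · exact Eventually.of_forall fun _ _ _ => hst
  · rw [ae_iff]
    refine measure_mono_null ?_ (volume_hull_inter hs ht hst)
    intro x hx
    simp only [mem_ofPred_eq, Classical.not_imp] at hx
    exact ⟨hx.1, hx.2.1⟩

lemma ae_notMem_shadow {γ : ℝ × E d → E d} {L : NNReal}
    (hγ : LipschitzOnWith L γ (Icc (0 : ℝ) 1 ×ˢ closure Ω)) :
    ∀ᵐ x ∂(volume : Measure (E d)), ∀ e ∈ T.faces, e.card < d → x ∉ shadow γ (hull e) := by
  rw [Filter.eventually_all_finite T.finite]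
  intro e he
  by_cases hc : e.card < d
  · have := volume_shadow_hull_eq_zero hγ hc (hull_face_subset he)
    filter_upwards [measure_eq_zero_iff_ae_notMem.1 this] with x hx _ using hx
  · exact Eventually.of_forall fun _ h => absurd h hc

/-- Transport estimate. Each point `x` of `S` is joined to `f x` by a segment, and `γ` recovers
`x` from any point of that segment. Then the cellwise constant function on `S` is controlled by
its values at `f x` and its jumps. -/
lemma lintegral_cellSq_le {ρ D : ℝ} (hρ : 0 < ρ) (hh : 0 < T.h)
    (hD : Metric.diam (closure Ω) ≤ D)
    (hb : ∀ s ∈ T.cells, ∃ x, Metric.ball x (ρ * T.h) ⊆ hull s) (hd : 2 ≤ d)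
    {γ : ℝ × E d → E d} {L : NNReal} (hγ : LipschitzOnWith L γ (Icc (0 : ℝ) 1 ×ˢ closure Ω))
    {S : Set (E d)} (hS : MeasurableSet S) (f : E d → E d)
    (hseg : ∀ x ∈ S, segment ℝ x (f x) ⊆ closure Ω)
    (hf : ∀ x ∈ S, ∀ z ∈ segment ℝ x (f x), ∃ s ∈ Icc (0 : ℝ) 1, γ (s, z) = x)
    (q : Finset (E d) → ℝ) (Q : E d → ENNReal) (hQm : Measurable Q)
    (hQ : ∀ᵐ x ∂(volume : Measure (E d)), x ∈ S →
      ∃ K ∈ T.cells, f x ∈ hull K ∧ ENNReal.ofReal (q K ^ 2) ≤ Q x) :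
    ∫⁻ x in S, T.cellSq q x ≤ 2 * (∫⁻ x in S, Q x) + ENNReal.ofReal
      (2 * crossConst d ρ D * (ballConst d * L ^ d * (1 + 2 * D)) *
        (T.h ^ (d - 2) * T.jumpSq q)) := by
  have hhD : T.h ≤ D := T.h_le.trans hD
  have hD0 : 0 ≤ D := hh.le.trans hhD
  have hbc := (ballConst_pos (d := d)).le
  have hcc := crossConst_nonneg (d := d) hρ hD0
  set A := ballConst d * L ^ d * (1 + 2 * D) with hA
  have hA0 : 0 ≤ A := by positivity
  -- the tubes swept out by the facets
  have htube : ∀ p : Finset (E d) × Finset (E d), ∃ M, MeasurableSet M ∧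
      (p ∈ T.pairs → shadow γ (hull (p.1 ∩ p.2)) ⊆ M ∧
        volume M ≤ ENNReal.ofReal (A * T.h ^ (d - 1))) := by
    intro p
    by_cases hp : p ∈ T.pairs
    · obtain ⟨⟨h1, h2⟩, h3⟩ := mem_pairs.1 hp
      have hsub : hull (p.1 ∩ p.2) ⊆ hull p.1 :=
        convexHull_mono (by exact_mod_cast Finset.inter_subset_left)
      obtain ⟨M, m1, m2, m3⟩ := exists_tube hγ (by omega) hh hhD
        (hsub.trans (hull_subset_closure h1))
        (fun x hx y hy => dist_le_h h1 (hsub hx) (hsub hy))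
      exact ⟨M, m1, fun _ => ⟨m2, m3⟩⟩
    · exact ⟨∅, MeasurableSet.empty, fun h => absurd h hp⟩
  choose M hMm hM using htube
  set N := crossConst d ρ D / T.h with hN
  have hN0 : 0 ≤ N := by positivity
  -- each crossed facet has `x` in its tube, and only `O(1 / h)` facets are crossed
  have key : ∀ᵐ x ∂(volume.restrict S), T.cellSq q x ≤ 2 * Q x
      + ∑ p ∈ T.pairs,
        (M p).indicator (fun _ => ENNReal.ofReal (2 * N * (q p.1 - q p.2) ^ 2)) x := by
    rw [ae_restrict_iff' hS]
    filter_upwards [hQ, ae_unique_cell (T := T), ae_notMem_shadow (T := T) hγ] with x h1 h2 h3 hx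
    obtain ⟨K', hK', hfx, hq⟩ := h1 hx
    obtain ⟨K, hK, hxK⟩ := exists_cell (T := T) (hseg x hx (left_mem_segment ℝ _ _))
    have hgen : ∀ e ∈ T.faces, e.card < d → segment ℝ x (f x) ∩ hull e = ∅ := by
      intro e he hc
      by_contra hne
      obtain ⟨z, hz, hze⟩ := nonempty_iff_ne_empty.2 hne
      obtain ⟨s, hs, hsz⟩ := hf x hx z hz
      exact h3 e he hc ⟨(s, z), ⟨hs, hze⟩, hsz⟩
    have e1 : T.cellSq q x = ENNReal.ofReal (q K ^ 2) := by
      rw [cellSq, Finset.sum_eq_single K]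
      · rw [indicator_of_mem hxK]
      · intro s hs hsK
        exact indicator_of_notMem (fun hxs => hsK (h2 s hs K hK hxs hxK)) _
      · exact fun h => absurd hK h
    have h4 := abs_sub_le_sum_crossed (hseg x hx) hgen hK hxK hK' hfx q
    have hdist : dist x (f x) ≤ D :=
      (Metric.dist_le_diam_of_mem T.isCompact_closure.isBounded
        (hseg x hx (left_mem_segment ℝ _ _)) (hseg x hx (right_mem_segment ℝ _ _))).trans hD
    have h5 := card_crossed_mul_le hρ hh hhD hb (by omega) hdist
    have h5' : ((T.crossed x (f x)).card : ℝ) ≤ N := by rwa [hN, le_div_iff₀ hh]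
    have h6 : (q K - q K') ^ 2 ≤ N * ∑ p ∈ T.crossed x (f x), (q p.1 - q p.2) ^ 2 := by
      calc (q K - q K') ^ 2 = |q K - q K'| ^ 2 := (sq_abs _).symm
        _ ≤ (∑ p ∈ T.crossed x (f x), |q p.1 - q p.2|) ^ 2 :=
            pow_le_pow_left₀ (abs_nonneg _) h4 2
        _ ≤ (T.crossed x (f x)).card * ∑ p ∈ T.crossed x (f x), |q p.1 - q p.2| ^ 2 :=
            sq_sum_le_card_mul_sum_sq
        _ ≤ N * ∑ p ∈ T.crossed x (f x), |q p.1 - q p.2| ^ 2 :=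
            mul_le_mul_of_nonneg_right h5' (Finset.sum_nonneg fun _ _ => sq_nonneg _)
        _ = _ := by simp only [sq_abs]
    have h7 : q K ^ 2 ≤ 2 * q K' ^ 2 + ∑ p ∈ T.crossed x (f x), 2 * N * (q p.1 - q p.2) ^ 2 := by
      rw [← Finset.mul_sum]
      nlinarith [sq_nonneg (q K - 2 * q K')]
    rw [e1]
    refine (ENNReal.ofReal_le_ofReal h7).trans ?_
    rw [ENNReal.ofReal_add (by positivity) (Finset.sum_nonneg fun _ _ => by positivity),
      ENNReal.ofReal_mul zero_le_two, ENNReal.ofReal_ofNat,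
      ENNReal.ofReal_sum_of_nonneg fun _ _ => by positivity]
    refine add_le_add (by gcongr) ?_
    refine (Finset.sum_le_sum fun p hp => ?_).trans
      (Finset.sum_le_sum_of_subset (Finset.filter_subset _ _))
    obtain ⟨hp, z, hz, hzp⟩ := Finset.mem_filter.1 hp
    obtain ⟨s, hs, hsz⟩ := hf x hx z hz
    rw [indicator_of_mem ((hM p hp).1 ⟨(s, z), ⟨hs, hzp⟩, hsz⟩)]
  refine (lintegral_mono_ae key).trans ?_
  rw [lintegral_add_left (by fun_prop), lintegral_const_mul _ hQm,
    lintegral_finsetSum _ fun p _ => measurable_const.indicator (hMm p)]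
  refine add_le_add le_rfl ?_
  have hterm : ∀ p ∈ T.pairs, ∫⁻ x in S, (M p).indicator
      (fun _ => ENNReal.ofReal (2 * N * (q p.1 - q p.2) ^ 2)) x
      ≤ ENNReal.ofReal (2 * N * (q p.1 - q p.2) ^ 2 * (A * T.h ^ (d - 1))) := by
    intro p hp
    rw [lintegral_indicator_const (hMm p), ENNReal.ofReal_mul (p := 2 * N * _) (by positivity)]
    gcongr
    exact (Measure.restrict_apply_le _ _).trans (hM p hp).2
  refine (Finset.sum_le_sum hterm).trans ?_
  rw [← ENNReal.ofReal_sum_of_nonneg fun _ _ => by positivity]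
  refine ENNReal.ofReal_le_ofReal (le_of_eq ?_)
  rw [← Finset.sum_mul, ← Finset.mul_sum, jumpSq, hN]
  obtain ⟨k, rfl⟩ : ∃ k, d = k + 2 := ⟨d - 2, by omega⟩
  simp only [Nat.add_sub_cancel, show k + 2 - 1 = k + 1 by omega]
  field_simp
  ring

end Mesh
end CauchyFEM
end

noncomputable section
namespace CauchyFEM
variable {d : ℕ}
open Classical Mesh

/-! ### A discrete Poincaré inequality for cellwise constant functions -/

namespace Mesh

lemma h_pos {Ω : Set (E d)} {T : Mesh Ω} (hd : 1 ≤ d) (hΩ : Ω.Nonempty) : 0 < T.h := by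
  obtain ⟨x, hx⟩ := hΩ
  obtain ⟨s, hs, -⟩ := exists_cell (T := T) (subset_closure hx)
  obtain ⟨a, ha, b, hb, hab⟩ := Finset.one_lt_card.1
    (show 1 < s.card by rw [(T.mem_cells.1 hs).2]; omega)
  exact (dist_pos.2 hab).trans_le
    (dist_le_h hs (subset_convexHull ℝ _ ha) (subset_convexHull ℝ _ hb))

end Mesh

section Poincare

variable {G : Domain d} {ι : Type*} {𝒯 : ι → Mesh G.Ω}

variable (G) in
/-- The facets on which both Cauchy data are given. -/
def cauchyFacets (T : Mesh G.Ω) : Finset (Finset (E d)) := T.on G.ΓD ∩ T.on G.ΓN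

variable (G) in
/-- The sum of the squares of `q` over the cells that touch the facets with Cauchy data. -/
def cauchySq (T : Mesh G.Ω) (q : Finset (E d) → ℝ) : ℝ :=
  ∑ F ∈ cauchyFacets G T, ∑ s ∈ T.adj F, q s ^ 2

variable (G) in
/-- The right-hand side of the discrete Poincaré inequality: scaled squares of the jumps and of
the values next to the facets with Cauchy data. -/
def energy (T : Mesh G.Ω) (q : Finset (E d) → ℝ) : ℝ :=
  T.h ^ (d - 2) * T.jumpSq q + T.h ^ (d - 1) * cauchySq G T q

lemma cauchySq_nonneg (T : Mesh G.Ω) (q : Finset (E d) → ℝ) : 0 ≤ cauchySq G T q :=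
  Finset.sum_nonneg fun _ _ => Finset.sum_nonneg fun _ _ => sq_nonneg _

lemma energy_nonneg (T : Mesh G.Ω) (hh : 0 ≤ T.h) (q : Finset (E d) → ℝ) : 0 ≤ energy G T q := by
  have := jumpSq_nonneg (T := T) q
  have := cauchySq_nonneg T q
  unfold energy; positivity

variable (𝒯) in
/-- The `L²`-norm over `S` of every cellwise constant function, on every mesh of the family, is
controlled by its energy. -/
def Controlled (S : Set (E d)) : Prop :=
  ∃ C : ℝ, 0 ≤ C ∧ ∀ i q, ∫⁻ x in S, (𝒯 i).cellSq q x ≤ ENNReal.ofReal (C * energy G (𝒯 i) q)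

lemma Controlled.mono {S S' : Set (E d)} (h : Controlled 𝒯 S) (hS : S' ⊆ S) :
    Controlled 𝒯 S' := by
  obtain ⟨C, hC, h⟩ := h
  exact ⟨C, hC, fun i q => (lintegral_mono_set hS).trans (h i q)⟩

lemma Controlled.union (hh : ∀ i, 0 < (𝒯 i).h) {S S' : Set (E d)} (h : Controlled 𝒯 S)
    (h' : Controlled 𝒯 S') : Controlled 𝒯 (S ∪ S') := by
  obtain ⟨C, hC, h⟩ := h
  obtain ⟨C', hC', h'⟩ := h'
  refine ⟨C + C', by positivity, fun i q => ?_⟩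
  have he := energy_nonneg (𝒯 i) (hh i).le q
  rw [add_mul, ENNReal.ofReal_add (by positivity) (by positivity)]
  exact (lintegral_union_le _ _ _).trans (add_le_add (h i q) (h' i q))

lemma Controlled.biUnion (hh : ∀ i, 0 < (𝒯 i).h) (A : Finset (Finset (E d)))
    (h : ∀ s ∈ A, Controlled 𝒯 (hull s)) : Controlled 𝒯 (⋃ s ∈ A, hull s) := by
  induction A using Finset.induction_on with
  | empty => exact ⟨0, le_rfl, fun i q => by simp⟩
  | insert a A _ ih =>
    rw [Finset.set_biUnion_insert]
    exact (h a (Finset.mem_insert_self _ _)).union hh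
      (ih fun s hs => h s (Finset.mem_insert_of_mem hs))

/-- Radial maps with bounded factors are Lipschitz. -/
lemma lipschitzOn_radial {B : Set (E d)} {D : ℝ} (hB : ∀ x ∈ B, ∀ y ∈ B, dist x y ≤ D) (hD : 0 ≤ D)
    {c : E d} (hc : c ∈ B) {α β : ℝ} (hα : 0 ≤ α) (hβ : 0 ≤ β) :
    LipschitzOnWith (Real.toNNReal (α + β + β * D))
      (fun p : ℝ × E d => c + (α + p.1 * β) • (p.2 - c)) (Icc (0 : ℝ) 1 ×ˢ B) := by
  refine LipschitzOnWith.of_dist_le_mul fun a ha b hb => ?_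
  rw [Real.coe_toNNReal _ (by positivity), dist_eq_norm, dist_eq_norm]
  have e : c + (α + a.1 * β) • (a.2 - c) - (c + (α + b.1 * β) • (b.2 - c))
      = (α + a.1 * β) • (a - b).2 + ((a - b).1 * β) • (b.2 - c) := by
    simp only [Prod.fst_sub, Prod.snd_sub]; module
  rw [e]
  refine (norm_add_le _ _).trans ?_
  rw [norm_smul, norm_smul, norm_mul, Real.norm_of_nonneg hβ,
    Real.norm_of_nonneg (by have := ha.1.1; positivity : 0 ≤ α + a.1 * β)]
  have h1 := norm_fst_le (a - b)
  have h2 := norm_snd_le (a - b)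
  have h3 : ‖b.2 - c‖ ≤ D := by rw [← dist_eq_norm]; exact hB _ hb.2 _ hc
  have h4 : α + a.1 * β ≤ α + β := by nlinarith [ha.1.2]
  calc (α + a.1 * β) * ‖(a - b).2‖ + ‖(a - b).1‖ * β * ‖b.2 - c‖
      ≤ (α + β) * ‖a - b‖ + ‖a - b‖ * β * D := by gcongr
    _ = _ := by ring

variable (hd : 2 ≤ d) {ρ : ℝ} (hρ : 0 < ρ)
  (hb : ∀ i, ∀ s ∈ (𝒯 i).cells, ∃ x, Metric.ball x (ρ * (𝒯 i).h) ⊆ hull s)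

lemma lintegral_comp_homothety (c : E d) {θ : ℝ} (hθ : 0 < θ) {g : E d → ENNReal}
    (hg : Measurable g) :
    ∫⁻ x, g (c + θ • (x - c)) = ENNReal.ofReal ((θ ^ d)⁻¹) * ∫⁻ x, g x := by
  have hg' : Measurable fun x => g (x + (c - θ • c)) := by fun_prop
  have e : (fun x => g (c + θ • (x - c))) = fun x => (fun x => g (x + (c - θ • c))) (θ • x) := by
    ext x; congr 1; rw [smul_sub]; abel
  rw [e, ← lintegral_map hg' (by fun_prop), Measure.map_addHaar_smul _ hθ.ne',
    lintegral_smul_measure, lintegral_add_right_eq_self g, finrank_euclideanSpace_fin,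
    abs_of_pos (by positivity), smul_eq_mul]

include hd hρ hb in
/-- Control spreads from a ball to any convex subset of the closed domain that contains its
centre: contract the convex set into the ball. -/
lemma Controlled.of_ball {U : Set (E d)} (hU : Convex ℝ U) (hUm : MeasurableSet U)
    (hUΩ : U ⊆ closure G.Ω) {c : E d} (hcU : c ∈ U) {r : ℝ} (hr : 0 < r)
    (hc : Controlled 𝒯 (Metric.ball c r)) : Controlled 𝒯 U := by
  rcases isEmpty_or_nonempty ι with hι | ⟨⟨i₀⟩⟩
  · exact ⟨0, le_rfl, fun i => hι.elim i⟩
  obtain ⟨C, hC, hc⟩ := hc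
  set D := Metric.diam (closure G.Ω) with hD
  have hD0 : 0 ≤ D := Metric.diam_nonneg
  have hdist : ∀ x ∈ closure G.Ω, ∀ y ∈ closure G.Ω, dist x y ≤ D := fun x hx y hy =>
    Metric.dist_le_diam_of_mem (𝒯 i₀).isCompact_closure.isBounded hx hy
  -- the homothety with factor `θ` maps `U` into the ball, and its inverse along a segment is a
  -- dilation with a factor between `1` and `θ⁻¹ = 1 + β`
  set θ := r / (r + D + 1) with hθ
  have hθ0 : 0 < θ := by positivity
  have hθ1 : θ < 1 := by rw [hθ, div_lt_one (by positivity)]; linarith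
  set β := θ⁻¹ - 1 with hβ
  have hβ0 : 0 < β := by rw [hβ, sub_pos]; exact (one_lt_inv₀ hθ0).2 hθ1
  set L := Real.toNNReal (1 + β + β * D) with hL
  have hγ := lipschitzOn_radial hdist hD0 (hUΩ hcU) zero_le_one hβ0.le
  have hcst : 0 ≤ 2 * crossConst d ρ D * (ballConst d * L ^ d * (1 + 2 * D)) := by
    have := crossConst_nonneg (d := d) hρ hD0
    have := (ballConst_pos (d := d)).le
    positivity
  refine ⟨2 * ((θ ^ d)⁻¹ * C) + 2 * crossConst d ρ D * (ballConst d * L ^ d * (1 + 2 * D)),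
    by positivity, fun i q => ?_⟩
  have hh : 0 < (𝒯 i).h := h_pos (by omega) G.isConnected.nonempty
  set f : E d → E d := fun x => c + θ • (x - c) with hf
  have hfU : ∀ x ∈ U, f x ∈ U := by
    intro x hx
    have := hU hcU hx (show 0 ≤ 1 - θ by linarith) hθ0.le (by ring)
    convert this using 1
    rw [hf]; module
  have hfball : ∀ x ∈ U, f x ∈ Metric.ball c r := by
    intro x hx
    rw [mem_ball_iff_norm, hf, add_sub_cancel_left, norm_smul, Real.norm_of_nonneg hθ0.le, hθ,
      ← dist_eq_norm, div_mul_eq_mul_div, div_lt_iff₀ (by positivity)]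
    have := hdist x (hUΩ hx) c (hUΩ hcU)
    nlinarith
  have hmain := lintegral_cellSq_le (T := 𝒯 i) hρ hh le_rfl (hb i) hd hγ hUm f
    (fun x hx => (hU.segment_subset hx (hfU x hx)).trans hUΩ) ?_ q
    (fun x => (𝒯 i).cellSq q (f x)) ((measurable_cellSq q).comp (by fun_prop)) ?_
  · refine hmain.trans ?_
    have h1 : ∫⁻ x in U, (𝒯 i).cellSq q (f x)
        ≤ ENNReal.ofReal ((θ ^ d)⁻¹ * (C * energy G (𝒯 i) q)) := by
      calc ∫⁻ x in U, (𝒯 i).cellSq q (f x)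
          = ∫⁻ x, U.indicator (fun x => (𝒯 i).cellSq q (f x)) x := (lintegral_indicator hUm _).symm
        _ ≤ ∫⁻ x, (Metric.ball c r).indicator ((𝒯 i).cellSq q) (f x) := by
            refine lintegral_mono fun x => ?_
            by_cases hx : x ∈ U
            · rw [indicator_of_mem hx, indicator_of_mem (hfball x hx)]
            · rw [indicator_of_notMem hx]; exact zero_le
        _ = ENNReal.ofReal ((θ ^ d)⁻¹) * ∫⁻ x in Metric.ball c r, (𝒯 i).cellSq q x := by
            rw [← lintegral_indicator measurableSet_ball]
            exact lintegral_comp_homothety c hθ0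
              ((measurable_cellSq q).indicator measurableSet_ball)
        _ ≤ _ := by
            rw [ENNReal.ofReal_mul (by positivity)]
            gcongr
            exact hc i q
    have he := energy_nonneg (𝒯 i) hh.le q
    have hJ : (𝒯 i).h ^ (d - 2) * (𝒯 i).jumpSq q ≤ energy G (𝒯 i) q := by
      have := cauchySq_nonneg (𝒯 i) q
      unfold energy
      have : 0 ≤ (𝒯 i).h ^ (d - 1) * cauchySq G (𝒯 i) q := by positivity
      linarith
    rw [add_mul, ENNReal.ofReal_add (by positivity) (by positivity)]
    refine add_le_add ?_ (ENNReal.ofReal_le_ofReal (mul_le_mul_of_nonneg_left hJ hcst))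
    rw [mul_assoc, ENNReal.ofReal_mul zero_le_two, ENNReal.ofReal_ofNat, mul_assoc]
    gcongr
  · intro x hx z hz
    rw [segment_eq_image'] at hz
    obtain ⟨σ, hσ, rfl⟩ := hz
    have hl : 0 < 1 - σ * (1 - θ) := by nlinarith [hσ.1, hσ.2]
    have hl2 : θ ≤ 1 - σ * (1 - θ) := by nlinarith [hσ.1, hσ.2]
    refine ⟨((1 - σ * (1 - θ))⁻¹ - 1) / β, ⟨?_, ?_⟩, ?_⟩
    · apply div_nonneg _ hβ0.le
      rw [sub_nonneg]
      exact (one_le_inv₀ hl).2 (by nlinarith [hσ.1, hσ.2])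
    · rw [div_le_one hβ0, hβ]
      gcongr
    · have e1 : x + σ • (f x - x) - c = (1 - σ * (1 - θ)) • (x - c) := by
        rw [hf]; module
      simp only [e1]
      rw [div_mul_cancel₀ _ hβ0.ne', add_sub_cancel, smul_smul, inv_mul_cancel₀ hl.ne', one_smul,
        add_sub_cancel]
  · refine Eventually.of_forall fun x hx => ?_
    obtain ⟨K, hK, hxK⟩ := exists_cell (T := 𝒯 i) (hUΩ (hfU x hx))
    exact ⟨K, hK, hxK, le_cellSq q hK hxK⟩

/-- Since the two boundary parts overlap in positive measure, some facet carries both data. -/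
lemma cauchyFacets_nonempty {T : Mesh G.Ω} (hD : T.Fits G.ΓD) (hN : T.Fits G.ΓN) :
    (cauchyFacets G T).Nonempty := by
  by_contra hne
  rw [Finset.not_nonempty_iff_eq_empty] at hne
  refine G.overlap ?_
  have hsub : G.ΓD ∩ G.ΓN ⊆ ⋃ F ∈ T.on G.ΓD, ⋃ F' ∈ T.on G.ΓN, hull F ∩ hull F' := by
    rintro x ⟨hx, hx'⟩
    rw [hD] at hx; rw [hN] at hx'
    obtain ⟨F, hF, hxF⟩ := mem_iUnion₂.1 hx
    obtain ⟨F', hF', hxF'⟩ := mem_iUnion₂.1 hx'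
    exact mem_biUnion hF (mem_biUnion hF' ⟨hxF, hxF'⟩)
  refine measure_mono_null hsub ?_
  refine (measure_biUnion_null_iff (T.on G.ΓD).countable_toSet).2 fun F hF => ?_
  refine (measure_biUnion_null_iff (T.on G.ΓN).countable_toSet).2 fun F' hF' => ?_
  have hFF' : F ≠ F' := by
    rintro rfl
    exact Finset.notMem_empty F (hne ▸ Finset.mem_inter.2 ⟨hF, hF'⟩)
  simp only [Mesh.on, bdryFacets, Finset.coe_filter, Finset.mem_filter, Finite.mem_toFinset,
    mem_ofPred_eq] at hF hF'
  have hc : (F ∩ F').card < d := by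
    by_contra hlt
    refine hFF' ?_
    have e1 : F ∩ F' = F := Finset.eq_of_subset_of_card_le Finset.inter_subset_left (by omega)
    have e2 : F ∩ F' = F' := Finset.eq_of_subset_of_card_le Finset.inter_subset_right (by omega)
    exact e1.symm.trans e2
  refine measure_mono_null ?_ (surf_hull_eq_zero hc)
  have := T.inter_subset_convexHull hF.1.1 hF'.1.1
  rwa [← Finset.coe_inter] at this

lemma on_prop {T : Mesh G.Ω} {Γ : Set (E d)} {F : Finset (E d)} (hF : F ∈ T.on Γ) :
    F ∈ T.faces ∧ F.card = d ∧ (T.adj F).card = 1 ∧ hull F ⊆ Γ := by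
  simp only [Mesh.on, bdryFacets, Finset.mem_filter, Finite.mem_toFinset] at hF
  exact ⟨hF.1.1, hF.1.2.1, hF.1.2.2, hF.2⟩

include hd hρ hb in
/-- The cell of a fixed mesh that touches a facet with Cauchy data is controlled: project it onto
the facet from the opposite vertex. -/
lemma controlled_of_mem_cauchyFacets (hfit : ∀ i, (𝒯 i).Fits G.ΓD ∧ (𝒯 i).Fits G.ΓN) (i₀ : ι)
    {F₀ : Finset (E d)} (hF₀ : F₀ ∈ cauchyFacets G (𝒯 i₀)) {K₀ : Finset (E d)}
    (hK₀ : K₀ ∈ (𝒯 i₀).adj F₀) : Controlled 𝒯 (hull K₀) := by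
  obtain ⟨hF₀D, hF₀N⟩ := Finset.mem_inter.1 hF₀
  obtain ⟨-, hF₀c, -, hF₀D⟩ := on_prop hF₀D
  obtain ⟨-, -, -, hF₀N⟩ := on_prop hF₀N
  obtain ⟨hK₀, hFK⟩ := mem_adj.1 hK₀
  obtain ⟨p, hp, rfl⟩ := exists_eq_insert hK₀ hFK hF₀c
  have hne : F₀.Nonempty := Finset.card_pos.1 (by omega)
  have hKΩ := hull_subset_closure hK₀
  have hpK : p ∈ hull (insert p F₀) := subset_convexHull ℝ _ (by simp)
  set D := Metric.diam (closure G.Ω) with hD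
  have hD0 : 0 ≤ D := Metric.diam_nonneg
  have hdist : ∀ x ∈ closure G.Ω, ∀ y ∈ closure G.Ω, dist x y ≤ D := fun x hx y hy =>
    Metric.dist_le_diam_of_mem (𝒯 i₀).isCompact_closure.isBounded hx hy
  have hγ := lipschitzOn_radial hdist hD0 (hKΩ hpK) le_rfl zero_le_one
  set L := Real.toNNReal (0 + 1 + 1 * D) with hL
  have hbc := (ballConst_pos (d := d)).le
  have hcst : 0 ≤ 2 * crossConst d ρ D * (ballConst d * L ^ d * (1 + 2 * D)) := by
    have := crossConst_nonneg (d := d) hρ hD0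
    positivity
  set A := ballConst d * L ^ d * (1 + 2 * D) with hA
  have hA0 : 0 ≤ A := by positivity
  -- the projection onto the facet
  have hproj : ∀ x, ∃ y, x ∈ hull (insert p F₀) → y ∈ hull F₀ ∧ ∃ a b : ℝ, 0 ≤ a ∧ 0 ≤ b ∧
      a + b = 1 ∧ a • p + b • y = x := by
    intro x
    by_cases hx : x ∈ hull (insert p F₀)
    · obtain ⟨a, b, ha, hb, hab, y, hy, e⟩ := (mem_hull_insert hne).1 hx
      exact ⟨y, fun _ => ⟨hy, a, b, ha, hb, hab, e⟩⟩
    · exact ⟨0, fun h => absurd h hx⟩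
  choose f hf using hproj
  have hFK' : hull F₀ ⊆ hull (insert p F₀) := convexHull_mono (by exact_mod_cast hFK)
  refine ⟨2 * A + 2 * crossConst d ρ D * A, by positivity, fun i q => ?_⟩
  have hh : 0 < (𝒯 i).h := h_pos (by omega) G.isConnected.nonempty
  -- contractions towards `p` recover `x` from the points of its segment
  have hγf : ∀ x ∈ hull (insert p F₀), ∀ z ∈ segment ℝ x (f x), ∃ s ∈ Icc (0 : ℝ) 1,
      (fun p' : ℝ × E d => p + (0 + p'.1 * 1) • (p'.2 - p)) (s, z) = x := by
    intro x hx z hz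
    obtain ⟨-, a, b, ha, hb, hab, e⟩ := hf x hx
    rw [segment_eq_image'] at hz
    obtain ⟨σ, hσ, rfl⟩ := hz
    have e1 : x - p = b • (f x - p) := by
      rw [show a = 1 - b by linarith] at e
      conv_lhs => rw [← e]
      module
    have e2 : x + σ • (f x - x) - p = (b + σ * (1 - b)) • (f x - p) := by
      have : x + σ • (f x - x) - p = (1 - σ) • (x - p) + σ • (f x - p) := by module
      rw [this, e1]; module
    have hb1 : b ≤ 1 := by linarith
    have hden : b ≤ b + σ * (1 - b) := by nlinarith [hσ.1]
    rcases hb.eq_or_lt with h0 | h0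
    · refine ⟨0, ⟨le_rfl, zero_le_one⟩, ?_⟩
      rw [← h0, zero_smul, sub_eq_zero] at e1
      simp [e1]
    · have hden0 : 0 < b + σ * (1 - b) := h0.trans_le hden
      refine ⟨b / (b + σ * (1 - b)), ⟨by positivity, (div_le_one hden0).2 hden⟩, ?_⟩
      simp only [e2, zero_add, mul_one]
      rw [smul_smul, div_mul_cancel₀ _ hden0.ne', ← e1, add_sub_cancel]
  -- the tubes swept out by the facets with Cauchy data
  have htube : ∀ F : Finset (E d), ∃ M, MeasurableSet M ∧ (F ∈ cauchyFacets G (𝒯 i) →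
      shadow (fun p' : ℝ × E d => p + (0 + p'.1 * 1) • (p'.2 - p)) (hull F) ⊆ M ∧
        volume M ≤ ENNReal.ofReal (A * (𝒯 i).h ^ (d - 1))) := by
    intro F
    by_cases hF : F ∈ cauchyFacets G (𝒯 i)
    · obtain ⟨-, hFc, hFa, -⟩ := on_prop (Finset.mem_inter.1 hF).1
      obtain ⟨s, hs⟩ := Finset.card_pos.1 (show 0 < ((𝒯 i).adj F).card by omega)
      obtain ⟨hs, hFs⟩ := mem_adj.1 hs
      have hsub : hull F ⊆ hull s := convexHull_mono (by exact_mod_cast hFs)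
      obtain ⟨M, m1, m2, m3⟩ := exists_tube hγ (by omega) hh (𝒯 i).h_le
        (hsub.trans (hull_subset_closure hs))
        (fun x hx y hy => dist_le_h hs (hsub hx) (hsub hy))
      exact ⟨M, m1, fun _ => ⟨m2, m3⟩⟩
    · exact ⟨∅, MeasurableSet.empty, fun h => absurd h hF⟩
  choose M hMm hM using htube
  have hQm : Measurable fun x => ∑ F ∈ cauchyFacets G (𝒯 i), ∑ s ∈ (𝒯 i).adj F,
      (M F).indicator (fun _ => ENNReal.ofReal (q s ^ 2)) x :=
    Finset.measurable_sum _ fun F _ => Finset.measurable_sum _ fun s _ =>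
      measurable_const.indicator (hMm F)
  have hmain := lintegral_cellSq_le (T := 𝒯 i) hρ hh le_rfl (hb i) hd hγ
    (measurableSet_hull (insert p F₀)) f
    (fun x hx => ((convex_convexHull ℝ _).segment_subset hx (hFK' (hf x hx).1)).trans hKΩ) hγf q
    (fun x => ∑ F ∈ cauchyFacets G (𝒯 i), ∑ s ∈ (𝒯 i).adj F,
      (M F).indicator (fun _ => ENNReal.ofReal (q s ^ 2)) x) hQm ?_
  · refine hmain.trans ?_
    have h1 : ∫⁻ x in hull (insert p F₀), (∑ F ∈ cauchyFacets G (𝒯 i), ∑ s ∈ (𝒯 i).adj F,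
        (M F).indicator (fun _ => ENNReal.ofReal (q s ^ 2)) x)
        ≤ ENNReal.ofReal (A * ((𝒯 i).h ^ (d - 1) * cauchySq G (𝒯 i) q)) := by
      rw [lintegral_finsetSum _ fun F _ => Finset.measurable_sum _ fun s _ =>
        measurable_const.indicator (hMm F), cauchySq, ← mul_assoc, Finset.mul_sum,
        ENNReal.ofReal_sum_of_nonneg fun F _ =>
          mul_nonneg (by positivity) (Finset.sum_nonneg fun _ _ => sq_nonneg _)]
      refine Finset.sum_le_sum fun F hF => ?_
      rw [lintegral_finsetSum _ fun s _ => measurable_const.indicator (hMm F), Finset.mul_sum,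
        ENNReal.ofReal_sum_of_nonneg fun s _ => by positivity]
      refine Finset.sum_le_sum fun s _ => ?_
      rw [lintegral_indicator_const (hMm F), mul_comm, ENNReal.ofReal_mul (by positivity)]
      gcongr
      exact (Measure.restrict_apply_le _ _).trans (hM F hF).2
    have hc0 := cauchySq_nonneg (𝒯 i) q
    have hj0 := jumpSq_nonneg (T := 𝒯 i) q
    have he := energy_nonneg (𝒯 i) hh.le q
    refine (add_le_add_left (mul_le_mul_right h1 2) _).trans ?_
    have h2 : 2 * ENNReal.ofReal (A * ((𝒯 i).h ^ (d - 1) * cauchySq G (𝒯 i) q))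
        = ENNReal.ofReal (2 * (A * ((𝒯 i).h ^ (d - 1) * cauchySq G (𝒯 i) q))) := by
      rw [ENNReal.ofReal_mul zero_le_two, ENNReal.ofReal_ofNat]
    rw [h2, ← ENNReal.ofReal_add (by positivity) (by positivity)]
    refine ENNReal.ofReal_le_ofReal ?_
    rw [add_mul, mul_assoc 2 A]
    have hx : 0 ≤ (𝒯 i).h ^ (d - 2) * (𝒯 i).jumpSq q := by positivity
    have hy : 0 ≤ (𝒯 i).h ^ (d - 1) * cauchySq G (𝒯 i) q := by positivity
    unfold energy
    gcongr <;> linarith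
  · -- almost every `x` is projected to a single facet of `𝒯 i`, which then carries both data
    filter_upwards [ae_notMem_shadow (T := 𝒯 i) hγ] with x hx hxK
    obtain ⟨hy, -⟩ := hf x hxK
    have hy1 := hF₀D hy
    have hy2 := hF₀N hy
    rw [(hfit i).1] at hy1
    rw [(hfit i).2] at hy2
    obtain ⟨F, hF, hyF⟩ := mem_iUnion₂.1 hy1
    obtain ⟨F', hF', hyF'⟩ := mem_iUnion₂.1 hy2
    obtain ⟨f1, f2, f3, -⟩ := on_prop hF
    obtain ⟨f1', f2', -, -⟩ := on_prop hF'
    obtain ⟨σ, hσ, hσx⟩ := hγf x hxK (f x) (right_mem_segment ℝ _ _)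
    have hFF' : F = F' := by
      by_contra hFF'
      have hc : (F ∩ F').card < d := by
        by_contra hlt
        refine hFF' ?_
        have e1 : F ∩ F' = F := Finset.eq_of_subset_of_card_le Finset.inter_subset_left (by omega)
        have e2 : F ∩ F' = F' :=
          Finset.eq_of_subset_of_card_le Finset.inter_subset_right (by omega)
        exact e1.symm.trans e2
      have hyi := (𝒯 i).inter_subset_convexHull f1 f1' ⟨hyF, hyF'⟩
      rw [← Finset.coe_inter] at hyi
      exact hx _ ((𝒯 i).down_closed f1 Finset.inter_subset_left (nonempty_of_mem_hull hyi)) hc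
        ⟨(σ, f x), ⟨hσ, hyi⟩, hσx⟩
    obtain ⟨s, hs⟩ := Finset.card_pos.1 (show 0 < ((𝒯 i).adj F).card by omega)
    have hFc : F ∈ cauchyFacets G (𝒯 i) := Finset.mem_inter.2 ⟨hF, hFF' ▸ hF'⟩
    refine ⟨s, (mem_adj.1 hs).1, convexHull_mono (by exact_mod_cast (mem_adj.1 hs).2) hyF, ?_⟩
    have hxM : x ∈ M F := (hM F hFc).1 ⟨(σ, f x), ⟨hσ, hyF⟩, hσx⟩
    refine le_trans ?_ (Finset.single_le_sum (f := fun F => ∑ s ∈ (𝒯 i).adj F,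
      (M F).indicator (fun _ => ENNReal.ofReal (q s ^ 2)) x) (fun _ _ => zero_le) hFc)
    refine le_trans ?_ (Finset.single_le_sum (f := fun s =>
      (M F).indicator (fun _ => ENNReal.ofReal (q s ^ 2)) x) (fun _ _ => zero_le) hs)
    rw [indicator_of_mem hxM]

include hd hρ hb in
/-- Control spreads over the whole domain, which is connected. -/
lemma controlled_closure (hfit : ∀ i, (𝒯 i).Fits G.ΓD ∧ (𝒯 i).Fits G.ΓN) :
    Controlled 𝒯 (closure G.Ω) := by
  rcases isEmpty_or_nonempty ι with hι | ⟨⟨i₀⟩⟩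
  · exact ⟨0, le_rfl, fun i => hι.elim i⟩
  have hh : ∀ i, 0 < (𝒯 i).h := fun i => h_pos (by omega) G.isConnected.nonempty
  have hcentre : ∀ s ∈ (𝒯 i₀).cells, ∃ x ∈ G.Ω, ∃ r > 0, Metric.ball x r ⊆ hull s := by
    intro s hs
    obtain ⟨x, hx⟩ := hb i₀ s hs
    have hr : 0 < ρ * (𝒯 i₀).h := mul_pos hρ (hh i₀)
    refine ⟨x, interior_hull_subset G.regular hs ?_, _, hr, hx⟩
    exact mem_interior.2 ⟨_, hx, Metric.isOpen_ball, Metric.mem_ball_self hr⟩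
  obtain ⟨F₀, hF₀⟩ := cauchyFacets_nonempty (hfit i₀).1 (hfit i₀).2
  obtain ⟨-, -, hF₀a, -⟩ := on_prop (Finset.mem_inter.1 hF₀).1
  obtain ⟨K₀, hK₀⟩ := Finset.card_pos.1 (show 0 < ((𝒯 i₀).adj F₀).card by omega)
  have hK₀c := controlled_of_mem_cauchyFacets hd hρ hb hfit i₀ hF₀ hK₀
  -- the points with a controlled neighbourhood form an open set, which is closed relative to `Ω`
  set u : Set (E d) := {x | ∃ r > 0, Controlled 𝒯 (Metric.ball x r)} with hu
  have huo : IsOpen u := by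
    rw [Metric.isOpen_iff]
    rintro x ⟨r, hr, hx⟩
    refine ⟨r, hr, fun y hy => ⟨r - dist y x, sub_pos.2 hy, hx.mono ?_⟩⟩
    exact Metric.ball_subset_ball' (by linarith)
  have hΩu : G.Ω ⊆ u := by
    refine G.isConnected.isPreconnected.subset_of_closure_inter_subset huo ?_ ?_
    · obtain ⟨x, hx, r, hr, hxr⟩ := hcentre K₀ (mem_adj.1 hK₀).1
      exact ⟨x, hx, r, hr, hK₀c.mono hxr⟩
    · rintro x ⟨hxu, hxΩ⟩
      obtain ⟨R, hR, hball⟩ := Metric.isOpen_iff.1 G.isOpen x hxΩ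
      obtain ⟨y, ⟨r, hr, hy⟩, hxy⟩ := Metric.mem_closure_iff.1 hxu R hR
      refine ⟨R, hR, Controlled.of_ball hd hρ hb (convex_ball x R) measurableSet_ball
        (hball.trans subset_closure) (c := y) ?_ hr hy⟩
      rwa [Metric.mem_ball, dist_comm]
  rw [closure_eq (T := 𝒯 i₀)]
  refine Controlled.biUnion hh _ fun s hs => ?_
  obtain ⟨x, hx, r, hr, hxr⟩ := hcentre s hs
  obtain ⟨r', hr', hc⟩ := hΩu hx
  exact Controlled.of_ball hd hρ hb (convex_convexHull ℝ _) (measurableSet_hull s)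
    (hull_subset_closure hs) (hxr (Metric.mem_ball_self hr)) hr' hc

include hd hρ hb in
/-- **Discrete Poincaré inequality** for cellwise constant functions, uniformly in the mesh. -/
theorem exists_poincare_cells (hfit : ∀ i, (𝒯 i).Fits G.ΓD ∧ (𝒯 i).Fits G.ΓN) :
    ∃ C : ℝ, 0 ≤ C ∧ ∀ i, ∀ q : Finset (E d) → ℝ,
      (𝒯 i).h ^ d * ∑ s ∈ (𝒯 i).cells, q s ^ 2 ≤ C * energy G (𝒯 i) q := by
  obtain ⟨C, hC, h⟩ := controlled_closure hd hρ hb hfit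
  have hbc := ballConst_pos (d := d)
  refine ⟨C / (ballConst d * ρ ^ d), by positivity, fun i q => ?_⟩
  have hh : 0 < (𝒯 i).h := h_pos (by omega) G.isConnected.nonempty
  have he := energy_nonneg (𝒯 i) hh.le q
  have h1 : ENNReal.ofReal (∑ s ∈ (𝒯 i).cells, q s ^ 2 * (ballConst d * (ρ * (𝒯 i).h) ^ d))
      ≤ ENNReal.ofReal (C * energy G (𝒯 i) q) := by
    refine le_trans ?_ (h i q)
    rw [ENNReal.ofReal_sum_of_nonneg fun s _ => by positivity]
    simp only [cellSq]
    rw [lintegral_finsetSum _ fun s _ => measurable_const.indicator (measurableSet_hull s)]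
    refine Finset.sum_le_sum fun s hs => ?_
    rw [lintegral_indicator_const (measurableSet_hull s), ENNReal.ofReal_mul (sq_nonneg _),
      Measure.restrict_apply (measurableSet_hull s),
      inter_eq_left.2 (hull_subset_closure hs)]
    gcongr
    obtain ⟨x, hx⟩ := hb i s hs
    rw [← volume_ball_eq x (mul_pos hρ hh)]
    exact measure_mono hx
  have h2 := (ENNReal.ofReal_le_ofReal_iff (by positivity)).1 h1
  rw [div_mul_eq_mul_div, le_div_iff₀ (by positivity)]
  refine le_trans (le_of_eq ?_) h2
  rw [← Finset.sum_mul]; ring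

end Poincare

end CauchyFEM
end

noncomputable section
namespace CauchyFEM
variable {d : ℕ}

/-! ### The norm of `H¹(Ω)` -/

lemma norm_sq_Lp_eq {α F : Type*} [MeasurableSpace α] {μ : Measure α} [NormedAddCommGroup F]
    [InnerProductSpace ℝ F] (f : Lp F 2 μ) : ‖f‖ ^ 2 = ∫ x, ‖f x‖ ^ 2 ∂μ := by
  rw [← real_inner_self_eq_norm_sq, L2.inner_def]
  exact integral_congr_ae (Eventually.of_forall fun x => real_inner_self_eq_norm_sq _)

section H1norm

variable {Ω : Set (E d)}

lemma memLp_fn (v : H1 Ω) : MemLp (fn v) 2 (vol Ω) := Lp.memLp v.1.fst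

lemma memLp_grad (v : H1 Ω) : MemLp (grad v) 2 (vol Ω) := Lp.memLp v.1.snd

lemma integrable_fn_sq (v : H1 Ω) : Integrable (fun x => fn v x ^ 2) (vol Ω) :=
  (memLp_fn v).integrable_sq

lemma integrable_grad_sq (v : H1 Ω) : Integrable (fun x => ‖grad v x‖ ^ 2) (vol Ω) :=
  (memLp_grad v).norm.integrable_sq

lemma norm_sq_eq (v : H1 Ω) : ‖v‖ ^ 2 = (∫ x in Ω, fn v x ^ 2) + ∫ x in Ω, ‖grad v x‖ ^ 2 := by
  have h := WithLp.prod_norm_sq_eq_of_L2 v.1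
  rw [norm_sq_Lp_eq, norm_sq_Lp_eq] at h
  change ‖v.1‖ ^ 2 = _
  rw [h]
  simp only [Real.norm_eq_abs, sq_abs]
  rfl

lemma integral_grad_sq_le (v : H1 Ω) : ∫ x in Ω, ‖grad v x‖ ^ 2 ≤ ‖v‖ ^ 2 := by
  rw [norm_sq_eq]
  exact le_add_of_nonneg_left (integral_nonneg fun x => sq_nonneg _)

lemma fn_sub (v w : H1 Ω) : fn (v - w) =ᵐ[vol Ω] (fn v) - (fn w) := Lp.coeFn_sub v.1.fst w.1.fst

lemma grad_sub (v w : H1 Ω) : grad (v - w) =ᵐ[vol Ω] (grad v) - (grad w) :=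
  Lp.coeFn_sub v.1.snd w.1.snd

end H1norm

/-- The Cauchy–Schwarz inequality for real integrals. -/
lemma sq_integral_mul_le {α : Type*} [MeasurableSpace α] {μ : Measure α} {f g : α → ℝ}
    (hf : MemLp f 2 μ) (hg : MemLp g 2 μ) :
    (∫ x, f x * g x ∂μ) ^ 2 ≤ (∫ x, f x ^ 2 ∂μ) * ∫ x, g x ^ 2 ∂μ := by
  have hfg : Integrable (fun x => f x * g x) μ := hf.integrable_mul (q := 2) hg
  have key : ∀ t : ℝ, 0 ≤ (∫ x, g x ^ 2 ∂μ) * (t * t) + (2 * ∫ x, f x * g x ∂μ) * t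
      + ∫ x, f x ^ 2 ∂μ := by
    intro t
    have h0 : 0 ≤ ∫ x, (f x + t * g x) ^ 2 ∂μ := integral_nonneg fun x => sq_nonneg _
    have e : ∀ x, (f x + t * g x) ^ 2 = t * t * g x ^ 2 + (2 * t * (f x * g x) + f x ^ 2) :=
      fun x => by ring
    simp only [e] at h0
    have i1 : Integrable (fun x => 2 * t * (f x * g x) + f x ^ 2) μ :=
      (hfg.const_mul _).add hf.integrable_sq
    rw [integral_add (hg.integrable_sq.const_mul _) i1,
      integral_add (hfg.const_mul _) hf.integrable_sq, integral_const_mul,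
      integral_const_mul] at h0
    linarith
  have := discrim_le_zero key
  unfold discrim at this
  nlinarith

namespace Mesh

open Classical

variable {Ω : Set (E d)} {T : Mesh Ω}

/-! ### Integrals over the cells -/

lemma nonempty_interior_hull {s : Finset (E d)} (hs : s ∈ T.cells) :
    (interior (hull s)).Nonempty := by
  obtain ⟨hf, hc⟩ := T.mem_cells.1 hs
  rw [interior_convexHull_nonempty_iff_affineSpan_eq_top]
  have := (T.indep hf).affineSpan_eq_top_iff_card_eq_finrank_add_one
  rw [Subtype.range_coe] at this
  refine this.2 ?_
  simp [hc]

lemma volume_interior_hull_ne_zero {s : Finset (E d)} (hs : s ∈ T.cells) :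
    volume (interior (hull s)) ≠ 0 :=
  (isOpen_interior.measure_pos _ (nonempty_interior_hull hs)).ne'

lemma volume_interior_hull_ne_top (s : Finset (E d)) : volume (interior (hull s)) ≠ ⊤ :=
  ((measure_mono interior_subset).trans_lt (isCompact_hull s).measure_lt_top).ne

lemma disjoint_interior_hull {s t : Finset (E d)} (hs : s ∈ T.cells) (ht : t ∈ T.cells)
    (hst : s ≠ t) : Disjoint (interior (hull s)) (interior (hull t)) := by
  rw [Set.disjoint_iff_inter_eq_empty,
    ← (isOpen_interior.inter isOpen_interior).measure_eq_zero_iff volume]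
  exact measure_mono_null (inter_subset_inter interior_subset interior_subset)
    (volume_hull_inter hs ht hst)

lemma integral_eq_sum_cells (hreg : interior (closure Ω) = Ω) {f : E d → ℝ}
    (hf : IntegrableOn f Ω) : ∫ x in Ω, f x = ∑ s ∈ T.cells, ∫ x in interior (hull s), f x := by
  rw [← integral_biUnion_finset T.cells (fun s _ => isOpen_interior.measurableSet)
    (fun s hs t ht hst => disjoint_interior_hull hs ht hst)
    (fun s hs => hf.mono_set (interior_hull_subset hreg hs))]
  refine setIntegral_congr_set ?_
  have hsub : (⋃ s ∈ T.cells, interior (hull s)) ⊆ Ω :=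
    iUnion₂_subset fun s hs => interior_hull_subset hreg hs
  have hnull : volume (Ω \ ⋃ s ∈ T.cells, interior (hull s)) = 0 := by
    refine measure_mono_null (t := ⋃ s ∈ T.cells, frontier (hull s)) ?_
      ((measure_biUnion_null_iff T.cells.countable_toSet).2 fun s _ =>
        (convex_convexHull ℝ _).addHaar_frontier volume)
    rintro x ⟨hx, hx2⟩
    obtain ⟨s, hs, hxs⟩ := exists_cell (T := T) (subset_closure hx)
    refine mem_biUnion (Finset.mem_coe.2 hs) ⟨subset_closure hxs, fun h => hx2 ?_⟩
    exact mem_biUnion (Finset.mem_coe.2 hs) h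
  exact (ae_eq_set.2 ⟨hnull, by rw [Set.sdiff_eq_empty.2 hsub, measure_empty]⟩)

/-! ### Piecewise affine functions -/

/-- On an open set, a function with an affine first component has a constant weak gradient. -/
lemma grad_ae_eq_of_affine {U : Set (E d)} (hU : IsOpen U) (hUΩ : U ⊆ Ω) (v : H1 Ω) (a : E d)
    (b : ℝ) (hv : ∀ᵐ x ∂volume.restrict U, fn v x = inner ℝ a x + b) :
    ∀ᵐ x ∂volume.restrict U, grad v x = a := by
  have hcomp : ∀ i, ∀ᵐ x ∂volume.restrict U, (grad v x) i = a i := by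
    intro i
    have hgi : MemLp (fun x => (grad v x) i) 2 (vol Ω) := by
      refine MemLp.of_le (memLp_grad v) ?_ (Eventually.of_forall fun x => PiLp.norm_apply_le _ i)
      exact (EuclideanSpace.proj (𝕜 := ℝ) i).continuous.comp_aestronglyMeasurable (grad_meas v)
    have hloc : LocallyIntegrableOn (fun x => (grad v x) i - a i) U volume := by
      have h1 : LocallyIntegrableOn (fun x => (grad v x) i) U volume := by
        have := (hgi.locallyIntegrable (by norm_num)).locallyIntegrableOn U
        rw [locallyIntegrableOn_iff hU.isLocallyClosed] at this ⊢
        intro K hK hKc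
        have h2 := this K hK hKc
        rwa [IntegrableOn, Measure.restrict_restrict hKc.measurableSet,
          inter_eq_self_of_subset_left (hK.trans hUΩ)] at h2
      exact h1.sub ((locallyIntegrable_const (a i)).locallyIntegrableOn U)
    rw [ae_restrict_iff' hU.measurableSet]
    have := hU.ae_eq_zero_of_integral_contDiff_smul_eq_zero hloc ?_
    · filter_upwards [this] with x hx hxU
      linarith [hx hxU]
    intro φ hφ hc hs
    have hz : ∀ x ∉ U, φ x = 0 := fun x hx => image_eq_zero_of_notMem_tsupport fun h => hx (hs h)
    have hzd : ∀ x ∉ U, pd φ i x = 0 := fun x hx => by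
      have h0 : x ∉ tsupport (fderiv ℝ φ) := fun h => hx (hs (tsupport_fderiv_subset ℝ h))
      rw [pd, image_eq_zero_of_notMem_tsupport h0]; rfl
    have hweak := v.2 φ hφ hc (hs.trans hUΩ) i
    change ∫ x in Ω, fn v x * pd φ i x = - ∫ x in Ω, (grad v x) i * φ x at hweak
    -- integrals against a function supported in `U` do not change with the domain
    have hres : ∀ (k : E d → ℝ), (∀ x ∉ U, k x = 0) → ∫ x in Ω, k x = ∫ x in U, k x := by
      intro k hk
      rw [setIntegral_eq_integral_of_forall_compl_eq_zero fun x hx => hk x fun h => hx (hUΩ h),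
        setIntegral_eq_integral_of_forall_compl_eq_zero hk]
    rw [hres _ fun x hx => by simp [hzd x hx], hres _ fun x hx => by simp [hz x hx]] at hweak
    have hL : ∫ x in U, fn v x * pd φ i x = - ∫ x in U, a i * φ x := by
      have e1 : ∫ x in U, fn v x * pd φ i x = ∫ x in U, (inner ℝ a x + b) * pd φ i x :=
        integral_congr_ae (hv.mono fun x hx => by simp only [hx])
      rw [e1, setIntegral_eq_integral_of_forall_compl_eq_zero fun x hx => by simp [hzd x hx],
        setIntegral_eq_integral_of_forall_compl_eq_zero fun x hx => by simp [hz x hx]]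
      have hder : ∀ x, HasFDerivAt (fun x => inner ℝ a x + b) (innerSL ℝ a) x := fun x =>
        ((innerSL ℝ a).hasFDerivAt).add_const b
      have hfd : ∀ x, fderiv ℝ (fun x => inner ℝ a x + b) x (EuclideanSpace.single i 1) = a i := by
        intro x
        rw [(hder x).fderiv]
        simp [EuclideanSpace.inner_single_right]
      have hcont : Continuous fun x : E d => inner ℝ a x + b := by fun_prop
      have := integral_mul_fderiv_eq_neg_fderiv_mul_of_integrable (μ := (volume : Measure (E d)))
        (f := fun x => inner ℝ a x + b) (g := φ) (v := EuclideanSpace.single i 1) ?_ ?_ ?_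
        (fun x _ => (hder x).differentiableAt) (fun x _ => hφ.differentiable (by simp) x)
      · simp only [hfd] at this
        exact this
      · simp only [hfd]
        exact (hφ.continuous.integrable_of_hasCompactSupport hc).const_mul _
      · exact (hcont.mul (pd_continuous hφ i)).integrable_of_hasCompactSupport
          ((pd_compact hc i).mul_left)
      · exact (hcont.mul hφ.continuous).integrable_of_hasCompactSupport hc.mul_left
    have hi1 : IntegrableOn (fun x => (grad v x) i * φ x) U :=
      IntegrableOn.mono_set (test_integrable_vec v.1.snd i hφ.continuous hc) hUΩ
    have hi2 : IntegrableOn (fun x => a i * φ x) U :=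
      ((hφ.continuous.integrable_of_hasCompactSupport hc).const_mul _).integrableOn
    rw [← setIntegral_eq_integral_of_forall_compl_eq_zero (s := U) fun x hx => by simp [hz x hx]]
    have e2 : ∀ x, φ x • ((grad v x) i - a i) = (grad v x) i * φ x - a i * φ x := fun x => by
      rw [smul_eq_mul]; ring
    simp only [e2]
    rw [integral_sub hi1 hi2]
    linarith
  have := (ae_all_iff (μ := volume.restrict U)).2 hcomp
  filter_upwards [this] with x hx
  ext i; exact hx i

/-- A function of `X_h` has a continuous representative, which on each cell is the affine
function `cellVal` with gradient `cellGrad`. -/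
lemma exists_rep (hreg : interior (closure Ω) = Ω) (v : T.X) :
    ∃ g : E d → ℝ, fn (v : H1 Ω) =ᵐ[vol Ω] g ∧ ∀ s ∈ T.cells,
      (∀ x ∈ hull s, cellVal (v : H1 Ω) s x = g x) ∧
      (∀ x y, cellVal (v : H1 Ω) s x = cellVal (v : H1 Ω) s y
        + inner ℝ (cellGrad (v : H1 Ω) s) (x - y)) ∧
      ∀ᵐ x ∂volume.restrict (interior (hull s)), grad (v : H1 Ω) x = cellGrad (v : H1 Ω) s := by
  obtain ⟨v, g, -, hA, hv⟩ := v
  refine ⟨g, hv, fun s hs => ?_⟩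
  obtain ⟨A, hA⟩ := hA s hs
  obtain ⟨a, b, hab⟩ : ∃ (a : E d) (b : ℝ), ∀ x, A x = inner ℝ a x + b := by
    refine ⟨(InnerProductSpace.toDual ℝ (E d)).symm A.linear.toContinuousLinearMap, A 0,
      fun x => ?_⟩
    rw [InnerProductSpace.toDual_symm_apply]
    have := congrFun (A.decomp) x
    simpa using this
  set U := interior (hull s) with hU
  have hUo : IsOpen U := isOpen_interior
  have hUΩ : U ⊆ Ω := interior_hull_subset hreg hs
  have h0 := volume_interior_hull_ne_zero hs
  have h1 := volume_interior_hull_ne_top s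
  have hvU : ∀ᵐ x ∂volume.restrict U, fn v x = inner ℝ a x + b := by
    filter_upwards [ae_restrict_of_ae_restrict_of_subset hUΩ hv,
      ae_restrict_mem hUo.measurableSet] with x hx hxU
    rw [hx, hA (interior_subset hxU), hab]
  have hgU := grad_ae_eq_of_affine hUo hUΩ v a b hvU
  have hcg : cellGrad v s = a := by
    unfold cellGrad
    rw [average_congr hgU, setAverage_const h0 h1]
  have hcv : ∀ x, cellVal v s x = inner ℝ a x + b := by
    intro x
    unfold cellVal
    rw [hcg]
    have : ∀ᵐ y ∂volume.restrict U, fn v y + inner ℝ a (x - y) = inner ℝ a x + b := by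
      filter_upwards [hvU] with y hy
      rw [hy, inner_sub_right]; ring
    rw [average_congr this, setAverage_const h0 h1]
  refine ⟨fun x hx => ?_, fun x y => ?_, by rwa [hcg]⟩
  · rw [hcv, hA hx, hab]
  · rw [hcv, hcv, hcg, inner_sub_right]; ring

end Mesh
end CauchyFEM
end

noncomputable section
namespace CauchyFEM
variable {d : ℕ}

/-! ### An inverse estimate -/

/-- Cut-off functions on balls: the integral scales like the volume and the derivatives like the
inverse of the radius. -/
lemma exists_cutoff (d : ℕ) : ∃ I > 0, ∃ K ≥ 0, ∀ (c : E d) (r : ℝ), 0 < r →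
    ∃ θ : E d → ℝ, ContDiff ℝ ∞ θ ∧ HasCompactSupport θ ∧ tsupport θ ⊆ Metric.ball c r ∧
      (∀ x, |θ x| ≤ 1) ∧ ∫ x, θ x = I * r ^ d ∧ ∀ i x, |pd θ i x| ≤ K / r := by
  let f : ContDiffBump (0 : E d) := ⟨1 / 3, 1 / 2, by norm_num, by norm_num⟩
  have hfs : ContDiff ℝ ∞ f := f.contDiff
  have hex : ∀ i, ∃ K, ∀ x, ‖pd f i x‖ ≤ K := fun i =>
    (pd_compact f.hasCompactSupport i).exists_bound_of_continuous (pd_continuous hfs i)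
  choose Ki hKi using hex
  refine ⟨∫ x, f x, f.integral_pos, ∑ i, |Ki i|, Finset.sum_nonneg fun _ _ => abs_nonneg _,
    fun c r hr => ?_⟩
  let A : E d → E d := fun x => r⁻¹ • (x - c)
  have hA : ContDiff ℝ ∞ A := (contDiff_id.sub contDiff_const).const_smul _
  have hsupp : Function.support (fun x => f (A x)) ⊆ Metric.closedBall c (r / 2) := by
    intro x hx
    have : A x ∈ Function.support f := hx
    rw [f.support_eq, mem_ball_zero_iff, norm_smul, norm_inv, Real.norm_of_nonneg hr.le] at this
    rw [Metric.mem_closedBall, dist_eq_norm]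
    change r⁻¹ * ‖x - c‖ < 1 / 2 at this
    rw [inv_mul_lt_iff₀ hr] at this
    linarith
  have hts : tsupport (fun x => f (A x)) ⊆ Metric.closedBall c (r / 2) :=
    closure_minimal hsupp Metric.isClosed_closedBall
  refine ⟨fun x => f (A x), hfs.comp hA,
    HasCompactSupport.of_support_subset_isCompact (isCompact_closedBall _ _) hsupp,
    hts.trans (Metric.closedBall_subset_ball (by linarith)), fun x => ?_, ?_, fun i x => ?_⟩
  · rw [abs_of_nonneg f.nonneg]; exact f.le_one
  · rw [integral_sub_right_eq_self (fun x => f (r⁻¹ • x)) c,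
      Measure.integral_comp_inv_smul_of_nonneg _ _ hr.le, finrank_euclideanSpace,
      Fintype.card_fin, smul_eq_mul, mul_comm]
  · have hd : HasFDerivAt A (r⁻¹ • ContinuousLinearMap.id ℝ (E d)) x :=
      ((hasFDerivAt_id x).sub_const c).const_smul r⁻¹
    have hd2 := ((hfs.differentiable (by simp) (A x)).hasFDerivAt.comp x hd)
    have : pd (fun x => f (A x)) i x = r⁻¹ * pd f i (A x) := by
      unfold pd
      rw [show (fun x => f (A x)) = f ∘ A from rfl, hd2.fderiv]
      simp
    rw [this, abs_mul, abs_of_pos (inv_pos.2 hr), div_eq_inv_mul]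
    refine mul_le_mul_of_nonneg_left ?_ (inv_pos.2 hr).le
    refine (hKi i (A x)).trans ((le_abs_self _).trans ?_)
    exact Finset.single_le_sum (f := fun i => |Ki i|) (fun _ _ => abs_nonneg _) (Finset.mem_univ i)

namespace Mesh

open Classical

variable {Ω : Set (E d)} {T : Mesh Ω}

lemma volume_real_interior_le (hh : 0 ≤ T.h) {s : Finset (E d)} (hs : s ∈ T.cells) :
    volume.real (interior (hull s)) ≤ ballConst d * T.h ^ d := by
  have h0 : 0 ≤ ballConst d * T.h ^ d := mul_nonneg ballConst_pos.le (pow_nonneg hh d)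
  refine ENNReal.toReal_le_of_le_ofReal h0 ((measure_mono interior_subset).trans ?_)
  exact volume_hull_le hs

/-- Integration by parts against a cut-off function in the cell `s` recovers the constant
gradient of `v` on `s` from `w` and the difference `w - v`. -/
lemma sq_cellGrad_mul_le (hreg : interior (closure Ω) = Ω) (v : T.X) (w : H1 Ω)
    {s : Finset (E d)} (hs : s ∈ T.cells) {θ : E d → ℝ} (hθ : ContDiff ℝ ∞ θ)
    (hc : HasCompactSupport θ) (hsupp : tsupport θ ⊆ interior (hull s)) (h1 : ∀ x, |θ x| ≤ 1)
    {i : Fin d} {K : ℝ} (hK : ∀ x, |pd θ i x| ≤ K) :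
    ((cellGrad (v : H1 Ω) s) i * ∫ x, θ x) ^ 2 ≤
      2 * volume.real (interior (hull s)) *
        (K ^ 2 * (∫ x in interior (hull s), fn (w - (v : H1 Ω)) x ^ 2)
          + ∫ x in interior (hull s), ‖grad w x‖ ^ 2) := by
  obtain ⟨_, _, hv⟩ := exists_rep hreg v
  have hg := (hv s hs).2.2
  set g := cellGrad (v : H1 Ω) s
  set U := interior (hull s) with hU
  have hUΩ : U ⊆ Ω := interior_hull_subset hreg hs
  have hz : ∀ x ∉ U, θ x = 0 := fun x hx => image_eq_zero_of_notMem_tsupport fun h => hx (hsupp h)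
  have hzd : ∀ x ∉ U, pd θ i x = 0 := fun x hx => by
    have h0 : x ∉ tsupport (fderiv ℝ θ) := fun h => hx (hsupp (tsupport_fderiv_subset ℝ h))
    rw [pd, image_eq_zero_of_notMem_tsupport h0]; rfl
  have hres : ∀ (k : E d → ℝ), (∀ x ∉ U, k x = 0) → ∫ x in Ω, k x = ∫ x in U, k x := by
    intro k hk
    rw [setIntegral_eq_integral_of_forall_compl_eq_zero fun x hx => hk x fun h => hx (hUΩ h),
      setIntegral_eq_integral_of_forall_compl_eq_zero hk]
  have hle : volume.restrict U ≤ vol Ω := Measure.restrict_mono hUΩ le_rfl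
  set e := w - (v : H1 Ω)
  have hweak := e.2 θ hθ hc (hsupp.trans hUΩ) i
  change ∫ x in Ω, fn e x * pd θ i x = - ∫ x in Ω, (grad e x) i * θ x at hweak
  rw [hres _ fun x hx => by simp [hzd x hx], hres _ fun x hx => by simp [hz x hx]] at hweak
  have hi1 : Integrable (fun x => (grad w x) i * θ x) (volume.restrict U) :=
    (test_integrable_vec w.1.snd i hθ.continuous hc).mono_measure hle
  have hi2 : Integrable (fun x => g i * θ x) (volume.restrict U) :=
    ((hθ.continuous.integrable_of_hasCompactSupport hc).const_mul _).mono_measure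
      Measure.restrict_le_self
  have e1 : ∫ x in U, (grad e x) i * θ x = (∫ x in U, (grad w x) i * θ x) - g i * ∫ x, θ x := by
    rw [← setIntegral_eq_integral_of_forall_compl_eq_zero hz, ← integral_const_mul,
      ← integral_sub hi1 hi2]
    refine integral_congr_ae ?_
    filter_upwards [hg, ae_restrict_of_ae_restrict_of_subset hUΩ (grad_sub w (v : H1 Ω))]
      with x hx1 hx2
    rw [hx2, Pi.sub_apply, PiLp.sub_apply, hx1]; ring
  have key : g i * ∫ x, θ x = (∫ x in U, fn e x * pd θ i x) + ∫ x in U, (grad w x) i * θ x := by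
    rw [hweak, e1]; ring
  have m1 : MemLp (fn e) 2 (volume.restrict U) := (memLp_fn e).mono_measure hle
  have m2 : MemLp (pd θ i) 2 (volume.restrict U) :=
    ((pd_continuous hθ i).memLp_of_hasCompactSupport (pd_compact hc i))
  have m3 : MemLp (fun x => (grad w x) i) 2 (volume.restrict U) := by
    refine MemLp.mono_measure hle ?_
    refine MemLp.of_le (memLp_grad w) ?_ (Eventually.of_forall fun x => PiLp.norm_apply_le _ i)
    exact (EuclideanSpace.proj (𝕜 := ℝ) i).continuous.comp_aestronglyMeasurable (grad_meas w)
  have m4 : MemLp θ 2 (volume.restrict U) := hθ.continuous.memLp_of_hasCompactSupport hc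
  have c1 := sq_integral_mul_le m1 m2
  have c2 := sq_integral_mul_le m3 m4
  have hfin : volume U ≠ ⊤ := volume_interior_hull_ne_top s
  have : IsFiniteMeasure (volume.restrict U) := ⟨by simpa using hfin.lt_top⟩
  have b1 : ∫ x in U, pd θ i x ^ 2 ≤ K ^ 2 * volume.real U := by
    have := integral_mono (μ := volume.restrict U) m2.integrable_sq
      (integrable_const (K ^ 2)) fun x => sq_le_sq' (abs_le.1 (hK x)).1 (abs_le.1 (hK x)).2
    rwa [integral_const, smul_eq_mul, measureReal_restrict_apply_univ, mul_comm] at this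
  have b2 : ∫ x in U, θ x ^ 2 ≤ volume.real U := by
    have := integral_mono (μ := volume.restrict U) m4.integrable_sq
      (integrable_const (1 ^ 2 : ℝ)) fun x => sq_le_sq' (abs_le.1 (h1 x)).1 (abs_le.1 (h1 x)).2
    rwa [integral_const, smul_eq_mul, measureReal_restrict_apply_univ, one_pow, mul_one] at this
  have b3 : ∫ x in U, (grad w x) i ^ 2 ≤ ∫ x in U, ‖grad w x‖ ^ 2 := by
    refine integral_mono m3.integrable_sq ((integrable_grad_sq w).mono_measure hle) fun x => ?_
    have := PiLp.norm_apply_le (grad w x) i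
    exact sq_le_sq' (by linarith [neg_abs_le ((grad w x) i), Real.norm_eq_abs ((grad w x) i)])
      ((le_abs_self _).trans this)
  have n1 : 0 ≤ ∫ x in U, fn e x ^ 2 := integral_nonneg fun x => sq_nonneg _
  have n2 : 0 ≤ ∫ x in U, (grad w x) i ^ 2 := integral_nonneg fun x => sq_nonneg _
  have n3 : 0 ≤ volume.real U := measureReal_nonneg
  rw [key]
  have d1 := mul_le_mul_of_nonneg_left b1 n1
  have d2 : (∫ x in U, (grad w x) i ^ 2) * (∫ x in U, θ x ^ 2)
      ≤ (∫ x in U, ‖grad w x‖ ^ 2) * volume.real U :=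
    mul_le_mul b3 b2 (integral_nonneg fun x => sq_nonneg _) (n2.trans b3)
  nlinarith [sq_nonneg ((∫ x in U, fn e x * pd θ i x) - ∫ x in U, (grad w x) i * θ x)]

lemma norm_sq_eq_sum (a : E d) : ‖a‖ ^ 2 = ∑ i, a i ^ 2 := EuclideanSpace.real_norm_sq_eq a

lemma integral_grad_sq_eq_sum (hreg : interior (closure Ω) = Ω) (v : T.X) :
    ∫ x in Ω, ‖grad (v : H1 Ω) x‖ ^ 2
      = ∑ s ∈ T.cells, volume.real (interior (hull s)) * ‖cellGrad (v : H1 Ω) s‖ ^ 2 := by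
  obtain ⟨_, _, hv⟩ := exists_rep hreg v
  rw [integral_eq_sum_cells (T := T) hreg (integrable_grad_sq _)]
  refine Finset.sum_congr rfl fun s hs => ?_
  rw [integral_congr_ae (g := fun _ => ‖cellGrad (v : H1 Ω) s‖ ^ 2)
    ((hv s hs).2.2.mono fun x hx => by simp only [hx]), integral_const, smul_eq_mul,
    measureReal_restrict_apply_univ]

end Mesh

namespace Mesh

variable {Ω : Set (E d)} {T : Mesh Ω}

/-- The contribution of one cell to the inverse estimate; `I` and `K` are the constants of the
cut-off functions. -/
lemma volume_mul_sq_cellGrad_le (hreg : interior (closure Ω) = Ω) {I K ρ : ℝ} (hI : 0 < I)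
    (hρ : 0 < ρ) (hT : 0 < T.h) (v : T.X) (w : H1 Ω) {s : Finset (E d)} (hs : s ∈ T.cells)
    {θ : E d → ℝ} (t1 : ContDiff ℝ ∞ θ) (t2 : HasCompactSupport θ)
    (hsub : tsupport θ ⊆ interior (hull s)) (t4 : ∀ x, |θ x| ≤ 1)
    (t5 : ∫ x, θ x = I * (ρ * T.h) ^ d) (t6 : ∀ i x, |pd θ i x| ≤ K / (ρ * T.h)) :
    volume.real (interior (hull s)) * ‖cellGrad (v : H1 Ω) s‖ ^ 2 ≤
      2 * ballConst d ^ 2 * d / (I * ρ ^ d) ^ 2 * ((K / ρ) ^ 2 + 1) *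
        ((T.h⁻¹) ^ 2 * (∫ x in interior (hull s), fn (w - (v : H1 Ω)) x ^ 2)
          + ∫ x in interior (hull s), ‖grad w x‖ ^ 2) := by
  have hI2 : 0 < (I * (ρ * T.h) ^ d) ^ 2 := by positivity
  have hcomp := fun j => sq_cellGrad_mul_le hreg v w hs t1 t2 hsub t4 (t6 j)
  have hp : 0 ≤ ∫ x in interior (hull s), fn (w - (v : H1 Ω)) x ^ 2 :=
    integral_nonneg fun x => sq_nonneg _
  have hq : 0 ≤ ∫ x in interior (hull s), ‖grad w x‖ ^ 2 := integral_nonneg fun x => sq_nonneg _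
  have hvol := volume_real_interior_le hT.le hs
  have hvol0 : 0 ≤ volume.real (interior (hull s)) := measureReal_nonneg
  rw [t5] at hcomp
  have hB : 0 < ballConst d := ballConst_pos
  have hG := norm_sq_eq_sum (cellGrad (v : H1 Ω) s)
  generalize (∫ x in interior (hull s), fn (w - (v : H1 Ω)) x ^ 2) = p at *
  generalize (∫ x in interior (hull s), ‖grad w x‖ ^ 2) = q at *
  generalize cellGrad (v : H1 Ω) s = g at *
  generalize volume.real (interior (hull s)) = m at *
  generalize ballConst d = B at *
  generalize T.h = h at *
  have hcomp2 : ∀ j, g j ^ 2 ≤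
      (2 * (B * h ^ d) * ((K / (ρ * h)) ^ 2 * p + q)) / (I * (ρ * h) ^ d) ^ 2 := by
    intro j
    rw [le_div_iff₀ hI2, ← mul_pow]
    refine (hcomp j).trans ?_
    gcongr
  have hsum : ‖g‖ ^ 2 ≤
      d * ((2 * (B * h ^ d) * ((K / (ρ * h)) ^ 2 * p + q)) / (I * (ρ * h) ^ d) ^ 2) := by
    rw [hG]
    refine (Finset.sum_le_sum fun j _ => hcomp2 j).trans ?_
    rw [Finset.sum_const, Finset.card_univ, Fintype.card_fin, nsmul_eq_mul]
  refine (mul_le_mul hvol hsum (sq_nonneg _) (by positivity)).trans ?_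
  have e : B * h ^ d *
      (d * ((2 * (B * h ^ d) * ((K / (ρ * h)) ^ 2 * p + q)) / (I * (ρ * h) ^ d) ^ 2))
      = 2 * B ^ 2 * d / (I * ρ ^ d) ^ 2 * ((K / ρ) ^ 2 * ((h⁻¹) ^ 2 * p) + q) := by
    have : h ^ d ≠ 0 := by positivity
    rw [mul_pow ρ h d]
    field_simp
  rw [e, mul_assoc (2 * B ^ 2 * d / (I * ρ ^ d) ^ 2)]
  have a1 : 0 ≤ 2 * B ^ 2 * d / (I * ρ ^ d) ^ 2 := by positivity
  have a2 : 0 ≤ (h⁻¹) ^ 2 * p := by positivity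
  refine mul_le_mul_of_nonneg_left ?_ a1
  nlinarith [mul_nonneg (sq_nonneg (K / ρ)) hq]

end Mesh

/-- The arithmetic of the inverse estimate. -/
lemma inverse_estimate_arith {D C₁ e2 w2 F z fv gv N : ℝ} (hC : 0 ≤ C₁) (hw : 0 ≤ w2)
    (hF : 0 ≤ F) (hz : 0 ≤ z) (hN : 0 ≤ N) (hgrad : gv ≤ C₁ * (z + w2))
    (hfn : fv ≤ 2 * F + 2 * e2) (hscale : e2 ≤ D ^ 2 * z) :
    fv + gv ≤ (2 * D ^ 2 + 2 + C₁) * (z + 2 * N + (F + w2)) := by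
  have h1 : fv + gv ≤ 2 * F + 2 * (D ^ 2 * z) + C₁ * (z + w2) := by linarith
  have h2 : 0 ≤ D ^ 2 * F := mul_nonneg (sq_nonneg D) hF
  have h3 : 0 ≤ D ^ 2 * w2 := mul_nonneg (sq_nonneg D) hw
  have h4 : 0 ≤ C₁ * F := mul_nonneg hC hF
  have h5 : 0 ≤ (2 * D ^ 2 + 2 + C₁) * (2 * N) := by positivity
  nlinarith

/-- An inverse estimate in perturbed form: if the discrete function `v` is close to some
`w ∈ H¹(Ω)` in `L²(Ω)`, relative to the mesh size, then the norm of `v` is bounded by that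
of `w`. -/
lemma exists_inverse_estimate {Ω : Set (E d)} {ι : Type*} {𝒯 : ι → Mesh Ω}
    (hreg : interior (closure Ω) = Ω) {ρ : ℝ} (hρ : 0 < ρ) (hh : ∀ i, 0 < (𝒯 i).h)
    (hb : ∀ i, ∀ s ∈ (𝒯 i).cells, ∃ x, Metric.ball x (ρ * (𝒯 i).h) ⊆ hull s) :
    ∃ C ≥ 0, ∀ i (v : (𝒯 i).X) (w : H1 Ω),
      ‖(v : H1 Ω)‖ ≤ C * ((𝒯 i).h⁻¹ * √(∫ x in Ω, fn (w - (v : H1 Ω)) x ^ 2) + ‖w‖) := by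
  obtain ⟨I, hI, K, hK, hcut⟩ := exists_cutoff d
  set D := Metric.diam (closure Ω) with hD
  set B := ballConst d with hB
  have hBpos : 0 < B := ballConst_pos
  set C₁ := 2 * B ^ 2 * d / (I * ρ ^ d) ^ 2 * ((K / ρ) ^ 2 + 1) with hC₁
  have hC₁0 : 0 ≤ C₁ := by positivity
  suffices main : ∀ T : Mesh Ω, 0 < T.h →
      (∀ s ∈ T.cells, ∃ x, Metric.ball x (ρ * T.h) ⊆ hull s) → ∀ (v : T.X) (w : H1 Ω),
      ‖(v : H1 Ω)‖ ≤ √(2 * D ^ 2 + 2 + C₁) *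
        (T.h⁻¹ * √(∫ x in Ω, fn (w - (v : H1 Ω)) x ^ 2) + ‖w‖) from
    ⟨√(2 * D ^ 2 + 2 + C₁), Real.sqrt_nonneg _, fun i v w => main (𝒯 i) (hh i) (hb i) v w⟩
  intro T hT hb v w
  have hTD : T.h ≤ D := T.h_le
  set e2 := ∫ x in Ω, fn (w - (v : H1 Ω)) x ^ 2 with he2
  set w2 := ∫ x in Ω, ‖grad w x‖ ^ 2 with hw2
  have he20 : 0 ≤ e2 := integral_nonneg fun x => sq_nonneg _
  have hw20 : 0 ≤ w2 := integral_nonneg fun x => sq_nonneg _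
  have hI2 : 0 < (I * (ρ * T.h) ^ d) ^ 2 := by positivity
  have hcell : ∀ s ∈ T.cells, volume.real (interior (hull s)) * ‖cellGrad (v : H1 Ω) s‖ ^ 2 ≤
      C₁ * ((T.h⁻¹) ^ 2 * (∫ x in interior (hull s), fn (w - (v : H1 Ω)) x ^ 2)
        + ∫ x in interior (hull s), ‖grad w x‖ ^ 2) := by
    intro s hs
    obtain ⟨c, hc⟩ := hb s hs
    obtain ⟨θ, t1, t2, t3, t4, t5, t6⟩ := hcut c (ρ * T.h) (by positivity)
    exact Mesh.volume_mul_sq_cellGrad_le hreg hI hρ hT v w hs t1 t2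
      (t3.trans (interior_maximal hc Metric.isOpen_ball)) t4 t5 t6
  have hgrad : ∫ x in Ω, ‖grad (v : H1 Ω) x‖ ^ 2 ≤ C₁ * ((T.h⁻¹) ^ 2 * e2 + w2) := by
    rw [Mesh.integral_grad_sq_eq_sum hreg v, he2, hw2,
      Mesh.integral_eq_sum_cells (T := T) hreg (integrable_fn_sq _),
      Mesh.integral_eq_sum_cells (T := T) hreg (integrable_grad_sq _), Finset.mul_sum,
      ← Finset.sum_add_distrib, Finset.mul_sum]
    exact Finset.sum_le_sum hcell
  have hfn : ∫ x in Ω, fn (v : H1 Ω) x ^ 2 ≤ 2 * (∫ x in Ω, fn w x ^ 2) + 2 * e2 := by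
    rw [he2, ← integral_const_mul, ← integral_const_mul,
      ← integral_add ((integrable_fn_sq _).const_mul _) ((integrable_fn_sq _).const_mul _)]
    refine integral_mono_ae (integrable_fn_sq _)
      (((integrable_fn_sq _).const_mul _).add ((integrable_fn_sq _).const_mul _)) ?_
    filter_upwards [fn_sub w (v : H1 Ω)] with x hx
    rw [hx, Pi.sub_apply]
    nlinarith [sq_nonneg (2 * fn w x - fn (v : H1 Ω) x)]
  have hscale : e2 ≤ D ^ 2 * ((T.h⁻¹) ^ 2 * e2) := by
    have : 1 ≤ D ^ 2 * (T.h⁻¹) ^ 2 := by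
      rw [← mul_pow]
      refine one_le_pow₀ ?_
      rw [← div_eq_mul_inv, one_le_div hT]
      exact hTD
    nlinarith
  have hw := norm_sq_eq w
  have hv := norm_sq_eq (v : H1 Ω)
  have hN : 0 ≤ T.h⁻¹ * √e2 * ‖w‖ := by positivity
  have hfw : 0 ≤ ∫ x in Ω, fn w x ^ 2 := integral_nonneg fun x => sq_nonneg _
  have hsq : (T.h⁻¹ * √e2 + ‖w‖) ^ 2
      = (T.h⁻¹) ^ 2 * e2 + 2 * (T.h⁻¹ * √e2 * ‖w‖) + ‖w‖ ^ 2 := by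
    rw [add_sq, mul_pow, Real.sq_sqrt he20]; ring
  refine abs_le_of_sq_le_sq' ?_ (by positivity) |>.2
  rw [mul_pow, Real.sq_sqrt (by positivity), hsq, hv, hw]
  exact inverse_estimate_arith hC₁0 hw20 hfw (by positivity) hN hgrad hfn hscale

end CauchyFEM
end

noncomputable section
namespace CauchyFEM
variable {d : ℕ}

/-! ### Traces and normal derivatives of discrete functions -/

lemma trace_zero (Ω A : Set (E d)) : trace Ω A (0 : H1 Ω) = 0 :=
  if_pos ((H1van Ω A).zero_mem)

lemma integrableOn_hull_surf {f : E d → ℝ} (hf : Continuous f) {F : Finset (E d)}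
    (hF : F.card ≤ d) : IntegrableOn f (hull F) (surf d) := by
  obtain ⟨C, hC⟩ := (Mesh.isCompact_hull F).exists_bound_of_continuousOn hf.continuousOn
  exact Measure.integrableOn_of_bounded (surf_hull_lt_top hF).ne hf.aestronglyMeasurable
    ((ae_restrict_iff' (Mesh.measurableSet_hull F)).2 (Eventually.of_forall hC))

namespace Mesh

open Classical

variable {Ω : Set (E d)} {T : Mesh Ω}

lemma toH1_zero : toH1 (0 : H2 Ω) = 0 := rfl

lemma dx_zero (i : Fin d) : dx (0 : H2 Ω) i = 0 := rfl

lemma bval_disc (v : T.X) : bval (disc v) = T.faceVal (v : H1 Ω) := by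
  funext F x
  simp [bval, disc, toH1_zero, trace_zero]

lemma bdn_disc (v : T.X) : bdn (disc v) = fun F _ => T.normalFlux (v : H1 Ω) F := by
  funext F x
  simp [bdn, disc, dx_zero, trace_zero]

lemma bjump_disc (v : T.X) : bjump (disc v) = fun F _ => T.normalFlux (v : H1 Ω) F := rfl

lemma bfn_disc (v : T.X) : bfn (disc v) = v := by
  simp [bfn, disc, toH1_zero]

lemma ip_self_nonneg (A : Finset (Finset (E d))) (p : Finset (E d) → E d → ℝ) : 0 ≤ ip A p p :=
  Finset.sum_nonneg fun _ _ => integral_nonneg fun _ => mul_self_nonneg _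

lemma nrm_sq (A : Finset (Finset (E d))) (p : Finset (E d) → E d → ℝ) :
    nrm A p ^ 2 = ip A p p := Real.sq_sqrt (ip_self_nonneg A p)

lemma nrm_nonneg (A : Finset (Finset (E d))) (p : Finset (E d) → E d → ℝ) : 0 ≤ nrm A p :=
  Real.sqrt_nonneg _

lemma cellVal_eq (hreg : interior (closure Ω) = Ω) (v : T.X) {s : Finset (E d)}
    (hs : s ∈ T.cells) (x y : E d) : cellVal (v : H1 Ω) s x = cellVal (v : H1 Ω) s y
      + inner ℝ (cellGrad (v : H1 Ω) s) (x - y) := by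
  obtain ⟨_, _, hv⟩ := exists_rep hreg v
  exact (hv s hs).2.1 x y

lemma cellVal_eq_of_mem (hreg : interior (closure Ω) = Ω) (v : T.X) {s t : Finset (E d)}
    (hs : s ∈ T.cells) (ht : t ∈ T.cells) {x : E d} (hxs : x ∈ hull s) (hxt : x ∈ hull t) :
    cellVal (v : H1 Ω) s x = cellVal (v : H1 Ω) t x := by
  obtain ⟨_, _, hv⟩ := exists_rep hreg v
  rw [(hv s hs).1 x hxs, (hv t ht).1 x hxt]

lemma continuous_cellVal (hreg : interior (closure Ω) = Ω) (v : T.X) {s : Finset (E d)}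
    (hs : s ∈ T.cells) : Continuous (cellVal (v : H1 Ω) s) := by
  have : cellVal (v : H1 Ω) s = fun x => cellVal (v : H1 Ω) s 0
      + inner ℝ (cellGrad (v : H1 Ω) s) (x - 0) := funext fun x => cellVal_eq hreg v hs x 0
  rw [this]; fun_prop

lemma abs_cellVal_sub_le (hreg : interior (closure Ω) = Ω) (v : T.X) {s : Finset (E d)}
    (hs : s ∈ T.cells) {x y : E d} (hx : x ∈ hull s) (hy : y ∈ hull s) :
    |cellVal (v : H1 Ω) s x - cellVal (v : H1 Ω) s y| ≤ T.h * ‖cellGrad (v : H1 Ω) s‖ := by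
  rw [cellVal_eq hreg v hs x y, add_sub_cancel_left, mul_comm]
  refine (abs_real_inner_le_norm _ _).trans (mul_le_mul_of_nonneg_left ?_ (norm_nonneg _))
  rw [← dist_eq_norm]; exact dist_le_h hs hx hy

/-! ### Facets -/

lemma surf_hull_ge (hd : 1 ≤ d) {s F : Finset (E d)} (hs : s ∈ T.cells) (hFs : F ⊆ s)
    (hF : F.card = d) {r : ℝ} (hr : 0 < r) {x : E d} (hb : Metric.ball x r ⊆ hull s) :
    diskConst d * r ^ (d - 1) ≤ (surf d).real (hull F) := by
  obtain ⟨q, -, hq⟩ := exists_disk hd hs hFs hF hr hb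
  have h1 := surf_disk (finrank_facet hd hs hFs hF) q hr
  have hsub : (fun τ : vectorSpan ℝ (F : Set (E d)) => q + (τ : E d)) '' Metric.ball 0 r
      ⊆ hull F := by
    rintro _ ⟨τ, hτ, rfl⟩
    exact hq τ τ.2 (by simpa using hτ)
  have h2 := measure_mono (μ := surf d) hsub
  rw [h1] at h2
  exact (ENNReal.ofReal_le_iff_le_toReal (surf_hull_lt_top hF.le).ne).1 h2

/-- The tangential part of the gradient is continuous, so the jump of the gradient across an
interior facet is the jump of the normal derivative. -/
lemma norm_cellGrad_sub_sq (hreg : interior (closure Ω) = Ω) (hd : 1 ≤ d) {r : ℝ} (hr : 0 < r)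
    (hb : ∀ s ∈ T.cells, ∃ x, Metric.ball x r ⊆ hull s) (v : T.X) {s t : Finset (E d)}
    (hs : s ∈ T.cells) (ht : t ∈ T.cells) (hst : (s ∩ t).card = d) :
    ‖cellGrad (v : H1 Ω) s - cellGrad (v : H1 Ω) t‖ ^ 2
      = T.normalFlux (v : H1 Ω) (s ∩ t) ^ 2 := by
  have hne : s ≠ t := by
    rintro rfl
    rw [Finset.inter_self, (T.mem_cells.1 hs).2] at hst
    omega
  set F := s ∩ t with hFdef
  have hFs : F ⊆ s := Finset.inter_subset_left
  have hFt : F ⊆ t := Finset.inter_subset_right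
  set a := cellGrad (v : H1 Ω) s - cellGrad (v : H1 Ω) t with ha
  set n := outwardNormal s F with hn
  obtain ⟨x, hx⟩ := hb s hs
  have hflux : T.normalFlux (v : H1 Ω) F = inner ℝ a n := by
    rw [normalFlux, adj_eq_pair hd hr hb hs ht hne hFs hFt hst, Finset.sum_pair hne,
      outwardNormal_eq_neg hd hs ht hne hFs hFt hst hr hx, inner_neg_right, ha, inner_sub_left]
    ring
  have horth : ∀ b ∈ vectorSpan ℝ (F : Set (E d)), inner ℝ a b = 0 := by
    intro b hb
    rw [vectorSpan] at hb
    induction hb using Submodule.span_induction with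
    | mem b hb =>
      obtain ⟨y, hy, z, hz, rfl⟩ := hb
      have hy' : y ∈ F := hy
      have hz' : z ∈ F := hz
      have e1 := cellVal_eq_of_mem hreg v hs ht (x := y)
        (subset_convexHull ℝ _ (hFs hy')) (subset_convexHull ℝ _ (hFt hy'))
      have e2 := cellVal_eq_of_mem hreg v hs ht (x := z)
        (subset_convexHull ℝ _ (hFs hz')) (subset_convexHull ℝ _ (hFt hz'))
      have e3 := cellVal_eq hreg v hs y z
      have e4 := cellVal_eq hreg v ht y z
      simp only [vsub_eq_sub]
      rw [ha, inner_sub_left]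
      linarith
    | zero => exact inner_zero_right a
    | add b c _ _ h1 h2 => rw [inner_add_right, h1, h2, add_zero]
    | smul k b _ h1 => rw [real_inner_smul_right, h1, mul_zero]
  have h1 := horth _ (sub_inner_normal_mem hd hs hFs hst a)
  rw [← hn, inner_sub_right, real_inner_smul_right, real_inner_self_eq_norm_sq] at h1
  rw [hflux]
  linarith

/-- The sum of the squares of the jumps of the gradient over all pairs of neighbours is controlled
by the jumps of the normal derivative. -/
lemma sum_pairs_cellGrad_le (hreg : interior (closure Ω) = Ω) (hd : 1 ≤ d) {r : ℝ} (hr : 0 < r)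
    (hb : ∀ s ∈ T.cells, ∃ x, Metric.ball x r ⊆ hull s) (v : T.X) :
    diskConst d * r ^ (d - 1) *
        ∑ p ∈ T.pairs, ‖cellGrad (v : H1 Ω) p.1 - cellGrad (v : H1 Ω) p.2‖ ^ 2
      ≤ 4 * ip T.intFacets (bjump (disc v)) (bjump (disc v)) := by
  have hpair : ∀ p ∈ T.pairs, p.1 ∩ p.2 ∈ T.intFacets ∧ p ∈ T.adj (p.1 ∩ p.2) ×ˢ T.adj (p.1 ∩ p.2)
      ∧ (T.adj (p.1 ∩ p.2)).card = 2 := by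
    intro p hp
    obtain ⟨⟨hs, ht⟩, hF⟩ := mem_pairs.1 hp
    have hne : p.1 ≠ p.2 := by
      intro h
      rw [← h, Finset.inter_self, (T.mem_cells.1 hs).2] at hF
      omega
    have hadj := adj_eq_pair hd hr hb hs ht hne Finset.inter_subset_left
      Finset.inter_subset_right hF
    have hcard : (T.adj (p.1 ∩ p.2)).card = 2 := by rw [hadj, Finset.card_pair hne]
    refine ⟨?_, ?_, hcard⟩
    · rw [intFacets, Finset.mem_filter, Set.Finite.mem_toFinset]
      exact ⟨T.down_closed (T.mem_cells.1 hs).1 Finset.inter_subset_left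
        (Finset.card_pos.1 (by omega)), hF, hcard⟩
    · rw [Finset.mem_product, mem_adj, mem_adj]
      exact ⟨⟨hs, Finset.inter_subset_left⟩, ⟨ht, Finset.inter_subset_right⟩⟩
  have hsum : ∑ p ∈ T.pairs, ‖cellGrad (v : H1 Ω) p.1 - cellGrad (v : H1 Ω) p.2‖ ^ 2
      ≤ ∑ F ∈ T.intFacets, 4 * T.normalFlux (v : H1 Ω) F ^ 2 := by
    rw [← Finset.sum_fiberwise_of_maps_to (fun p hp => (hpair p hp).1)]
    refine Finset.sum_le_sum fun F hF => ?_
    have hcard : ((T.pairs.filter fun p => p.1 ∩ p.2 = F).card : ℝ) ≤ 4 := by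
      have h2 : (T.adj F).card = 2 := ((Finset.mem_filter.1 hF).2).2
      have : (T.pairs.filter fun p => p.1 ∩ p.2 = F) ⊆ T.adj F ×ˢ T.adj F := by
        intro p hp
        obtain ⟨hp', rfl⟩ := Finset.mem_filter.1 hp
        exact (hpair p hp').2.1
      have := Finset.card_le_card this
      rw [Finset.card_product, h2] at this
      exact_mod_cast this
    have e : ∑ p ∈ T.pairs.filter (fun p => p.1 ∩ p.2 = F),
        ‖cellGrad (v : H1 Ω) p.1 - cellGrad (v : H1 Ω) p.2‖ ^ 2
        = ∑ p ∈ T.pairs.filter (fun p => p.1 ∩ p.2 = F), T.normalFlux (v : H1 Ω) F ^ 2 := by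
      refine Finset.sum_congr rfl fun p hp => ?_
      obtain ⟨hp', rfl⟩ := Finset.mem_filter.1 hp
      obtain ⟨⟨hs, ht⟩, hF⟩ := mem_pairs.1 hp'
      exact norm_cellGrad_sub_sq hreg hd hr hb v hs ht hF
    rw [e, Finset.sum_const, nsmul_eq_mul]
    exact mul_le_mul_of_nonneg_right hcard (sq_nonneg _)
  have hk : 0 ≤ diskConst d * r ^ (d - 1) := mul_nonneg diskConst_pos.le (pow_nonneg hr.le _)
  refine (mul_le_mul_of_nonneg_left hsum hk).trans ?_
  rw [ip, Finset.mul_sum, Finset.mul_sum]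
  refine Finset.sum_le_sum fun F hF => ?_
  obtain ⟨-, hc, h2⟩ := Finset.mem_filter.1 hF
  obtain ⟨s, hs⟩ := Finset.card_pos.1 (by omega : 0 < (T.adj F).card)
  obtain ⟨hs, hFs⟩ := mem_adj.1 hs
  obtain ⟨x, hx⟩ := hb s hs
  have hge := surf_hull_ge hd hs hFs hc hr hx
  rw [bjump_disc]
  simp only
  rw [integral_const, smul_eq_mul, measureReal_restrict_apply_univ]
  nlinarith [mul_le_mul_of_nonneg_right hge (sq_nonneg (T.normalFlux (v : H1 Ω) F))]

/-- The values at the centroids of neighbouring cells differ by at most `h` times the sum of the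
norms of the gradients. -/
lemma jumpSq_cellVal_le (hreg : interior (closure Ω) = Ω) (hd : 1 ≤ d) {ρ : ℝ} (hρ : 0 < ρ)
    (hh : 0 < T.h) (hb : ∀ s ∈ T.cells, ∃ x, Metric.ball x (ρ * T.h) ⊆ hull s) (v : T.X) :
    T.jumpSq (fun s => cellVal (v : H1 Ω) s (s.centroid ℝ id))
      ≤ 4 * (2 / ρ) ^ d * T.h ^ 2 * ∑ s ∈ T.cells, ‖cellGrad (v : H1 Ω) s‖ ^ 2 := by
  set a : Finset (E d) → ℝ := fun s => ‖cellGrad (v : H1 Ω) s‖ ^ 2 with ha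
  have hpair : ∀ p ∈ T.pairs, (cellVal (v : H1 Ω) p.1 (p.1.centroid ℝ id)
      - cellVal (v : H1 Ω) p.2 (p.2.centroid ℝ id)) ^ 2 ≤ 2 * T.h ^ 2 * (a p.1 + a p.2) := by
    intro p hp
    obtain ⟨⟨hs, ht⟩, hF⟩ := mem_pairs.1 hp
    obtain ⟨x, hx⟩ := Finset.card_pos.1 (by omega : 0 < (p.1 ∩ p.2).card)
    obtain ⟨hx1, hx2⟩ := Finset.mem_inter.1 hx
    have hx1' : x ∈ hull p.1 := subset_convexHull ℝ _ hx1
    have hx2' : x ∈ hull p.2 := subset_convexHull ℝ _ hx2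
    have e0 := cellVal_eq_of_mem hreg v hs ht hx1' hx2'
    have e1 := abs_le.1 (abs_cellVal_sub_le hreg v hs (centroid_mem_hull ⟨x, hx1⟩) hx1')
    have e2 := abs_le.1 (abs_cellVal_sub_le hreg v ht (centroid_mem_hull ⟨x, hx2⟩) hx2')
    have h3 := sq_le_sq' (a := cellVal (v : H1 Ω) p.1 (p.1.centroid ℝ id)
      - cellVal (v : H1 Ω) p.2 (p.2.centroid ℝ id))
      (b := T.h * ‖cellGrad (v : H1 Ω) p.1‖ + T.h * ‖cellGrad (v : H1 Ω) p.2‖)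
      (by linarith [e1.1, e2.2]) (by linarith [e1.2, e2.1])
    refine h3.trans ?_
    simp only [ha]
    nlinarith [sq_nonneg (T.h * (‖cellGrad (v : H1 Ω) p.1‖ - ‖cellGrad (v : H1 Ω) p.2‖))]
  have hcard := fun s hs => card_neighbours_le (T := T) hρ hh hb hd (s := s) hs
  have h1 : ∑ p ∈ T.pairs, a p.1 ≤ (2 / ρ) ^ d * ∑ s ∈ T.cells, a s := by
    rw [pairs, Finset.sum_filter, Finset.sum_product, Finset.mul_sum]
    refine Finset.sum_le_sum fun s hs => ?_
    rw [← Finset.sum_filter]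
    simp only
    rw [Finset.sum_const, nsmul_eq_mul]
    exact mul_le_mul_of_nonneg_right (hcard s hs) (sq_nonneg _)
  have h2 : ∑ p ∈ T.pairs, a p.2 ≤ (2 / ρ) ^ d * ∑ s ∈ T.cells, a s := by
    rw [pairs, Finset.sum_filter, Finset.sum_product_right, Finset.mul_sum]
    refine Finset.sum_le_sum fun s hs => ?_
    simp only [Finset.inter_comm _ s]
    rw [← Finset.sum_filter, Finset.sum_const, nsmul_eq_mul]
    exact mul_le_mul_of_nonneg_right (hcard s hs) (sq_nonneg _)
  refine (Finset.sum_le_sum hpair).trans ?_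
  rw [← Finset.mul_sum, Finset.sum_add_distrib]
  nlinarith [sq_nonneg T.h]

/-- An affine function on a facet `F` is controlled by its square integral: there is a point of
`F` at which the value, and moreover the tangential gradient, are bounded by it. On a disk that is
moved from that point in the direction of growth, the function is large. -/
lemma exists_le_integral_cellVal_sq (hreg : interior (closure Ω) = Ω) (hd : 1 ≤ d) (v : T.X)
    {s F : Finset (E d)} (hs : s ∈ T.cells) (hFs : F ⊆ s) (hF : F.card = d) {r : ℝ} (hr : 0 < r)
    {x : E d} (hb : Metric.ball x r ⊆ hull s) :
    ∃ q ∈ hull F, diskConst d * (r / 4) ^ (d - 1) *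
      (cellVal (v : H1 Ω) s q ^ 2 + r ^ 2 / 16 * ‖cellGrad (v : H1 Ω) s
        - inner ℝ (cellGrad (v : H1 Ω) s) (outwardNormal s F) • outwardNormal s F‖ ^ 2)
      ≤ ∫ y in hull F, cellVal (v : H1 Ω) s y ^ 2 ∂(surf d) := by
  obtain ⟨q, hqF, hq⟩ := exists_disk hd hs hFs hF hr hb
  refine ⟨q, hqF, ?_⟩
  set g := cellGrad (v : H1 Ω) s
  set n := outwardNormal s F with hn
  set b := g - inner ℝ g n • n with hbdef
  have hbV : b ∈ vectorSpan ℝ (F : Set (E d)) := sub_inner_normal_mem hd hs hFs hF g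
  have hgb : ∀ τ ∈ vectorSpan ℝ (F : Set (E d)), inner ℝ g τ = inner ℝ b τ := by
    intro τ hτ
    have h0 : inner ℝ n τ = 0 := by
      rw [real_inner_comm]
      exact (Submodule.mem_orthogonal _ _).1 outwardNormal_mem τ hτ
    rw [hbdef, inner_sub_left, real_inner_smul_left, h0, mul_zero, sub_zero]
  -- the direction of growth of the modulus
  obtain ⟨ε, hε, hεA⟩ : ∃ ε : ℝ, |ε| = 1 ∧ ε * cellVal (v : H1 Ω) s q
      = |cellVal (v : H1 Ω) s q| := by
    rcases le_total 0 (cellVal (v : H1 Ω) s q) with h | h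
    · exact ⟨1, by simp, by rw [abs_of_nonneg h, one_mul]⟩
    · exact ⟨-1, by simp, by rw [abs_of_nonpos h]; ring⟩
  have hεε : ε * ε = 1 := by rw [← abs_mul_abs_self, hε, one_mul]
  set m : E d := (ε * (r / 2) * ‖b‖⁻¹) • b with hm
  have hmV : m ∈ vectorSpan ℝ (F : Set (E d)) := Submodule.smul_mem _ _ hbV
  have hbb : ‖b‖⁻¹ * ‖b‖ ≤ 1 := by
    rcases eq_or_ne ‖b‖ 0 with h | h
    · rw [h]; simp
    · rw [inv_mul_cancel₀ h]
  have hmn : ‖m‖ ≤ r / 2 := by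
    rw [hm, norm_smul, norm_mul, norm_mul, Real.norm_eq_abs ε, hε, one_mul, norm_inv, norm_norm,
      Real.norm_of_nonneg (by positivity : 0 ≤ r / 2), mul_assoc]
    exact mul_le_of_le_one_right (by positivity) hbb
  have hbm : ε * inner ℝ b m = r / 2 * ‖b‖ := by
    rw [hm, real_inner_smul_right, real_inner_self_eq_norm_sq]
    rcases eq_or_ne ‖b‖ 0 with h | h
    · rw [h]; simp
    · field_simp
      linear_combination hεε
  -- on the disk `D` around `q + m` the modulus has grown by at least `(r / 4) ‖b‖`
  set D : Set (E d) := (fun τ : vectorSpan ℝ (F : Set (E d)) => (q + m) + (τ : E d)) ''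
    Metric.ball 0 (r / 4) with hD
  have hsurf := surf_disk (finrank_facet hd hs hFs hF) (q + m) (by positivity : 0 < r / 4)
  have hDF : D ⊆ hull F := by
    rintro _ ⟨τ, hτ, rfl⟩
    have hτ' : ‖(τ : E d)‖ < r / 4 := by simpa using hτ
    change q + m + (τ : E d) ∈ hull F
    rw [add_assoc]
    refine hq _ (Submodule.add_mem _ hmV τ.2) ((norm_add_le _ _).trans_lt ?_)
    linarith
  have hlow : ∀ y ∈ D, cellVal (v : H1 Ω) s q ^ 2 + r ^ 2 / 16 * ‖b‖ ^ 2
      ≤ cellVal (v : H1 Ω) s y ^ 2 := by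
    rintro _ ⟨τ, hτ, rfl⟩
    have hτ' : ‖(τ : E d)‖ < r / 4 := by simpa using hτ
    have e := cellVal_eq hreg v hs (q + m + (τ : E d)) q
    have e2 : q + m + (τ : E d) - q = m + τ := by abel
    rw [e2, hgb _ (Submodule.add_mem _ hmV τ.2), inner_add_right] at e
    have e3 : |ε * inner ℝ b (τ : E d)| ≤ ‖b‖ * (r / 4) := by
      rw [abs_mul, hε, one_mul]
      exact (abs_real_inner_le_norm _ _).trans
        (mul_le_mul_of_nonneg_left hτ'.le (norm_nonneg _))
    have e4 : |cellVal (v : H1 Ω) s q| + r / 4 * ‖b‖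
        ≤ ε * cellVal (v : H1 Ω) s (q + m + (τ : E d)) := by
      rw [e, mul_add, mul_add, hεA, hbm]
      linarith [(abs_le.1 e3).1]
    have e5 : (ε * cellVal (v : H1 Ω) s (q + m + (τ : E d))) ^ 2
        = cellVal (v : H1 Ω) s (q + m + (τ : E d)) ^ 2 := by
      rw [mul_pow, pow_two ε, hεε, one_mul]
    change _ ≤ cellVal (v : H1 Ω) s (q + m + (τ : E d)) ^ 2
    rw [← e5]
    have h0 : 0 ≤ |cellVal (v : H1 Ω) s q| := abs_nonneg _
    have h1 : 0 ≤ r / 4 * ‖b‖ := by positivity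
    have := pow_le_pow_left₀ (add_nonneg h0 h1) e4 2
    rw [← sq_abs (cellVal (v : H1 Ω) s q)]
    nlinarith [mul_nonneg h0 h1]
  have hint : IntegrableOn (fun y => cellVal (v : H1 Ω) s y ^ 2) (hull F) (surf d) :=
    integrableOn_hull_surf ((continuous_cellVal hreg v hs).pow 2) hF.le
  have hDm : MeasurableSet D := by
    refine (Metric.isOpen_ball.measurableSet).image_of_continuousOn_injOn (by fun_prop) ?_
    intro τ _ τ' _ h
    exact Subtype.ext (add_left_cancel h)
  have hreal : (surf d).real D = diskConst d * (r / 4) ^ (d - 1) := by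
    rw [Measure.real, hsurf, ENNReal.toReal_ofReal]
    exact mul_nonneg diskConst_pos.le (by positivity)
  have hfin : surf d D ≠ ⊤ := ((measure_mono hDF).trans_lt (surf_hull_lt_top hF.le)).ne
  calc _ = ∫ _ in D, (cellVal (v : H1 Ω) s q ^ 2 + r ^ 2 / 16 * ‖b‖ ^ 2) ∂(surf d) := by
        rw [setIntegral_const, smul_eq_mul, hreal]
    _ ≤ ∫ y in D, cellVal (v : H1 Ω) s y ^ 2 ∂(surf d) :=
        setIntegral_mono_on (integrableOn_const hfin) (hint.mono_set hDF) hDm hlow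
    _ ≤ _ := setIntegral_mono_set hint (Eventually.of_forall fun y => sq_nonneg _)
        hDF.eventuallyLE

end Mesh
end CauchyFEM
end

noncomputable section
namespace CauchyFEM
variable {d : ℕ}

/-! ### The discrete Poincaré inequality on the finite element space -/

section DiscretePoincare

open Classical Mesh

variable {G : Domain d}

section OneMesh

variable {T : Mesh G.Ω}

lemma faceVal_of_adj (v : H1 G.Ω) {s F : Finset (E d)} (h : T.adj F = {s}) (x : E d) :
    T.faceVal v F x = cellVal v s x := by
  simp [faceVal, h]

lemma normalFlux_of_adj (v : H1 G.Ω) {s F : Finset (E d)} (h : T.adj F = {s}) :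
    T.normalFlux v F = inner ℝ (cellGrad v s) (outwardNormal s F) := by
  simp [normalFlux, h]

/-- On a facet with both Cauchy data, the value and the normal derivative of a discrete function
control its gradient and its value at the centroid on the adjacent cell. -/
lemma cell_le_facet_integrals (hd : 1 ≤ d) {ρ : ℝ} (hρ : 0 < ρ) (hT : 0 < T.h)
    (hb : ∀ s ∈ T.cells, ∃ x, Metric.ball x (ρ * T.h) ⊆ hull s) (v : T.X) {F s : Finset (E d)}
    (hF : F.card = d) (hadj : T.adj F = {s}) :
    diskConst d * (ρ / 4) ^ (d - 1) * (T.h ^ (d - 1) * ‖cellGrad (v : H1 G.Ω) s‖ ^ 2)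
        ≤ (∫ x in hull F, bdn (disc v) F x * bdn (disc v) F x ∂(surf d))
          + 16 / ρ ^ 2 * (T.h⁻¹ ^ 2 *
            ∫ x in hull F, bval (disc v) F x * bval (disc v) F x ∂(surf d)) ∧
    diskConst d * (ρ / 4) ^ (d - 1) * (T.h ^ (d - 1) *
        cellVal (v : H1 G.Ω) s (s.centroid ℝ id) ^ 2)
        ≤ (2 + 32 / ρ ^ 2) * (∫ x in hull F, bval (disc v) F x * bval (disc v) F x ∂(surf d))
          + 2 * (T.h ^ 2 * ∫ x in hull F, bdn (disc v) F x * bdn (disc v) F x ∂(surf d)) := by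
  obtain ⟨hs, hFs⟩ := mem_adj.1 (hadj ▸ Finset.mem_singleton_self s : s ∈ T.adj F)
  obtain ⟨x, hx⟩ := hb s hs
  have hr : 0 < ρ * T.h := by positivity
  obtain ⟨q, hqF, hq⟩ := exists_le_integral_cellVal_sq G.regular hd v hs hFs hF hr hx
  have hsurf := surf_hull_ge hd hs hFs hF hr hx
  have hn := norm_outwardNormal hd hs hFs hF
  have hS : ∫ x in hull F, bval (disc v) F x * bval (disc v) F x ∂(surf d)
      = ∫ y in hull F, cellVal (v : H1 G.Ω) s y ^ 2 ∂(surf d) := by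
    refine integral_congr_ae (Eventually.of_forall fun y => ?_)
    simp only [bval_disc, faceVal_of_adj _ hadj, pow_two]
  have hR : ∫ x in hull F, bdn (disc v) F x * bdn (disc v) F x ∂(surf d)
      = (surf d).real (hull F) *
        inner ℝ (cellGrad (v : H1 G.Ω) s) (outwardNormal s F) ^ 2 := by
    rw [bdn_disc]
    simp only
    rw [normalFlux_of_adj _ hadj, integral_const, smul_eq_mul, measureReal_restrict_apply_univ]
    ring
  have hval := abs_le.1 (abs_cellVal_sub_le G.regular v hs
    (centroid_mem_hull (Finset.card_pos.1 (by rw [(T.mem_cells.1 hs).2]; omega)))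
    (convexHull_mono (Finset.coe_subset.2 hFs) hqF))
  rw [hS, hR]
  set g := cellGrad (v : H1 G.Ω) s
  set n := outwardNormal s F
  have hpyth : ‖g‖ ^ 2 = inner ℝ g n ^ 2 + ‖g - inner ℝ g n • n‖ ^ 2 := by
    rw [norm_sub_sq_real, real_inner_smul_right, norm_smul, mul_pow, hn, Real.norm_eq_abs, sq_abs]
    ring
  have hdc := diskConst_pos (d := d)
  have hk : 0 < diskConst d * (ρ / 4) ^ (d - 1) := by positivity
  have hβ : 0 ≤ ‖g - inner ℝ g n • n‖ ^ 2 := sq_nonneg _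
  generalize ‖g - inner ℝ g n • n‖ ^ 2 = β at *
  generalize inner ℝ g n = φ at *
  generalize (∫ y in hull F, cellVal (v : H1 G.Ω) s y ^ 2 ∂(surf d)) = S at *
  generalize cellVal (v : H1 G.Ω) s q = A at *
  generalize cellVal (v : H1 G.Ω) s (s.centroid ℝ id) = m at *
  have hsplit : (ρ * T.h / 4) ^ (d - 1) = (ρ / 4) ^ (d - 1) * T.h ^ (d - 1) := by
    rw [← mul_pow]; ring
  rw [hsplit] at hq
  have hmono : diskConst d * (ρ / 4) ^ (d - 1) * T.h ^ (d - 1) ≤ (surf d).real (hull F) := by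
    refine le_trans ?_ hsurf
    rw [mul_assoc, ← mul_pow]
    refine mul_le_mul_of_nonneg_left (pow_le_pow_left₀ (by positivity) ?_ _) hdc.le
    nlinarith
  have hflux : diskConst d * (ρ / 4) ^ (d - 1) * T.h ^ (d - 1) * φ ^ 2
      ≤ (surf d).real (hull F) * φ ^ 2 := mul_le_mul_of_nonneg_right hmono (sq_nonneg _)
  have hkh : 0 < diskConst d * (ρ / 4) ^ (d - 1) * T.h ^ (d - 1) := by positivity
  have e0 : ∀ z, diskConst d * (ρ / 4) ^ (d - 1) * (T.h ^ (d - 1) * z)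
      = diskConst d * (ρ / 4) ^ (d - 1) * T.h ^ (d - 1) * z := fun z => by ring
  rw [← mul_assoc] at hq
  rw [e0, e0]
  generalize diskConst d * (ρ / 4) ^ (d - 1) * T.h ^ (d - 1) = κ at *
  generalize (surf d).real (hull F) * φ ^ 2 = R at *
  have hA : κ * A ^ 2 ≤ S := by
    refine le_trans (mul_le_mul_of_nonneg_left ?_ hkh.le) hq
    exact le_add_of_nonneg_right (by positivity)
  have hB : κ * β ≤ 16 / ρ ^ 2 * (T.h⁻¹ ^ 2 * S) := by
    have h1 : κ * ((ρ * T.h) ^ 2 / 16 * β) ≤ S := by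
      refine le_trans (mul_le_mul_of_nonneg_left ?_ hkh.le) hq
      exact le_add_of_nonneg_left (sq_nonneg _)
    have h2 := mul_le_mul_of_nonneg_left h1 (by positivity : 0 ≤ 16 / ρ ^ 2 * T.h⁻¹ ^ 2)
    have e : 16 / ρ ^ 2 * T.h⁻¹ ^ 2 * (κ * ((ρ * T.h) ^ 2 / 16 * β)) = κ * β := by
      have : T.h ≠ 0 := hT.ne'
      field_simp
    rw [e] at h2
    linarith
  have hG : κ * ‖g‖ ^ 2 ≤ R + 16 / ρ ^ 2 * (T.h⁻¹ ^ 2 * S) := by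
    rw [hpyth, mul_add]; exact add_le_add hflux hB
  refine ⟨hG, ?_⟩
  have hm : m ^ 2 ≤ 2 * A ^ 2 + 2 * (T.h ^ 2 * ‖g‖ ^ 2) := by
    have := sq_le_sq' hval.1 hval.2
    nlinarith [sq_nonneg (m - 2 * A)]
  have h3 := mul_le_mul_of_nonneg_left hm hkh.le
  have h4 := mul_le_mul_of_nonneg_left hG (sq_nonneg T.h)
  have e : T.h ^ 2 * (R + 16 / ρ ^ 2 * (T.h⁻¹ ^ 2 * S)) = T.h ^ 2 * R + 16 / ρ ^ 2 * S := by
    have : T.h ≠ 0 := hT.ne'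
    field_simp
  rw [e] at h4
  have e2 : (2 + 32 / ρ ^ 2) * S = 2 * S + 2 * (16 / ρ ^ 2 * S) := by ring
  rw [e2]
  linarith

lemma sum_adj_cauchyFacets {q : Finset (E d) → ℝ} {F : Finset (E d)} {B : ℝ}
    (hF : F ∈ cauchyFacets G T) (h : ∀ s, T.adj F = {s} → q s ≤ B) :
    ∑ s ∈ T.adj F, q s ≤ B := by
  obtain ⟨s, hs⟩ := Finset.card_eq_one.1 (on_prop (Finset.mem_inter.1 hF).1).2.2.1
  rw [hs, Finset.sum_singleton]
  exact h s hs

lemma sum_cauchyFacets_le_ip (p : Finset (E d) → E d → ℝ) :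
    ∑ F ∈ cauchyFacets G T, ∫ x in hull F, p F x * p F x ∂(surf d) ≤ ip (T.on G.ΓD) p p ∧
    ∑ F ∈ cauchyFacets G T, ∫ x in hull F, p F x * p F x ∂(surf d) ≤ ip (T.on G.ΓN) p p :=
  ⟨Finset.sum_le_sum_of_subset_of_nonneg Finset.inter_subset_left
    fun _ _ _ => integral_nonneg fun _ => mul_self_nonneg _,
  Finset.sum_le_sum_of_subset_of_nonneg Finset.inter_subset_right
    fun _ _ _ => integral_nonneg fun _ => mul_self_nonneg _⟩

/-- `cell_le_facet_integrals`, summed over the facets with Cauchy data. -/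
lemma cauchy_sum_le (hd : 1 ≤ d) {ρ : ℝ} (hρ : 0 < ρ) (hT : 0 < T.h)
    (hb : ∀ s ∈ T.cells, ∃ x, Metric.ball x (ρ * T.h) ⊆ hull s) (v : T.X) :
    diskConst d * (ρ / 4) ^ (d - 1) * (T.h ^ (d - 1) *
        ∑ F ∈ cauchyFacets G T, ∑ s ∈ T.adj F, ‖cellGrad (v : H1 G.Ω) s‖ ^ 2)
        ≤ ip (T.on G.ΓN) (bdn (disc v)) (bdn (disc v))
          + 16 / ρ ^ 2 * (T.h⁻¹ ^ 2 * ip (T.on G.ΓD) (bval (disc v)) (bval (disc v))) ∧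
    diskConst d * (ρ / 4) ^ (d - 1) * (T.h ^ (d - 1) *
        cauchySq G T (fun s => cellVal (v : H1 G.Ω) s (s.centroid ℝ id)))
        ≤ (2 + 32 / ρ ^ 2) * ip (T.on G.ΓD) (bval (disc v)) (bval (disc v))
          + 2 * (T.h ^ 2 * ip (T.on G.ΓN) (bdn (disc v)) (bdn (disc v))) := by
  have hS := (sum_cauchyFacets_le_ip (G := G) (T := T) (bval (disc v))).1
  have hR := (sum_cauchyFacets_le_ip (G := G) (T := T) (bdn (disc v))).2
  have hcard : ∀ F ∈ cauchyFacets G T, F.card = d := fun F hF =>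
    (on_prop (Finset.mem_inter.1 hF).1).2.1
  constructor
  · calc _ = ∑ F ∈ cauchyFacets G T, ∑ s ∈ T.adj F, diskConst d * (ρ / 4) ^ (d - 1) *
          (T.h ^ (d - 1) * ‖cellGrad (v : H1 G.Ω) s‖ ^ 2) := by
          simp only [Finset.mul_sum]
      _ ≤ ∑ F ∈ cauchyFacets G T,
          ((∫ x in hull F, bdn (disc v) F x * bdn (disc v) F x ∂(surf d))
          + 16 / ρ ^ 2 * (T.h⁻¹ ^ 2 *
            ∫ x in hull F, bval (disc v) F x * bval (disc v) F x ∂(surf d))) :=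
        Finset.sum_le_sum fun F hF => sum_adj_cauchyFacets hF fun s hs =>
          (cell_le_facet_integrals hd hρ hT hb v (hcard F hF) hs).1
      _ ≤ _ := by
        rw [Finset.sum_add_distrib, ← Finset.mul_sum, ← Finset.mul_sum]
        gcongr
  · calc _ = ∑ F ∈ cauchyFacets G T, ∑ s ∈ T.adj F, diskConst d * (ρ / 4) ^ (d - 1) *
          (T.h ^ (d - 1) * cellVal (v : H1 G.Ω) s (s.centroid ℝ id) ^ 2) := by
          simp only [Finset.mul_sum, cauchySq]
      _ ≤ ∑ F ∈ cauchyFacets G T, ((2 + 32 / ρ ^ 2) *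
            (∫ x in hull F, bval (disc v) F x * bval (disc v) F x ∂(surf d))
          + 2 * (T.h ^ 2 * ∫ x in hull F, bdn (disc v) F x * bdn (disc v) F x ∂(surf d))) :=
        Finset.sum_le_sum fun F hF => sum_adj_cauchyFacets hF fun s hs =>
          (cell_le_facet_integrals hd hρ hT hb v (hcard F hF) hs).2
      _ ≤ _ := by
        rw [Finset.sum_add_distrib, ← Finset.mul_sum, ← Finset.mul_sum, ← Finset.mul_sum]
        gcongr

/-- The norm of a discrete function in terms of its gradients and its values at the centroids. -/
lemma norm_sq_le_sum (hd : 1 ≤ d) (hT : 0 < T.h) (v : T.X) :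
    ‖(v : H1 G.Ω)‖ ^ 2 ≤ ballConst d *
      (2 * (T.h ^ d * ∑ s ∈ T.cells, cellVal (v : H1 G.Ω) s (s.centroid ℝ id) ^ 2)
        + (2 * T.h ^ 2 + 1) * (T.h ^ d * ∑ s ∈ T.cells, ‖cellGrad (v : H1 G.Ω) s‖ ^ 2)) := by
  rw [norm_sq_eq, integral_grad_sq_eq_sum G.regular v,
    integral_eq_sum_cells (T := T) G.regular (integrable_fn_sq _), ← Finset.sum_add_distrib]
  simp only [Finset.mul_sum]
  rw [← Finset.sum_add_distrib, Finset.mul_sum]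
  refine Finset.sum_le_sum fun s hs => ?_
  obtain ⟨k, hk, hv⟩ := exists_rep G.regular v
  have hB := volume_real_interior_le hT.le hs
  set m := cellVal (v : H1 G.Ω) s (s.centroid ℝ id)
  set g := cellGrad (v : H1 G.Ω) s
  have hne : s.Nonempty := Finset.card_pos.1 (by rw [(T.mem_cells.1 hs).2]; omega)
  have hpt : ∀ᵐ x ∂volume.restrict (interior (hull s)),
      fn (v : H1 G.Ω) x ^ 2 ≤ 2 * m ^ 2 + 2 * (T.h ^ 2 * ‖g‖ ^ 2) := by
    filter_upwards [ae_restrict_of_ae_restrict_of_subset (interior_hull_subset G.regular hs) hk,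
      ae_restrict_mem isOpen_interior.measurableSet] with x hx hxU
    have hxs : x ∈ hull s := interior_subset hxU
    have e := abs_le.1 (abs_cellVal_sub_le G.regular v hs hxs (centroid_mem_hull hne))
    rw [hx, ← (hv s hs).1 x hxs]
    have := sq_le_sq' e.1 e.2
    nlinarith [sq_nonneg (cellVal (v : H1 G.Ω) s x - 2 * m)]
  have hfin : IsFiniteMeasure (volume.restrict (interior (hull s))) :=
    ⟨by simpa using (volume_interior_hull_ne_top s).lt_top⟩
  have hint : ∫ x in interior (hull s), fn (v : H1 G.Ω) x ^ 2
      ≤ volume.real (interior (hull s)) * (2 * m ^ 2 + 2 * (T.h ^ 2 * ‖g‖ ^ 2)) := by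
    have := integral_mono_ae ((integrable_fn_sq (v : H1 G.Ω)).mono_measure
      (Measure.restrict_mono (interior_hull_subset G.regular hs) le_rfl))
      (integrable_const _) hpt
    rwa [integral_const, smul_eq_mul, measureReal_restrict_apply_univ] at this
  calc _ ≤ volume.real (interior (hull s)) *
        (2 * m ^ 2 + (2 * T.h ^ 2 + 1) * ‖g‖ ^ 2) := by linarith
    _ ≤ ballConst d * T.h ^ d * (2 * m ^ 2 + (2 * T.h ^ 2 + 1) * ‖g‖ ^ 2) :=
        mul_le_mul_of_nonneg_right hB (by positivity)
    _ = _ := by ring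

end OneMesh

variable {ι : Type*} {𝒯 : ι → Mesh G.Ω}

/-- The discrete Poincaré inequality applied to the components of the gradient. -/
lemma exists_cellGrad_bound (hd : 2 ≤ d) {ρ : ℝ} (hρ : 0 < ρ) (hh : ∀ i, 0 < (𝒯 i).h)
    (hb : ∀ i, ∀ s ∈ (𝒯 i).cells, ∃ x, Metric.ball x (ρ * (𝒯 i).h) ⊆ hull s)
    (hfit : ∀ i, (𝒯 i).Fits G.ΓD ∧ (𝒯 i).Fits G.ΓN) :
    ∃ C, 0 ≤ C ∧ ∀ i (v : (𝒯 i).X),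
      (𝒯 i).h ^ d * ∑ s ∈ (𝒯 i).cells, ‖cellGrad (v : H1 G.Ω) s‖ ^ 2 ≤
        C * ((𝒯 i).h⁻¹ * ip (𝒯 i).intFacets (bjump (disc v)) (bjump (disc v))
          + ip ((𝒯 i).on G.ΓN) (bdn (disc v)) (bdn (disc v))
          + (𝒯 i).h⁻¹ ^ 2 * ip ((𝒯 i).on G.ΓD) (bval (disc v)) (bval (disc v))) := by
  obtain ⟨C, hC, hP⟩ := exists_poincare_cells hd hρ hb hfit
  have hdc := diskConst_pos (d := d)
  set k := diskConst d * (ρ / 4) ^ (d - 1) with hk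
  have hk0 : 0 < k := by positivity
  refine ⟨C / k * (4 + 16 / ρ ^ 2), by positivity, fun i v => ?_⟩
  have hT := hh i
  have hcs := (cauchy_sum_le (by omega) hρ hT (hb i) v).1
  have hpr := sum_pairs_cellGrad_le G.regular (by omega) (by positivity : 0 < ρ * (𝒯 i).h) (hb i) v
  have hsum : (𝒯 i).h ^ d * ∑ s ∈ (𝒯 i).cells, ‖cellGrad (v : H1 G.Ω) s‖ ^ 2
      ≤ C * ((𝒯 i).h ^ (d - 2) * ∑ p ∈ (𝒯 i).pairs,
          ‖cellGrad (v : H1 G.Ω) p.1 - cellGrad (v : H1 G.Ω) p.2‖ ^ 2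
        + (𝒯 i).h ^ (d - 1) * ∑ F ∈ cauchyFacets G (𝒯 i), ∑ s ∈ (𝒯 i).adj F,
          ‖cellGrad (v : H1 G.Ω) s‖ ^ 2) := by
    have := Finset.sum_le_sum fun j (_ : j ∈ (Finset.univ : Finset (Fin d))) =>
      hP i fun s => (cellGrad (v : H1 G.Ω) s) j
    simp only [energy, jumpSq, cauchySq] at this
    rw [← Finset.mul_sum, ← Finset.mul_sum, Finset.sum_add_distrib, ← Finset.mul_sum,
      ← Finset.mul_sum, Finset.sum_comm, Finset.sum_comm (t := (𝒯 i).pairs),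
      Finset.sum_comm (t := cauchyFacets G (𝒯 i))] at this
    have e : ∀ F, ∑ j : Fin d, ∑ s ∈ (𝒯 i).adj F, (cellGrad (v : H1 G.Ω) s) j ^ 2
        = ∑ s ∈ (𝒯 i).adj F, ‖cellGrad (v : H1 G.Ω) s‖ ^ 2 := fun F => by
      rw [Finset.sum_comm]
      exact Finset.sum_congr rfl fun s _ => (norm_sq_eq_sum _).symm
    simp only [e] at this
    simpa only [norm_sq_eq_sum (_ : E d), PiLp.sub_apply] using this
  have hP0 : 0 ≤ ∑ p ∈ (𝒯 i).pairs,
      ‖cellGrad (v : H1 G.Ω) p.1 - cellGrad (v : H1 G.Ω) p.2‖ ^ 2 :=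
    Finset.sum_nonneg fun _ _ => sq_nonneg _
  generalize (∑ p ∈ (𝒯 i).pairs,
    ‖cellGrad (v : H1 G.Ω) p.1 - cellGrad (v : H1 G.Ω) p.2‖ ^ 2) = P at *
  generalize (∑ F ∈ cauchyFacets G (𝒯 i), ∑ s ∈ (𝒯 i).adj F,
    ‖cellGrad (v : H1 G.Ω) s‖ ^ 2) = Q at *
  generalize (∑ s ∈ (𝒯 i).cells, ‖cellGrad (v : H1 G.Ω) s‖ ^ 2) = Γ at *
  have ha := ip_self_nonneg (𝒯 i).intFacets (bjump (disc v))
  have he := ip_self_nonneg ((𝒯 i).on G.ΓN) (bdn (disc v))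
  have hb0 := ip_self_nonneg ((𝒯 i).on G.ΓD) (bval (disc v))
  generalize ip (𝒯 i).intFacets (bjump (disc v)) (bjump (disc v)) = a at *
  generalize ip ((𝒯 i).on G.ΓN) (bdn (disc v)) (bdn (disc v)) = e at *
  generalize ip ((𝒯 i).on G.ΓD) (bval (disc v)) (bval (disc v)) = b at *
  generalize (𝒯 i).h = h at *
  have hd1 : h ^ (d - 1) = h ^ (d - 2) * h := by
    rw [← pow_succ]; congr 1; omega
  have hkP : k * (h ^ (d - 2) * P) ≤ 4 * (h⁻¹ * a) := by
    have h1 : k * h ^ (d - 1) ≤ diskConst d * (ρ * h) ^ (d - 1) := by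
      rw [hk, mul_assoc, ← mul_pow]
      refine mul_le_mul_of_nonneg_left (pow_le_pow_left₀ (by positivity) ?_ _) hdc.le
      nlinarith
    have h2 := (mul_le_mul_of_nonneg_right h1 hP0).trans hpr
    have h3 := mul_le_mul_of_nonneg_left h2 (inv_pos.2 hT).le
    have e1 : h⁻¹ * (k * h ^ (d - 1) * P) = k * (h ^ (d - 2) * P) := by
      rw [hd1]; field_simp
    rw [e1] at h3
    linarith
  have hmain : k * (h ^ d * Γ) ≤ C * ((4 + 16 / ρ ^ 2) * (h⁻¹ * a + e + h⁻¹ ^ 2 * b)) := by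
    have h1 := mul_le_mul_of_nonneg_left hsum hk0.le
    have h2 : k * (C * (h ^ (d - 2) * P + h ^ (d - 1) * Q))
        = C * (k * (h ^ (d - 2) * P) + k * (h ^ (d - 1) * Q)) := by ring
    rw [h2] at h1
    refine h1.trans (mul_le_mul_of_nonneg_left ?_ hC)
    have hρ2 : 0 ≤ 16 / ρ ^ 2 := by positivity
    have h3 : 0 ≤ h⁻¹ * a := by positivity
    have h4 : 0 ≤ h⁻¹ ^ 2 * b := by positivity
    nlinarith [mul_nonneg hρ2 h3, mul_nonneg hρ2 he]
  have e2 : C / k * (4 + 16 / ρ ^ 2) * (h⁻¹ * a + e + h⁻¹ ^ 2 * b)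
      = C * ((4 + 16 / ρ ^ 2) * (h⁻¹ * a + e + h⁻¹ ^ 2 * b)) / k := by ring
  rw [e2, le_div_iff₀ hk0, mul_comm]
  exact hmain

/-- The discrete Poincaré inequality applied to the values at the centroids of the cells. -/
lemma exists_cellVal_bound (hd : 2 ≤ d) {ρ : ℝ} (hρ : 0 < ρ) (hh : ∀ i, 0 < (𝒯 i).h)
    (hb : ∀ i, ∀ s ∈ (𝒯 i).cells, ∃ x, Metric.ball x (ρ * (𝒯 i).h) ⊆ hull s)
    (hfit : ∀ i, (𝒯 i).Fits G.ΓD ∧ (𝒯 i).Fits G.ΓN) :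
    ∃ C, 0 ≤ C ∧ ∀ i (v : (𝒯 i).X),
      (𝒯 i).h ^ d * ∑ s ∈ (𝒯 i).cells, cellVal (v : H1 G.Ω) s (s.centroid ℝ id) ^ 2 ≤
        C * ((𝒯 i).h ^ d * (∑ s ∈ (𝒯 i).cells, ‖cellGrad (v : H1 G.Ω) s‖ ^ 2)
          + (𝒯 i).h ^ 2 * ip ((𝒯 i).on G.ΓN) (bdn (disc v)) (bdn (disc v))
          + ip ((𝒯 i).on G.ΓD) (bval (disc v)) (bval (disc v))) := by
  obtain ⟨C, hC, hP⟩ := exists_poincare_cells hd hρ hb hfit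
  have hdc := diskConst_pos (d := d)
  set k := diskConst d * (ρ / 4) ^ (d - 1) with hk
  have hk0 : 0 < k := by positivity
  refine ⟨C * (4 * (2 / ρ) ^ d + (2 + 32 / ρ ^ 2) / k), by positivity, fun i v => ?_⟩
  have hT := hh i
  have hcs := (cauchy_sum_le (by omega) hρ hT (hb i) v).2
  have hju := jumpSq_cellVal_le G.regular (by omega) hρ hT (hb i) v
  have hsum := hP i fun s => cellVal (v : H1 G.Ω) s (s.centroid ℝ id)
  rw [energy] at hsum
  have hΓ0 : 0 ≤ ∑ s ∈ (𝒯 i).cells, ‖cellGrad (v : H1 G.Ω) s‖ ^ 2 :=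
    Finset.sum_nonneg fun s _ => sq_nonneg _
  have he := ip_self_nonneg ((𝒯 i).on G.ΓN) (bdn (disc v))
  have hb0 := ip_self_nonneg ((𝒯 i).on G.ΓD) (bval (disc v))
  generalize (∑ s ∈ (𝒯 i).cells, ‖cellGrad (v : H1 G.Ω) s‖ ^ 2) = Γ at *
  generalize (𝒯 i).jumpSq (fun s => cellVal (v : H1 G.Ω) s (s.centroid ℝ id)) = J at *
  generalize cauchySq G (𝒯 i) (fun s => cellVal (v : H1 G.Ω) s (s.centroid ℝ id)) = Q at *
  generalize ip ((𝒯 i).on G.ΓN) (bdn (disc v)) (bdn (disc v)) = e at *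
  generalize ip ((𝒯 i).on G.ΓD) (bval (disc v)) (bval (disc v)) = b at *
  generalize (𝒯 i).h = h at *
  refine hsum.trans ?_
  rw [mul_assoc]
  refine mul_le_mul_of_nonneg_left ?_ hC
  have hd1 : h ^ d = h ^ (d - 2) * h ^ 2 := by
    rw [← pow_add]; congr 1; omega
  have h1 : h ^ (d - 2) * J ≤ 4 * (2 / ρ) ^ d * (h ^ d * Γ) := by
    have := mul_le_mul_of_nonneg_left hju (pow_nonneg hT.le (d - 2))
    rw [hd1]
    linarith
  have h2 : h ^ (d - 1) * Q ≤ (2 + 32 / ρ ^ 2) / k * (h ^ 2 * e + b) := by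
    have h3 : (2 + 32 / ρ ^ 2) / k * (h ^ 2 * e + b)
      = ((2 + 32 / ρ ^ 2) * (h ^ 2 * e + b)) / k := by ring
    rw [h3, le_div_iff₀ hk0, mul_comm]
    refine hcs.trans ?_
    have : 0 ≤ 32 / ρ ^ 2 * (h ^ 2 * e) := by positivity
    linarith
  have h4 : 0 ≤ 4 * (2 / ρ) ^ d := by positivity
  have h5 : 0 ≤ (2 + 32 / ρ ^ 2) / k := by positivity
  have h6 : 0 ≤ h ^ d * Γ := by positivity
  have h7 : 0 ≤ h ^ 2 * e + b := by positivity
  nlinarith [mul_nonneg h4 h7, mul_nonneg h5 h6]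

/-- The arithmetic that combines the bounds for the gradients (`Γ`) and for the values at the
centroids (`μ`) to a bound for the norm `n`. -/
lemma discrete_poincare_arith {C₁ C₂ D B h a b e Γ μ n : ℝ} (hC₁ : 0 ≤ C₁) (hC₂ : 0 ≤ C₂)
    (hB : 0 < B) (hT : 0 < h) (hTD : h ≤ D)
    (g1 : Γ ≤ C₁ * (h⁻¹ * a ^ 2 + e ^ 2 + h⁻¹ ^ 2 * b ^ 2))
    (g2 : μ ≤ C₂ * (Γ + h ^ 2 * e ^ 2 + b ^ 2))
    (g3 : n ^ 2 ≤ B * (2 * μ + (2 * h ^ 2 + 1) * Γ)) :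
    (h * n) ^ 2 ≤ B * (2 * (C₂ * (C₁ * (1 + D) + D ^ 3)) + (2 * D ^ 2 + 1) * (C₁ * (1 + D))) *
      (h * a ^ 2 + h⁻¹ * b ^ 2 + h * e ^ 2) := by
  have hD0 : 0 ≤ D := hT.le.trans hTD
  have n1 : 0 ≤ h * a ^ 2 := by positivity
  have n2 : 0 ≤ h⁻¹ * b ^ 2 := by positivity
  have n3 : 0 ≤ h * e ^ 2 := by positivity
  have k1 : h ^ 2 * Γ ≤ C₁ * (1 + D) * (h * a ^ 2 + h⁻¹ * b ^ 2 + h * e ^ 2) := by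
    have h0 := mul_le_mul_of_nonneg_left g1 (sq_nonneg h)
    have e1 : h ^ 2 * (C₁ * (h⁻¹ * a ^ 2 + e ^ 2 + h⁻¹ ^ 2 * b ^ 2))
        = C₁ * (h * a ^ 2 + h * (h * e ^ 2) + h * (h⁻¹ * b ^ 2)) := by
      field_simp
    rw [e1] at h0
    refine h0.trans ?_
    rw [mul_assoc]
    refine mul_le_mul_of_nonneg_left ?_ hC₁
    have h1 := mul_le_mul_of_nonneg_right hTD n2
    have h2 := mul_le_mul_of_nonneg_right hTD n3
    have h3 := mul_nonneg hD0 n1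
    have e2 : (1 + D) * (h * a ^ 2 + h⁻¹ * b ^ 2 + h * e ^ 2) = h * a ^ 2 + h⁻¹ * b ^ 2 + h * e ^ 2
      + D * (h * a ^ 2) + D * (h⁻¹ * b ^ 2) + D * (h * e ^ 2) := by ring
    rw [e2]; linarith
  have k2 : h ^ 2 * μ ≤ C₂ * (C₁ * (1 + D) + D ^ 3) *
      (h * a ^ 2 + h⁻¹ * b ^ 2 + h * e ^ 2) := by
    have h0 := mul_le_mul_of_nonneg_left g2 (sq_nonneg h)
    have e1 : h ^ 2 * (C₂ * (Γ + h ^ 2 * e ^ 2 + b ^ 2))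
        = C₂ * (h ^ 2 * Γ + h ^ 3 * (h * e ^ 2) + h ^ 3 * (h⁻¹ * b ^ 2)) := by
      field_simp
    rw [e1] at h0
    refine h0.trans ?_
    rw [mul_assoc]
    refine mul_le_mul_of_nonneg_left ?_ hC₂
    have h3 : h ^ 3 ≤ D ^ 3 := pow_le_pow_left₀ hT.le hTD 3
    have h4 := mul_le_mul_of_nonneg_right h3 n2
    have h5 := mul_le_mul_of_nonneg_right h3 n3
    have h6 := mul_nonneg (pow_nonneg hD0 3) n1
    have e2 : (C₁ * (1 + D) + D ^ 3) * (h * a ^ 2 + h⁻¹ * b ^ 2 + h * e ^ 2)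
      = C₁ * (1 + D) * (h * a ^ 2 + h⁻¹ * b ^ 2 + h * e ^ 2)
      + D ^ 3 * (h * a ^ 2) + D ^ 3 * (h⁻¹ * b ^ 2) + D ^ 3 * (h * e ^ 2) := by ring
    rw [e2]; linarith
  have hN0 : 0 ≤ C₁ * (1 + D) * (h * a ^ 2 + h⁻¹ * b ^ 2 + h * e ^ 2) := by positivity
  generalize h * a ^ 2 + h⁻¹ * b ^ 2 + h * e ^ 2 = N at *
  generalize C₁ * (1 + D) = Q₁ at *
  generalize C₂ * (Q₁ + D ^ 3) = Q₂ at *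
  have h0 := mul_le_mul_of_nonneg_left g3 (sq_nonneg h)
  have e1 : h ^ 2 * (B * (2 * μ + (2 * h ^ 2 + 1) * Γ))
      = B * (2 * (h ^ 2 * μ) + (2 * h ^ 2 + 1) * (h ^ 2 * Γ)) := by ring
  rw [e1] at h0
  rw [mul_pow, mul_assoc]
  refine h0.trans (mul_le_mul_of_nonneg_left ?_ hB.le)
  have h2 : h ^ 2 ≤ D ^ 2 := pow_le_pow_left₀ hT.le hTD 2
  have h4 : (2 * h ^ 2 + 1) * (h ^ 2 * Γ) ≤ (2 * D ^ 2 + 1) * (Q₁ * N) :=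
    (mul_le_mul_of_nonneg_left k1 (by positivity)).trans
      (mul_le_mul_of_nonneg_right (by linarith) hN0)
  linarith

lemma discrete_poincare_arith_sqrt {C₁ C₂ D B h a b e Γ μ n : ℝ} (hC₁ : 0 ≤ C₁) (hC₂ : 0 ≤ C₂)
    (hB : 0 < B) (hT : 0 < h) (hTD : h ≤ D) (ha : 0 ≤ a) (hb : 0 ≤ b) (he : 0 ≤ e)
    (g1 : Γ ≤ C₁ * (h⁻¹ * a ^ 2 + e ^ 2 + h⁻¹ ^ 2 * b ^ 2))
    (g2 : μ ≤ C₂ * (Γ + h ^ 2 * e ^ 2 + b ^ 2))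
    (g3 : n ^ 2 ≤ B * (2 * μ + (2 * h ^ 2 + 1) * Γ)) :
    h * n ≤ √(B * (2 * (C₂ * (C₁ * (1 + D) + D ^ 3)) + (2 * D ^ 2 + 1) * (C₁ * (1 + D)))) *
      (√h * a + (√h)⁻¹ * b + √h * e) := by
  have hD0 : 0 ≤ D := hT.le.trans hTD
  have k3 := discrete_poincare_arith hC₁ hC₂ hB hT hTD g1 g2 g3
  refine abs_le_of_sq_le_sq' (k3.trans ?_) (by positivity) |>.2
  rw [mul_pow, Real.sq_sqrt (by positivity)]
  refine mul_le_mul_of_nonneg_left ?_ (by positivity)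
  have s1 : √h ^ 2 = h := Real.sq_sqrt hT.le
  have e3 : h * a ^ 2 + h⁻¹ * b ^ 2 + h * e ^ 2
      = (√h * a) ^ 2 + ((√h)⁻¹ * b) ^ 2 + (√h * e) ^ 2 := by
    rw [mul_pow, mul_pow, mul_pow, inv_pow, s1]
  rw [e3]
  have p1 : 0 ≤ √h * a := by positivity
  have p2 : 0 ≤ (√h)⁻¹ * b := by positivity
  have p3 : 0 ≤ √h * e := by positivity
  nlinarith [mul_nonneg p1 p2, mul_nonneg p1 p3, mul_nonneg p2 p3]

/-- A discrete function whose normal derivative jumps little and whose Cauchy data are small is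
small: `h ‖v‖` is bounded by the part of the semi-norm of `v` that does not involve the
differential operator. -/
theorem exists_discrete_poincare (hd : 2 ≤ d) {ρ : ℝ} (hρ : 0 < ρ) (hh : ∀ i, 0 < (𝒯 i).h)
    (hb : ∀ i, ∀ s ∈ (𝒯 i).cells, ∃ x, Metric.ball x (ρ * (𝒯 i).h) ⊆ hull s)
    (hfit : ∀ i, (𝒯 i).Fits G.ΓD ∧ (𝒯 i).Fits G.ΓN) :
    ∃ C, 0 ≤ C ∧ ∀ i (v : (𝒯 i).X), (𝒯 i).h * ‖(v : H1 G.Ω)‖ ≤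
        C * (√(𝒯 i).h * nrm (𝒯 i).intFacets (bjump (disc v))
          + (√(𝒯 i).h)⁻¹ * nrm ((𝒯 i).on G.ΓD) (bval (disc v))
          + √(𝒯 i).h * nrm ((𝒯 i).on G.ΓN) (bdn (disc v))) := by
  obtain ⟨C₁, hC₁, h₁⟩ := exists_cellGrad_bound (𝒯 := 𝒯) hd hρ hh hb hfit
  obtain ⟨C₂, hC₂, h₂⟩ := exists_cellVal_bound (𝒯 := 𝒯) hd hρ hh hb hfit
  set D := Metric.diam (closure G.Ω) with hD
  have hD0 : 0 ≤ D := Metric.diam_nonneg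
  set B := ballConst d
  have hB : 0 < B := ballConst_pos
  refine ⟨√(B * (2 * (C₂ * (C₁ * (1 + D) + D ^ 3)) + (2 * D ^ 2 + 1) * (C₁ * (1 + D)))),
    Real.sqrt_nonneg _, fun i v => ?_⟩
  have hT := hh i
  have hTD : (𝒯 i).h ≤ D := (𝒯 i).h_le
  have g1 := h₁ i v
  have g2 := h₂ i v
  have g3 := norm_sq_le_sum (by omega) hT v
  rw [← nrm_sq, ← nrm_sq, ← nrm_sq] at g1
  rw [← nrm_sq, ← nrm_sq] at g2
  exact discrete_poincare_arith_sqrt hC₁ hC₂ hB hT hTD (nrm_nonneg _ _) (nrm_nonneg _ _)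
    (nrm_nonneg _ _) g1 g2 g3

end DiscretePoincare
end CauchyFEM
end

noncomputable section
namespace CauchyFEM
variable {d : ℕ}

/-! ### Linearity of the discrete operations -/

lemma memLp_trace (Ω A : Set (E d)) (v : H1 Ω) : MemLp (trace Ω A v) 2 ((surf d).restrict A) := by
  unfold trace
  split_ifs with h1 h2
  · exact MemLp.zero
  · exact h2.choose_spec.1
  · exact MemLp.zero

lemma memLp_hull_surf {f : E d → ℝ} (hf : Continuous f) {F : Finset (E d)} (hF : F.card ≤ d) :
    MemLp f 2 ((surf d).restrict (hull F)) := by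
  obtain ⟨C, hC⟩ := (Mesh.isCompact_hull F).exists_bound_of_continuousOn hf.continuousOn
  have : IsFiniteMeasure ((surf d).restrict (hull F)) :=
    ⟨by simpa using surf_hull_lt_top hF⟩
  exact MemLp.of_bound hf.aestronglyMeasurable C
    ((ae_restrict_iff' (Mesh.measurableSet_hull F)).2 (Eventually.of_forall hC))

/-- The triangle inequality of `L²`, for integrals of squares. -/
lemma sqrt_integral_sq_sub_le {α : Type*} [MeasurableSpace α] {μ : Measure α} {f g : α → ℝ}
    (hf : MemLp f 2 μ) (hg : MemLp g 2 μ) :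
    √(∫ x, (f x - g x) ^ 2 ∂μ) ≤ √(∫ x, f x ^ 2 ∂μ) + √(∫ x, g x ^ 2 ∂μ) := by
  have hfg : Integrable (fun x => f x * g x) μ := hf.integrable_mul (q := 2) hg
  have e : ∫ x, (f x - g x) ^ 2 ∂μ
      = (∫ x, f x ^ 2 ∂μ) - 2 * (∫ x, f x * g x ∂μ) + ∫ x, g x ^ 2 ∂μ := by
    have e1 : ∀ x, (f x - g x) ^ 2 = f x ^ 2 - 2 * (f x * g x) + g x ^ 2 := fun x => by ring
    simp only [e1]
    have i1 : Integrable (fun x => f x ^ 2 - 2 * (f x * g x)) μ :=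
      hf.integrable_sq.sub (hfg.const_mul _)
    rw [integral_add i1 hg.integrable_sq, integral_sub hf.integrable_sq (hfg.const_mul _),
      integral_const_mul]
  have hf0 : 0 ≤ ∫ x, f x ^ 2 ∂μ := integral_nonneg fun x => sq_nonneg _
  have hg0 : 0 ≤ ∫ x, g x ^ 2 ∂μ := integral_nonneg fun x => sq_nonneg _
  have hcs : -(∫ x, f x * g x ∂μ) ≤ √(∫ x, f x ^ 2 ∂μ) * √(∫ x, g x ^ 2 ∂μ) := by
    rw [← Real.sqrt_mul hf0]
    refine (neg_le_abs _).trans (Real.abs_le_sqrt (sq_integral_mul_le hf hg))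
  refine Real.sqrt_le_iff.2 ⟨by positivity, ?_⟩
  rw [e, add_sq, Real.sq_sqrt hf0, Real.sq_sqrt hg0]
  linarith

namespace Mesh

open Classical

variable {Ω : Set (E d)} {T : Mesh Ω}

/-! #### The `L²`-product over facets -/

section ip

variable {A : Finset (Finset (E d))} {p q r : Finset (E d) → E d → ℝ}

/-- Square integrability over each facet of a set of facets. -/
def SqInt (A : Finset (Finset (E d))) (p : Finset (E d) → E d → ℝ) : Prop :=
  ∀ F ∈ A, MemLp (p F) 2 ((surf d).restrict (hull F))

lemma ip_comm : ip A p q = ip A q p := by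
  unfold ip; simp only [mul_comm]

lemma ip_sub_left (hp : SqInt A p) (hq : SqInt A q) (hr : SqInt A r) :
    ip A (p - q) r = ip A p r - ip A q r := by
  unfold ip
  rw [← Finset.sum_sub_distrib]
  refine Finset.sum_congr rfl fun F hF => ?_
  have i1 : Integrable (fun x => p F x * r F x) ((surf d).restrict (hull F)) :=
    (hp F hF).integrable_mul (q := 2) (hr F hF)
  have i2 : Integrable (fun x => q F x * r F x) ((surf d).restrict (hull F)) :=
    (hq F hF).integrable_mul (q := 2) (hr F hF)
  rw [← integral_sub i1 i2]
  refine integral_congr_ae (Eventually.of_forall fun x => ?_)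
  simp only [Pi.sub_apply, sub_mul]

lemma ip_sub_right (hp : SqInt A p) (hq : SqInt A q) (hr : SqInt A r) :
    ip A r (p - q) = ip A r p - ip A r q := by
  rw [ip_comm, ip_sub_left hp hq hr, ip_comm, ip_comm (p := q)]

lemma SqInt.sub (hp : SqInt A p) (hq : SqInt A q) : SqInt A (p - q) :=
  fun F hF => (hp F hF).sub (hq F hF)

lemma abs_ip_le (hp : SqInt A p) (hq : SqInt A q) : |ip A p q| ≤ nrm A p * nrm A q := by
  unfold nrm ip
  refine (Finset.abs_sum_le_sum_abs _ _).trans ?_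
  have h0 : ∀ (p : Finset (E d) → E d → ℝ) F, 0 ≤ ∫ x in hull F, p F x * p F x ∂(surf d) :=
    fun p F => integral_nonneg fun _ => mul_self_nonneg _
  have h1 : ∀ F ∈ A, |∫ x in hull F, p F x * q F x ∂(surf d)|
      ≤ √(∫ x in hull F, p F x * p F x ∂(surf d)) * √(∫ x in hull F, q F x * q F x ∂(surf d)) := by
    intro F hF
    rw [← Real.sqrt_mul (h0 p F)]
    have := sq_integral_mul_le (hp F hF) (hq F hF)
    simp only [← pow_two]
    exact Real.abs_le_sqrt this
  refine (Finset.sum_le_sum h1).trans ?_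
  have := Real.sum_sqrt_mul_sqrt_le A (h0 p) (h0 q)
  exact this

lemma nrm_sub_le (hp : SqInt A p) (hq : SqInt A q) : nrm A (p - q) ≤ nrm A p + nrm A q := by
  have e : ip A (p - q) (p - q) = ip A p p - 2 * ip A p q + ip A q q := by
    rw [ip_sub_left hp hq (hp.sub hq), ip_comm, ip_comm (p := q),
      ip_sub_left hp hq hp, ip_sub_left hp hq hq, ip_comm (p := q) (q := p)]
    ring
  refine Real.sqrt_le_iff.2 ⟨add_nonneg (nrm_nonneg _ _) (nrm_nonneg _ _), ?_⟩
  rw [e, add_sq, nrm_sq, nrm_sq]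
  linarith [(abs_le.1 (abs_ip_le hp hq)).1]

lemma nrm_zero : nrm A (0 : Finset (E d) → E d → ℝ) = 0 := by
  simp [nrm, ip]

lemma ip_zero_left : ip A 0 q = 0 := by simp [ip]

end ip

/-! #### Cell gradients and cell values -/

lemma isFiniteMeasure_interior (s : Finset (E d)) :
    IsFiniteMeasure (volume.restrict (interior (hull s))) :=
  ⟨by simpa using (volume_interior_hull_ne_top s).lt_top⟩

lemma cellGrad_sub (hreg : interior (closure Ω) = Ω) (v w : H1 Ω) {s : Finset (E d)}
    (hs : s ∈ T.cells) : cellGrad (v - w) s = cellGrad v s - cellGrad w s := by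
  have hU := interior_hull_subset hreg hs
  have := isFiniteMeasure_interior s
  have hi : ∀ v : H1 Ω, Integrable (grad v) (volume.restrict (interior (hull s))) := fun v =>
    ((memLp_grad v).mono_measure (Measure.restrict_mono hU le_rfl)).integrable (by norm_num)
  unfold cellGrad
  rw [setAverage_eq, setAverage_eq, setAverage_eq, ← smul_sub, ← integral_sub (hi v) (hi w)]
  congr 1
  exact integral_congr_ae (ae_restrict_of_ae_restrict_of_subset hU (grad_sub v w))

lemma cellVal_sub (hreg : interior (closure Ω) = Ω) (v w : H1 Ω) {s : Finset (E d)}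
    (hs : s ∈ T.cells) (x : E d) : cellVal (v - w) s x = cellVal v s x - cellVal w s x := by
  have hU := interior_hull_subset hreg hs
  have := isFiniteMeasure_interior s
  have hi : ∀ v : H1 Ω, Integrable (fun y => fn v y + inner ℝ (cellGrad v s) (x - y))
      (volume.restrict (interior (hull s))) := fun v => by
    refine Integrable.add (((memLp_fn v).mono_measure
      (Measure.restrict_mono hU le_rfl)).integrable (by norm_num)) ?_
    have hc : Continuous fun y : E d => inner ℝ (cellGrad v s) (x - y) := by fun_prop
    exact (hc.continuousOn.integrableOn_compact (isCompact_hull s)).mono_set interior_subset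
  unfold cellVal
  rw [setAverage_eq, setAverage_eq, setAverage_eq, ← smul_sub, ← integral_sub (hi v) (hi w)]
  congr 1
  refine integral_congr_ae ?_
  filter_upwards [ae_restrict_of_ae_restrict_of_subset hU (fn_sub v w)] with y hy
  rw [hy, cellGrad_sub hreg v w hs, inner_sub_left, Pi.sub_apply]
  ring

lemma faceVal_sub (hreg : interior (closure Ω) = Ω) (v w : H1 Ω) :
    T.faceVal (v - w) = T.faceVal v - T.faceVal w := by
  funext F x
  simp only [faceVal, Pi.sub_apply]
  rw [← mul_sub, ← Finset.sum_sub_distrib]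
  congr 1
  exact Finset.sum_congr rfl fun s hs => cellVal_sub hreg v w (mem_adj.1 hs).1 x

lemma normalFlux_sub (hreg : interior (closure Ω) = Ω) (v w : H1 Ω) (F : Finset (E d)) :
    T.normalFlux (v - w) F = T.normalFlux v F - T.normalFlux w F := by
  simp only [normalFlux]
  rw [← Finset.sum_sub_distrib]
  refine Finset.sum_congr rfl fun s hs => ?_
  rw [cellGrad_sub hreg v w (mem_adj.1 hs).1, inner_sub_left]

/-! #### Broken functions -/

lemma bval_sub (hreg : interior (closure Ω) = Ω) (φ : H2 Ω) (y e : T.X) :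
    bval (T := T) (φ, y - e) = bval (φ, y) - bval (disc e) := by
  rw [bval_disc]
  funext F x
  simp only [bval, Pi.sub_apply]
  rw [Submodule.coe_sub, faceVal_sub hreg, Pi.sub_apply, Pi.sub_apply]
  ring

lemma bdn_sub (hreg : interior (closure Ω) = Ω) (φ : H2 Ω) (y e : T.X) :
    bdn (T := T) (φ, y - e) = bdn (φ, y) - bdn (disc e) := by
  rw [bdn_disc]
  funext F x
  simp only [bdn, Pi.sub_apply]
  rw [Submodule.coe_sub, normalFlux_sub hreg]
  ring

lemma bjump_sub (hreg : interior (closure Ω) = Ω) (φ : H2 Ω) (y e : T.X) :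
    bjump (T := T) (φ, y - e) = bjump (φ, y) - bjump (disc e) := by
  funext F x
  simp only [bjump, disc, Pi.sub_apply]
  rw [Submodule.coe_sub, normalFlux_sub hreg]

lemma bfn_sub (φ : H2 Ω) (y e : T.X) :
    bfn (T := T) (φ, y - e) = bfn (φ, y) - bfn (disc e) := by
  rw [bfn_disc]
  simp only [bfn]
  rw [Submodule.coe_sub, add_sub_assoc]

lemma lap_zero : lap (0 : H2 Ω) =ᵐ[vol Ω] 0 := by
  filter_upwards [grad_zero (Ω := Ω)] with x hx
  simp only [lap, dx_zero, hx]
  simp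

lemma bop_sub (c : ℝ) (φ : H2 Ω) (y e : T.X) :
    bop (T := T) c (φ, y - e) =ᵐ[vol Ω] fun x => bop c (φ, y) x - bop c (disc e) x := by
  have h := fn_sub (bfn (T := T) (φ, y)) (bfn (disc e))
  rw [← bfn_sub] at h
  filter_upwards [h, lap_zero] with x hx h0
  change -lap φ x + c * fn (bfn (T := T) (φ, y - e)) x
    = (-lap φ x + c * fn (bfn (T := T) (φ, y)) x) - (-lap (0 : H2 Ω) x + c * fn (bfn (disc e)) x)
  rw [hx, h0, Pi.sub_apply, Pi.zero_apply]
  ring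

lemma memLp_bop (c : ℝ) (b : T.Broken) : MemLp (bop c b) 2 (vol Ω) := by
  refine MemLp.add (MemLp.neg ?_) ((memLp_fn _).const_mul c)
  refine memLp_finsetSum _ fun i _ => ?_
  refine MemLp.of_le (memLp_grad (dx b.1 i)) ?_
    (Eventually.of_forall fun x => PiLp.norm_apply_le _ i)
  exact (EuclideanSpace.proj (𝕜 := ℝ) i).continuous.comp_aestronglyMeasurable (grad_meas _)

lemma continuous_faceVal (hreg : interior (closure Ω) = Ω) (v : T.X) (F : Finset (E d)) :
    Continuous (T.faceVal (v : H1 Ω) F) :=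
  continuous_const.mul (continuous_finsetSum _ fun _ hs =>
    continuous_cellVal hreg v (mem_adj.1 hs).1)

variable {A : Finset (Finset (E d))}

lemma sqInt_bval (hreg : interior (closure Ω) = Ω) (hA : ∀ F ∈ A, F.card ≤ d) (b : T.Broken) :
    SqInt A (bval b) := fun F hF =>
  (memLp_trace _ _ _).add (memLp_hull_surf (continuous_faceVal hreg b.2 F) (hA F hF))

lemma sqInt_bdn (hA : ∀ F ∈ A, F.card ≤ d) (b : T.Broken) : SqInt A (bdn b) := fun F hF =>
  (memLp_finsetSum _ fun _ _ => (memLp_trace _ _ _).mul_const _).add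
    (memLp_hull_surf continuous_const (hA F hF))

lemma sqInt_bjump (hA : ∀ F ∈ A, F.card ≤ d) (b : T.Broken) : SqInt A (bjump b) := fun F hF =>
  memLp_hull_surf continuous_const (hA F hF)

lemma card_intFacets : ∀ F ∈ T.intFacets, F.card ≤ d := fun _ hF =>
  (Finset.mem_filter.1 hF).2.1.le

lemma card_bdryFacets : ∀ F ∈ T.bdryFacets, F.card ≤ d := fun _ hF =>
  (Finset.mem_filter.1 hF).2.1.le

lemma card_on (Γ : Set (E d)) : ∀ F ∈ T.on Γ, F.card ≤ d := fun F hF =>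
  card_bdryFacets F (Finset.mem_filter.1 hF).1

lemma card_off (Γ : Set (E d)) : ∀ F ∈ T.off Γ, F.card ≤ d := fun F hF =>
  card_bdryFacets F (Finset.mem_filter.1 hF).1

lemma normalFlux_zero (hreg : interior (closure Ω) = Ω) (F : Finset (E d)) :
    T.normalFlux (0 : H1 Ω) F = 0 := by
  have := normalFlux_sub (T := T) hreg 0 0 F
  rwa [sub_self, sub_self] at this

lemma bval_disc_zero (hreg : interior (closure Ω) = Ω) : bval (disc (0 : T.X)) = 0 := by
  have := bval_sub (T := T) hreg 0 0 0
  rwa [sub_self, disc, sub_self] at this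

lemma bdn_disc_zero (hreg : interior (closure Ω) = Ω) : bdn (disc (0 : T.X)) = 0 := by
  have := bdn_sub (T := T) hreg 0 0 0
  rwa [sub_self, disc, sub_self] at this

lemma bjump_smooth (hreg : interior (closure Ω) = Ω) (φ : H2 Ω) :
    bjump (smooth φ : T.Broken) = 0 := by
  funext F x
  exact normalFlux_zero hreg F

lemma bjump_disc_zero (hreg : interior (closure Ω) = Ω) : bjump (disc (0 : T.X)) = 0 :=
  bjump_smooth hreg 0

lemma bfn_disc_zero : bfn (disc (0 : T.X)) = 0 := bfn_disc 0

lemma integral_bop_disc_zero (c : ℝ) : ∫ x in Ω, bop c (disc (0 : T.X)) x ^ 2 = 0 := by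
  rw [integral_congr_ae (g := fun _ => 0), integral_zero]
  filter_upwards [lap_zero, fn_zero (Ω := Ω)] with x hx h0
  simp only [bop]
  rw [bfn_disc_zero, h0]
  simp only [disc, hx]
  simp

end Mesh
end CauchyFEM
end

noncomputable section
namespace CauchyFEM
variable {d : ℕ}

/-! ### The bilinear form -/

namespace Domain

variable (G : Domain d)

lemma a_eq_inner (c : ℝ) (v w : H1 G.Ω) :
    G.a c v w = inner ℝ v.1.snd w.1.snd + c * inner ℝ v.1.fst w.1.fst := by
  rw [L2.inner_def, L2.inner_def, ← integral_const_mul,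
    ← integral_add (L2.integrable_inner v.1.snd w.1.snd)
      ((L2.integrable_inner (𝕜 := ℝ) v.1.fst w.1.fst).const_mul c)]
  refine integral_congr_ae (Eventually.of_forall fun x => ?_)
  have e : ∀ a b : ℝ, inner ℝ a b = a * b := fun a b => by simp [mul_comm]
  simp only [grad, fn, e]

lemma a_sub_left (c : ℝ) (v v' w : H1 G.Ω) : G.a c (v - v') w = G.a c v w - G.a c v' w := by
  simp only [a_eq_inner]
  change inner ℝ (v.1.snd - v'.1.snd) w.1.snd + c * inner ℝ (v.1.fst - v'.1.fst) w.1.fst = _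
  rw [inner_sub_left, inner_sub_left]; ring

lemma abs_a_le (c : ℝ) (v w : H1 G.Ω) : |G.a c v w| ≤ max 1 |c| * (‖v‖ * ‖w‖) := by
  have hv : ‖v‖ ^ 2 = ‖v.1.fst‖ ^ 2 + ‖v.1.snd‖ ^ 2 := WithLp.prod_norm_sq_eq_of_L2 v.1
  have hw : ‖w‖ ^ 2 = ‖w.1.fst‖ ^ 2 + ‖w.1.snd‖ ^ 2 := WithLp.prod_norm_sq_eq_of_L2 w.1
  have h1 := abs_real_inner_le_norm v.1.snd w.1.snd
  have h2 := abs_real_inner_le_norm v.1.fst w.1.fst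
  have h3 : ‖v.1.snd‖ * ‖w.1.snd‖ + ‖v.1.fst‖ * ‖w.1.fst‖ ≤ ‖v‖ * ‖w‖ := by
    refine abs_le_of_sq_le_sq' ?_ (by positivity) |>.2
    rw [mul_pow, hv, hw]
    nlinarith [sq_nonneg (‖v.1.snd‖ * ‖w.1.fst‖ - ‖v.1.fst‖ * ‖w.1.snd‖)]
  rw [a_eq_inner]
  refine (abs_add_le _ _).trans ?_
  rw [abs_mul]
  calc _ ≤ max 1 |c| * (‖v.1.snd‖ * ‖w.1.snd‖) + max 1 |c| * (‖v.1.fst‖ * ‖w.1.fst‖) := by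
        refine add_le_add (h1.trans ?_) (mul_le_mul (le_max_right _ _) h2 (abs_nonneg _)
          (by positivity))
        exact le_mul_of_one_le_left (by positivity) (le_max_left _ _)
    _ ≤ _ := by
      rw [← mul_add]
      exact mul_le_mul_of_nonneg_left h3 (by positivity)

lemma a_add_right (c : ℝ) (v w w' : H1 G.Ω) : G.a c v (w + w') = G.a c v w + G.a c v w' := by
  simp only [a_eq_inner]
  change inner ℝ v.1.snd (w.1.snd + w'.1.snd) + c * inner ℝ v.1.fst (w.1.fst + w'.1.fst) = _
  rw [inner_add_right, inner_add_right]; ring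

lemma a_smul_right (c t : ℝ) (v w : H1 G.Ω) : G.a c v (t • w) = t * G.a c v w := by
  simp only [a_eq_inner]
  change inner ℝ v.1.snd (t • w.1.snd) + c * inner ℝ v.1.fst (t • w.1.fst) = _
  rw [real_inner_smul_right, real_inner_smul_right]; ring

/-- The functional `a(v, ·)`. -/
def aL (c : ℝ) (v : H1 G.Ω) : H1 G.Ω →L[ℝ] ℝ :=
  LinearMap.mkContinuous
    { toFun := G.a c v
      map_add' := G.a_add_right c v
      map_smul' := fun t w => G.a_smul_right c t v w }
    (max 1 |c| * ‖v‖) fun w => by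
      have h := G.abs_a_le c v w
      rw [← mul_assoc, ← Real.norm_eq_abs] at h
      exact h

end Domain

/-! ### The forms of the method -/

namespace Method

open Mesh

variable {G : Domain d} {P : Params} {T : Mesh G.Ω}

lemma sqInt_bval_on (Γ : Set (E d)) (b : T.Broken) : SqInt (T.on Γ) (bval b) :=
  sqInt_bval G.regular (card_on (T := T) Γ) b

lemma sqInt_bval_off (Γ : Set (E d)) (b : T.Broken) : SqInt (T.off Γ) (bval b) :=
  sqInt_bval G.regular (card_off (T := T) Γ) b

lemma sqInt_bdn_on (Γ : Set (E d)) (b : T.Broken) : SqInt (T.on Γ) (bdn b) :=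
  sqInt_bdn (card_on (T := T) Γ) b

lemma sqInt_bdn_off (Γ : Set (E d)) (b : T.Broken) : SqInt (T.off Γ) (bdn b) :=
  sqInt_bdn (card_off (T := T) Γ) b

lemma sqInt_bjump_int (b : T.Broken) : SqInt T.intFacets (bjump b) :=
  sqInt_bjump (card_intFacets (T := T)) b

lemma ah_sub (φ : H2 G.Ω) (y e : T.X) (w : T.Broken) :
    ah G P T (φ, y - e) w = ah G P T (φ, y) w - ah G P T (disc e) w := by
  have e1 := ip_sub_left (sqInt_bdn_off G.ΓN ((φ, y) : T.Broken)) (sqInt_bdn_off G.ΓN (disc e))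
    (sqInt_bval_off G.ΓN w)
  have e2 := ip_sub_right (sqInt_bval_on G.ΓD ((φ, y) : T.Broken)) (sqInt_bval_on G.ΓD (disc e))
    (sqInt_bdn_on G.ΓD w)
  have e3 := G.a_sub_left P.c (bfn ((φ, y) : T.Broken)) (bfn (disc e)) (bfn w)
  rw [← bdn_sub G.regular] at e1
  rw [← bval_sub G.regular] at e2
  rw [← bfn_sub] at e3
  unfold ah
  linear_combination e3 - e1 - e2

lemma ah_disc_zero (w : T.Broken) : ah G P T (disc 0) w = 0 := by
  have := ah_sub (P := P) (T := T) 0 0 0 w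
  rw [sub_self] at this
  exact this.trans (sub_self _)

lemma sV_sub (φ : H2 G.Ω) (y e : T.X) (w : T.Broken) :
    sV G P T (φ, y - e) w = sV G P T (φ, y) w - sV G P T (disc e) w := by
  have e1 := ip_sub_left (sqInt_bval_on G.ΓD ((φ, y) : T.Broken)) (sqInt_bval_on G.ΓD (disc e))
    (sqInt_bval_on G.ΓD w)
  have e2 := ip_sub_left (sqInt_bdn_on G.ΓN ((φ, y) : T.Broken)) (sqInt_bdn_on G.ΓN (disc e))
    (sqInt_bdn_on G.ΓN w)
  have e3 := ip_sub_left (sqInt_bjump_int ((φ, y) : T.Broken)) (sqInt_bjump_int (disc e))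
    (sqInt_bjump_int w)
  rw [← bval_sub G.regular] at e1
  rw [← bdn_sub G.regular] at e2
  rw [← bjump_sub G.regular] at e3
  unfold sV sVD cip
  linear_combination P.γD * T.h⁻¹ * e1 + P.γD * T.h * e2 + P.γS * T.h * e3

lemma sVD_smooth (φ : H2 G.Ω) (w : T.Broken) :
    sVD G P T (smooth φ) w = sV G P T (smooth φ) w := by
  unfold sV cip
  rw [bjump_smooth G.regular, ip_zero_left]; ring

lemma sV_disc_zero_right (v : T.Broken) : sV G P T v (disc 0) = 0 := by
  unfold sV sVD cip
  rw [bjump_disc_zero G.regular, bval_disc_zero G.regular, bdn_disc_zero G.regular, ip_comm,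
    ip_zero_left, ip_comm, ip_zero_left, ip_comm, ip_zero_left]; ring

lemma sVD_disc_zero_right (v : T.Broken) : sVD G P T v (disc 0) = 0 := by
  unfold sVD
  rw [bval_disc_zero G.regular, bdn_disc_zero G.regular, ip_comm,
    ip_zero_left, ip_comm, ip_zero_left]; ring

/-! ### The semi-norm -/

variable (G P T) in
/-- The terms of the semi-norm that involve the primal variable. -/
def primalNorm (v : T.Broken) : ℝ :=
  T.h * √(∫ x in G.Ω, bop P.c v x ^ 2) + √T.h * nrm T.intFacets (bjump v)
  + (√T.h)⁻¹ * nrm (T.on G.ΓD) (bval v) + √T.h * nrm (T.on G.ΓN) (bdn v)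

variable (G P T) in
/-- The terms of the semi-norm that involve the adjoint variable. -/
def adjointNorm (w : T.Broken) : ℝ :=
  T.h * √(∫ x in G.Ω, bop P.c w x ^ 2) + √T.h * nrm T.intFacets (bjump w)
  + (√T.h)⁻¹ * nrm (T.off G.ΓN) (bval w) + √T.h * nrm (T.off G.ΓD) (bdn w)
  + (match P.adj with
    | .cip => 0
    | .grad => ‖(bfn w)‖)

lemma normL_eq (v w : T.Broken) :
    normL G P T v w = primalNorm G P T v + adjointNorm G P T w := by
  unfold normL primalNorm adjointNorm
  cases P.adj <;> ring

lemma primalNorm_zero : primalNorm G P T (disc 0) = 0 := by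
  unfold primalNorm
  rw [bjump_disc_zero G.regular, bval_disc_zero G.regular, bdn_disc_zero G.regular,
    integral_bop_disc_zero]
  simp [nrm_zero]

lemma adjointNorm_zero : adjointNorm G P T (disc 0) = 0 := by
  unfold adjointNorm
  rw [bjump_disc_zero G.regular, bval_disc_zero G.regular, bdn_disc_zero G.regular,
    integral_bop_disc_zero, bfn_disc_zero]
  cases P.adj <;> simp [nrm_zero]

lemma normL_disc_zero_right (v : T.Broken) :
    normL G P T v (disc 0) = primalNorm G P T v := by
  rw [normL_eq, adjointNorm_zero, add_zero]

lemma normL_disc_zero_left (w : T.Broken) :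
    normL G P T (disc 0) w = adjointNorm G P T w := by
  rw [normL_eq, primalNorm_zero, zero_add]

lemma primalNorm_nonneg (hh : 0 < T.h) (v : T.Broken) : 0 ≤ primalNorm G P T v := by
  have := nrm_nonneg T.intFacets (bjump v)
  have := nrm_nonneg (T.on G.ΓD) (bval v)
  have := nrm_nonneg (T.on G.ΓN) (bdn v)
  unfold primalNorm; positivity

lemma adjointNorm_nonneg (hh : 0 < T.h) (w : T.Broken) : 0 ≤ adjointNorm G P T w := by
  have := nrm_nonneg T.intFacets (bjump w)
  have := nrm_nonneg (T.off G.ΓN) (bval w)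
  have := nrm_nonneg (T.off G.ΓD) (bdn w)
  unfold adjointNorm
  cases P.adj <;> positivity

lemma primalNorm_sub_le (hh : 0 < T.h) (φ : H2 G.Ω) (y e : T.X) :
    primalNorm G P T (φ, y - e) ≤ primalNorm G P T (φ, y) + primalNorm G P T (disc e) := by
  have h1 := nrm_sub_le (sqInt_bval_on G.ΓD ((φ, y) : T.Broken)) (sqInt_bval_on G.ΓD (disc e))
  have h2 := nrm_sub_le (sqInt_bdn_on G.ΓN ((φ, y) : T.Broken)) (sqInt_bdn_on G.ΓN (disc e))
  have h3 := nrm_sub_le (sqInt_bjump_int ((φ, y) : T.Broken)) (sqInt_bjump_int (disc e))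
  rw [← bval_sub G.regular] at h1
  rw [← bdn_sub G.regular] at h2
  rw [← bjump_sub G.regular] at h3
  have h4 : √(∫ x in G.Ω, bop P.c ((φ, y - e) : T.Broken) x ^ 2)
      ≤ √(∫ x in G.Ω, bop P.c ((φ, y) : T.Broken) x ^ 2)
        + √(∫ x in G.Ω, bop P.c (disc e) x ^ 2) := by
    have hb : ∫ x in G.Ω, bop P.c ((φ, y - e) : T.Broken) x ^ 2
        = ∫ x in G.Ω, (bop P.c ((φ, y) : T.Broken) x - bop P.c (disc e) x) ^ 2 := by
      refine integral_congr_ae ?_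
      filter_upwards [bop_sub P.c φ y e] with x hx
      rw [hx]
    rw [hb]
    exact sqrt_integral_sq_sub_le (memLp_bop P.c ((φ, y) : T.Broken)) (memLp_bop P.c (disc e))
  have h5 := mul_le_mul_of_nonneg_left h1 (by positivity : 0 ≤ (√T.h)⁻¹)
  have h6 := mul_le_mul_of_nonneg_left h2 (by positivity : 0 ≤ √T.h)
  have h7 := mul_le_mul_of_nonneg_left h3 (by positivity : 0 ≤ √T.h)
  have h8 := mul_le_mul_of_nonneg_left h4 hh.le
  unfold primalNorm
  linarith

/-! ### Bounds for the stabilisation terms -/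

lemma h_mul_ip_le (hh : 0 < T.h) {A : Finset (Finset (E d))} {p q : Finset (E d) → E d → ℝ}
    (hp : SqInt A p) (hq : SqInt A q) :
    |T.h * ip A p q| ≤ (√T.h * nrm A p) * (√T.h * nrm A q) := by
  have h1 := mul_le_mul_of_nonneg_left (abs_ip_le hp hq) hh.le
  rw [abs_mul, abs_of_pos hh]
  have e : (√T.h * nrm A p) * (√T.h * nrm A q) = √T.h ^ 2 * (nrm A p * nrm A q) := by ring
  rw [e, Real.sq_sqrt hh.le]
  exact h1

lemma h_inv_mul_ip_le (hh : 0 < T.h) {A : Finset (Finset (E d))} {p q : Finset (E d) → E d → ℝ}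
    (hp : SqInt A p) (hq : SqInt A q) :
    |T.h⁻¹ * ip A p q| ≤ ((√T.h)⁻¹ * nrm A p) * ((√T.h)⁻¹ * nrm A q) := by
  have h1 := mul_le_mul_of_nonneg_left (abs_ip_le hp hq) (inv_pos.2 hh).le
  rw [abs_mul, abs_of_pos (inv_pos.2 hh)]
  have e : ((√T.h)⁻¹ * nrm A p) * ((√T.h)⁻¹ * nrm A q)
    = (√T.h ^ 2)⁻¹ * (nrm A p * nrm A q) := by ring
  rw [e, Real.sq_sqrt hh.le]
  exact h1

lemma sV_le (hh : 0 < T.h) (b w : T.Broken) :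
    sV G P T b w ≤ (2 * P.γD + P.γS) * (primalNorm G P T b * primalNorm G P T w) := by
  have h1 := (le_abs_self _).trans (h_inv_mul_ip_le hh
    (sqInt_bval_on G.ΓD b) (sqInt_bval_on G.ΓD w))
  have h2 := (le_abs_self _).trans (h_mul_ip_le hh
    (sqInt_bdn_on G.ΓN b) (sqInt_bdn_on G.ΓN w))
  have h3 := (le_abs_self _).trans (h_mul_ip_le hh
    (sqInt_bjump_int b) (sqInt_bjump_int w))
  have parts : ∀ b : T.Broken, √T.h * nrm T.intFacets (bjump b) ≤ primalNorm G P T b ∧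
      (√T.h)⁻¹ * nrm (T.on G.ΓD) (bval b) ≤ primalNorm G P T b ∧
      √T.h * nrm (T.on G.ΓN) (bdn b) ≤ primalNorm G P T b := by
    intro b
    have t1 : 0 ≤ T.h * √(∫ x in G.Ω, bop P.c b x ^ 2) := by positivity
    have t2 : 0 ≤ √T.h * nrm T.intFacets (bjump b) :=
      mul_nonneg (Real.sqrt_nonneg _) (nrm_nonneg _ _)
    have t3 : 0 ≤ (√T.h)⁻¹ * nrm (T.on G.ΓD) (bval b) :=
      mul_nonneg (by positivity) (nrm_nonneg _ _)
    have t4 : 0 ≤ √T.h * nrm (T.on G.ΓN) (bdn b) :=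
      mul_nonneg (Real.sqrt_nonneg _) (nrm_nonneg _ _)
    unfold primalNorm
    exact ⟨by linarith, by linarith, by linarith⟩
  obtain ⟨b1, b2, b3⟩ := parts b
  obtain ⟨w1, w2, w3⟩ := parts w
  have n := primalNorm_nonneg (G := G) (P := P) hh b
  have m1 := h3.trans (mul_le_mul b1 w1 (mul_nonneg (Real.sqrt_nonneg _) (nrm_nonneg _ _)) n)
  have m2 := h1.trans (mul_le_mul b2 w2
    (mul_nonneg (inv_nonneg.2 (Real.sqrt_nonneg _)) (nrm_nonneg _ _)) n)
  have m3 := h2.trans (mul_le_mul b3 w3 (mul_nonneg (Real.sqrt_nonneg _) (nrm_nonneg _ _)) n)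
  have hD := P.γD_pos
  have hS := P.γS_pos
  unfold sV sVD cip
  have k1 := mul_le_mul_of_nonneg_left m1 hS.le
  have k2 := mul_le_mul_of_nonneg_left m2 hD.le
  have k3 := mul_le_mul_of_nonneg_left m3 hD.le
  linarith

variable (G P T) in
/-- The square root of the interior part of the adjoint stabilisation, without its parameter. -/
def interiorNorm (w : T.Broken) : ℝ :=
  match P.adj with
  | .cip => √T.h * nrm T.intFacets (bjump w)
  | .grad => √(∫ x in G.Ω, ‖grad (bfn w) x‖ ^ 2)

lemma interiorNorm_nonneg (w : T.Broken) : 0 ≤ interiorNorm G P T w := by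
  unfold interiorNorm
  cases P.adj
  · exact mul_nonneg (Real.sqrt_nonneg _) (nrm_nonneg _ _)
  · exact Real.sqrt_nonneg _

lemma abs_sWS_le (hh : 0 < T.h) (z w : T.Broken) :
    |sWS G P T z w| ≤ P.γS * (interiorNorm G P T z * interiorNorm G P T w) := by
  have hS := P.γS_pos
  unfold sWS interiorNorm cip
  cases P.adj
  · simp only
    rw [abs_mul, abs_of_pos hS]
    exact mul_le_mul_of_nonneg_left (h_mul_ip_le hh (sqInt_bjump_int z)
      (sqInt_bjump_int w)) hS.le
  · simp only
    rw [abs_mul, abs_of_pos hS]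
    refine mul_le_mul_of_nonneg_left ?_ hS.le
    have e : ∀ v : H1 G.Ω, √(∫ x in G.Ω, ‖grad v x‖ ^ 2) = ‖v.1.snd‖ := fun v => by
      rw [← Real.sqrt_sq (norm_nonneg v.1.snd), norm_sq_Lp_eq]; rfl
    rw [e, e]
    have := abs_real_inner_le_norm (bfn z).1.snd (bfn w).1.snd
    rwa [L2.inner_def] at this

lemma sWS_self (hh : 0 < T.h) (z : T.Broken) :
    sWS G P T z z = P.γS * interiorNorm G P T z ^ 2 := by
  unfold sWS interiorNorm cip
  cases P.adj
  · simp only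
    rw [mul_pow, Real.sq_sqrt hh.le, nrm_sq]
  · simp only
    rw [Real.sq_sqrt (integral_nonneg fun x => sq_nonneg _)]
    simp only [real_inner_self_eq_norm_sq]

lemma sW_self (hh : 0 < T.h) (z : T.Broken) :
    sW G P T z z = P.γD * ((√T.h)⁻¹ * nrm (T.off G.ΓN) (bval z)) ^ 2
      + P.γD * (√T.h * nrm (T.off G.ΓD) (bdn z)) ^ 2 + P.γS * interiorNorm G P T z ^ 2 := by
  unfold sW sWD
  rw [sWS_self hh, mul_pow, mul_pow, inv_pow, Real.sq_sqrt hh.le, nrm_sq, nrm_sq]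

lemma parts_le_adjointNorm (hh : 0 < T.h) (w : T.Broken) :
    (√T.h)⁻¹ * nrm (T.off G.ΓN) (bval w) + √T.h * nrm (T.off G.ΓD) (bdn w)
      + interiorNorm G P T w ≤ adjointNorm G P T w := by
  have t1 : 0 ≤ T.h * √(∫ x in G.Ω, bop P.c w x ^ 2) := by positivity
  have t2 : 0 ≤ √T.h * nrm T.intFacets (bjump w) :=
    mul_nonneg (Real.sqrt_nonneg _) (nrm_nonneg _ _)
  unfold adjointNorm interiorNorm
  cases P.adj
  · simp only; linarith
  · simp only
    have := Real.sqrt_le_iff.2 ⟨norm_nonneg (bfn w), integral_grad_sq_le (bfn w)⟩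
    linarith

/-- The Cauchy–Schwarz inequality for the adjoint stabilisation, in which the second factor is
bounded by the semi-norm. -/
lemma abs_sW_le (hh : 0 < T.h) (z w : T.Broken) :
    |sW G P T z w| ≤ (√P.γD + √P.γS) * (√(sW G P T z z) * adjointNorm G P T w) := by
  have hD := P.γD_pos
  have hS := P.γS_pos
  have h1 := h_inv_mul_ip_le hh (sqInt_bval_off G.ΓN z)
    (sqInt_bval_off G.ΓN w)
  have h2 := h_mul_ip_le hh (sqInt_bdn_off G.ΓD z) (sqInt_bdn_off G.ΓD w)
  have h3 := abs_sWS_le (P := P) hh z w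
  have hz := sW_self (P := P) hh z
  have hw := parts_le_adjointNorm (P := P) hh w
  have z1 : 0 ≤ (√T.h)⁻¹ * nrm (T.off G.ΓN) (bval z) := mul_nonneg (by positivity) (nrm_nonneg _ _)
  have z2 : 0 ≤ √T.h * nrm (T.off G.ΓD) (bdn z) := mul_nonneg (by positivity) (nrm_nonneg _ _)
  have z3 := interiorNorm_nonneg (P := P) z
  have w1 : 0 ≤ (√T.h)⁻¹ * nrm (T.off G.ΓN) (bval w) := mul_nonneg (by positivity) (nrm_nonneg _ _)
  have w2 : 0 ≤ √T.h * nrm (T.off G.ΓD) (bdn w) := mul_nonneg (by positivity) (nrm_nonneg _ _)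
  have w3 := interiorNorm_nonneg (P := P) w
  have hsplit : |sW G P T z w| ≤ P.γD * |T.h⁻¹ * ip (T.off G.ΓN) (bval z) (bval w)|
      + P.γD * |T.h * ip (T.off G.ΓD) (bdn z) (bdn w)| + |sWS G P T z w| := by
    unfold sW sWD
    refine (abs_add_le _ _).trans (add_le_add ((abs_add_le _ _).trans ?_) le_rfl)
    rw [abs_mul, abs_mul P.γD, abs_of_pos hD]
  generalize (√T.h)⁻¹ * nrm (T.off G.ΓN) (bval z) = αz at *
  generalize (√T.h)⁻¹ * nrm (T.off G.ΓN) (bval w) = αw at *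
  generalize √T.h * nrm (T.off G.ΓD) (bdn z) = βz at *
  generalize √T.h * nrm (T.off G.ΓD) (bdn w) = βw at *
  generalize interiorNorm G P T z = σz at *
  generalize interiorNorm G P T w = σw at *
  generalize adjointNorm G P T w = N at *
  rw [hz]
  set R := √(P.γD * αz ^ 2 + P.γD * βz ^ 2 + P.γS * σz ^ 2) with hR
  have sD : √P.γD ^ 2 = P.γD := Real.sq_sqrt hD.le
  have sS : √P.γS ^ 2 = P.γS := Real.sq_sqrt hS.le
  have r1 : √P.γD * αz ≤ R := Real.le_sqrt_of_sq_le
    (by rw [mul_pow, sD]; nlinarith [sq_nonneg βz, sq_nonneg σz])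
  have r2 : √P.γD * βz ≤ R := Real.le_sqrt_of_sq_le
    (by rw [mul_pow, sD]; nlinarith [sq_nonneg αz, sq_nonneg σz])
  have r3 : √P.γS * σz ≤ R := Real.le_sqrt_of_sq_le
    (by rw [mul_pow, sS]; nlinarith [sq_nonneg αz, sq_nonneg βz])
  have hR0 : 0 ≤ R := Real.sqrt_nonneg _
  have hDs : 0 ≤ √P.γD := Real.sqrt_nonneg _
  have hSs : 0 ≤ √P.γS := Real.sqrt_nonneg _
  have k1 : P.γD * (αz * αw) ≤ R * (√P.γD * αw) := by
    have := mul_le_mul_of_nonneg_right r1 (mul_nonneg hDs w1)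
    have e : √P.γD * αz * (√P.γD * αw) = √P.γD ^ 2 * (αz * αw) := by ring
    rwa [e, sD] at this
  have k2 : P.γD * (βz * βw) ≤ R * (√P.γD * βw) := by
    have := mul_le_mul_of_nonneg_right r2 (mul_nonneg hDs w2)
    have e : √P.γD * βz * (√P.γD * βw) = √P.γD ^ 2 * (βz * βw) := by ring
    rwa [e, sD] at this
  have k3 : P.γS * (σz * σw) ≤ R * (√P.γS * σw) := by
    have := mul_le_mul_of_nonneg_right r3 (mul_nonneg hSs w3)
    have e : √P.γS * σz * (√P.γS * σw) = √P.γS ^ 2 * (σz * σw) := by ring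
    rwa [e, sS] at this
  have l1 := mul_le_mul_of_nonneg_left h1 hD.le
  have l2 := mul_le_mul_of_nonneg_left h2 hD.le
  have l4 : √P.γD * αw + √P.γD * βw + √P.γS * σw ≤ (√P.γD + √P.γS) * N := by
    have := mul_le_mul_of_nonneg_left hw (add_nonneg hDs hSs)
    nlinarith [mul_nonneg hSs w1, mul_nonneg hSs w2, mul_nonneg hDs w3]
  have l5 := mul_le_mul_of_nonneg_left l4 hR0
  linarith

lemma sqrt_sW_self_le (hh : 0 < T.h) (z : T.Broken) :
    √(sW G P T z z) ≤ (√P.γD + √P.γS) * adjointNorm G P T z := by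
  have hN := adjointNorm_nonneg (P := P) hh z
  have h0 : 0 ≤ sW G P T z z := by
    rw [sW_self hh]
    have := P.γD_pos
    have := P.γS_pos
    positivity
  have h := (le_abs_self _).trans (abs_sW_le (P := P) hh z z)
  rcases eq_or_lt_of_le (Real.sqrt_nonneg (sW G P T z z)) with h1 | h1
  · rw [← h1]; positivity
  · nth_rewrite 1 [← Real.mul_self_sqrt h0] at h
    have e : (√P.γD + √P.γS) * (√(sW G P T z z) * adjointNorm G P T z)
      = √(sW G P T z z) * ((√P.γD + √P.γS) * adjointNorm G P T z) := by ring
    rw [e] at h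
    exact le_of_mul_le_mul_left h h1

/-! ### The perturbation of the Neumann data -/

/-- Facets overlap in sets without area, so the sum over the facets of `ΓN` is bounded by the
integral over `ΓN`. -/
lemma nrm_const_le_normN {δψ : E d → ℝ} (hδ : MemLp δψ 2 ((surf d).restrict G.ΓN)) :
    nrm (T.on G.ΓN) (fun _ => δψ) ≤ G.normN δψ := by
  classical
  refine Real.sqrt_le_sqrt ?_
  unfold ip
  simp only [← pow_two]
  have hsub : ∀ F ∈ T.on G.ΓN, hull F ⊆ G.ΓN := fun F hF => (on_prop hF).2.2.2
  have hint : IntegrableOn (fun x => δψ x ^ 2) G.ΓN (surf d) := hδ.integrable_sq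
  have hdisj : Pairwise fun F F' : T.on G.ΓN =>
      AEDisjoint (surf d) (hull (F : Finset (E d))) (hull (F' : Finset (E d))) := by
    intro F F' hne
    have hF := on_prop F.2
    have hF' := on_prop F'.2
    have hne' : (F : Finset (E d)) ≠ F' := fun h => hne (Subtype.ext h)
    refine measure_mono_null (t := hull ((F : Finset (E d)) ∩ F')) ?_ (surf_hull_eq_zero ?_)
    · rw [hull, hull, hull, T.convexHull_inter_convexHull hF.1 hF'.1, Finset.coe_inter]
    · by_contra! hlt
      have h1 : (F : Finset (E d)) ∩ F' = F :=
        Finset.eq_of_subset_of_card_le Finset.inter_subset_left (by omega)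
      have h2 : (F : Finset (E d)) ∩ F' = F' :=
        Finset.eq_of_subset_of_card_le Finset.inter_subset_right (by omega)
      exact hne' (h1.symm.trans h2)
  have hU : (⋃ F : T.on G.ΓN, hull (F : Finset (E d))) ⊆ G.ΓN :=
    iUnion_subset fun F => hsub F F.2
  have := integral_iUnion_ae (μ := surf d) (f := fun x => δψ x ^ 2)
    (fun F : T.on G.ΓN => (measurableSet_hull (F : Finset (E d))).nullMeasurableSet) hdisj
    (hint.mono_set hU)
  rw [tsum_fintype, Finset.univ_eq_attach,
    Finset.sum_attach (T.on G.ΓN) (fun F => ∫ x in hull F, δψ x ^ 2 ∂(surf d))] at this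
  rw [← this]
  exact setIntegral_mono_set hint (Eventually.of_forall fun x => sq_nonneg _) hU.eventuallyLE

lemma sqInt_const {δψ : E d → ℝ} (hδ : MemLp δψ 2 ((surf d).restrict G.ΓN)) :
    SqInt (T.on G.ΓN) (fun _ => δψ) := fun _ hF =>
  hδ.mono_measure (Measure.restrict_mono (on_prop hF).2.2.2 le_rfl)

end Method
end CauchyFEM
end

noncomputable section
namespace CauchyFEM
variable {d : ℕ}

/-! ### Error analysis -/

section

variable {V : Type*} [SeminormedAddCommGroup V] [NormedSpace ℝ V]

lemma norm_comp_subtypeL_le (l : V →L[ℝ] ℝ) (U : Submodule ℝ V) : ‖l.comp U.subtypeL‖ ≤ ‖l‖ :=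
  ContinuousLinearMap.opNorm_le_bound _ (norm_nonneg _) fun w => l.le_opNorm w

lemma abs_le_norm_comp_subtypeL (l : V →L[ℝ] ℝ) (U : Submodule ℝ V) {w : V} (hw : w ∈ U) :
    |l w| ≤ ‖l.comp U.subtypeL‖ * ‖w‖ :=
  (l.comp U.subtypeL).le_opNorm ⟨w, hw⟩

lemma norm_comp_subtypeL_le_of_forall (l : V →L[ℝ] ℝ) (U : Submodule ℝ V) {C : ℝ} (hC : 0 ≤ C)
    (h : ∀ w : U, l w ≤ C * ‖w‖) : ‖l.comp U.subtypeL‖ ≤ C := by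
  refine ContinuousLinearMap.opNorm_le_bound _ hC fun w => ?_
  have h1 := h (-w)
  rw [norm_neg, NegMemClass.coe_neg, map_neg] at h1
  exact abs_le.2 ⟨neg_le.1 h1, h w⟩

end

namespace Method

open Mesh

section

variable {G : Domain d} {P : Params} {T : Mesh G.Ω}

lemma ηV_nonneg (hh : 0 < T.h) (f : Lp ℝ 2 (vol G.Ω)) (ψ : E d → ℝ) (v : T.X) :
    0 ≤ ηV G P T f ψ v := by
  have := nrm_nonneg T.intFacets (bjump (disc v))
  have := nrm_nonneg (T.on G.ΓN) (fun F x => ψ x - bdn (disc v) F x)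
  have := nrm_nonneg (T.on G.ΓD) (bval (disc v))
  unfold ηV; positivity

lemma ηV_le_ηδ (f : Lp ℝ 2 (vol G.Ω)) (ψ : E d → ℝ) (δl : H1 G.Ω →L[ℝ] ℝ) (v z : T.X) :
    ηV G P T f ψ v ≤ ηδ G P T f ψ δl v z := by
  have := Real.sqrt_nonneg (sW G P T (disc z) (disc z))
  have := norm_nonneg (δl.comp G.W.subtypeL)
  unfold ηδ; linarith

lemma le_starV (φ : H2 G.Ω) (y : T.X) :
    T.h⁻¹ * √(∫ x in G.Ω, fn (toH1 φ - (y : H1 G.Ω)) x ^ 2) ≤ starV G T (φ, -y) := by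
  have h1 : bfn ((φ, -y) : T.Broken) = toH1 φ - (y : H1 G.Ω) := by
    rw [sub_eq_add_neg]; rfl
  have h2 := mul_nonneg (inv_nonneg.2 (Real.sqrt_nonneg T.h))
    (nrm_nonneg (T.intFacets ∪ T.off G.ΓD) (bval ((φ, -y) : T.Broken)))
  have h3 := mul_nonneg (Real.sqrt_nonneg T.h) (nrm_nonneg (T.off G.ΓN) (bdn ((φ, -y) : T.Broken)))
  unfold starV
  rw [h1]
  linarith

lemma starV_nonneg (hh : 0 < T.h) (φ : H2 G.Ω) (y : T.X) : 0 ≤ starV G T (φ, -y) :=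
  le_trans (by positivity) (le_starV φ y)

lemma le_starW (w : H1 G.Ω) (y : T.X) :
    T.h⁻¹ * √(∫ x in G.Ω, fn (w - (y : H1 G.Ω)) x ^ 2) ≤ starW G T w y :=
  le_add_of_nonneg_right (mul_nonneg (inv_nonneg.2 (Real.sqrt_nonneg T.h)) (nrm_nonneg _ _))

lemma starW_nonneg (hh : 0 < T.h) (w : H1 G.Ω) (y : T.X) : 0 ≤ starW G T w y :=
  le_trans (by positivity) (le_starW w y)

/-- The pairing of the perturbed Neumann data with a discrete normal derivative. -/
lemma ip_data_le (hh : 0 < T.h) {δψ : E d → ℝ} (hδ : MemLp δψ 2 ((surf d).restrict G.ΓN))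
    (v : T.Broken) : T.h * ip (T.on G.ΓN) (fun _ => δψ) (bdn v)
      ≤ √T.h * G.normN δψ * primalNorm G P T v := by
  have h1 := (le_abs_self _).trans (h_mul_ip_le hh (sqInt_const (T := T) hδ) (sqInt_bdn_on G.ΓN v))
  have t1 : 0 ≤ T.h * √(∫ x in G.Ω, bop P.c v x ^ 2) := by positivity
  have t2 : 0 ≤ √T.h * nrm T.intFacets (bjump v) :=
    mul_nonneg (Real.sqrt_nonneg _) (nrm_nonneg _ _)
  have t3 : 0 ≤ (√T.h)⁻¹ * nrm (T.on G.ΓD) (bval v) :=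
    mul_nonneg (by positivity) (nrm_nonneg _ _)
  have h2 : √T.h * nrm (T.on G.ΓN) (bdn v) ≤ primalNorm G P T v := by
    unfold primalNorm; linarith
  refine h1.trans (mul_le_mul ?_ h2 (mul_nonneg (Real.sqrt_nonneg _) (nrm_nonneg _ _)) ?_)
  · exact mul_le_mul_of_nonneg_left (nrm_const_le_normN hδ) (Real.sqrt_nonneg _)
  · exact mul_nonneg (Real.sqrt_nonneg _) (Real.sqrt_nonneg _)

/-- The error equation: the discrete error solves the method with the interpolation error and the
perturbations as data. -/
lemma error_equation {f : Lp ℝ 2 (vol G.Ω)} {ψ : E d → ℝ} {u : H2 G.Ω} {δl : H1 G.Ω →L[ℝ] ℝ}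
    {δψ : E d → ℝ} {uh zh : T.X} (hs : Solves G P T f ψ u δl δψ uh zh) (y : T.X)
    (hcons : ∀ w : T.X, ah G P T (smooth u) (disc w) = G.l f ψ w) (v w : T.X) :
    Ah G P T (disc (uh - y)) (disc zh) (disc v) (disc w) =
      ah G P T (u, -y) (disc w) + δl w + sV G P T (u, -y) (disc v)
        + T.h * ip (T.on G.ΓN) (fun _ => δψ) (bdn (disc v)) := by
  have e1 := hs v w
  have a1 := ah_sub (P := P) 0 uh y (disc w)
  have a2 := ah_sub (P := P) u 0 y (disc w)
  have b1 := sV_sub (P := P) 0 uh y (disc v)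
  have b2 := sV_sub (P := P) u 0 y (disc v)
  rw [zero_sub] at a2 b2
  have c1 := hcons w
  have c2 := sVD_smooth (P := P) (T := T) u (disc v)
  change ah G P T (disc (uh - y)) (disc w) = ah G P T (disc uh) (disc w) - _ at a1
  change ah G P T (u, -y) (disc w) = ah G P T (smooth u) (disc w) - _ at a2
  change sV G P T (disc (uh - y)) (disc v) = sV G P T (disc uh) (disc v) - _ at b1
  change sV G P T (u, -y) (disc v) = sV G P T (smooth u) (disc v) - _ at b2
  unfold Ah at e1 ⊢
  linarith

/-- The residual equation, for test functions in the adjoint variable. -/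
lemma residual_equation {f : Lp ℝ 2 (vol G.Ω)} {ψ : E d → ℝ} {u : H2 G.Ω} {δl : H1 G.Ω →L[ℝ] ℝ}
    {δψ : E d → ℝ} {uh zh : T.X} (hs : Solves G P T f ψ u δl δψ uh zh) (w : T.X) :
    G.l f ψ w - ah G P T (disc uh) (disc w) = - sW G P T (disc zh) (disc w) - δl w := by
  have e := hs 0 w
  unfold Ah at e
  rw [ah_disc_zero, sV_disc_zero_right, sVD_disc_zero_right, bdn_disc_zero G.regular, ip_comm,
    ip_zero_left] at e
  linarith

end

variable {G : Domain d} {P : Params} {ι : Type*} {𝒯 : ι → Mesh G.Ω} {M : ℝ}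
  {normS normC : Seminorm ℝ (H1 G.Ω)} {f : Lp ℝ 2 (vol G.Ω)} {ψ : E d → ℝ} {u : H2 G.Ω}
  {iV : ∀ i, H1 G.Ω → (𝒯 i).X} {iW : ∀ i, G.W → (𝒯 i).X} {rV : ∀ i, H1 G.Ω → (𝒯 i).X}
  {cs t κ : ℝ} {CV : H2 G.Ω → ℝ}

/-- The data of the error equation, tested with a pair of norms `a` and `b`. -/
lemma discrete_error_arith {M g p s a b A k N L x₁ x₂ x₃ x₄ y : ℝ} (hM : 0 ≤ M) (hg : 0 ≤ g)
    (hp : 0 ≤ p) (hs : 0 ≤ s) (ha : 0 ≤ a) (hb : 0 ≤ b) (hN : 0 ≤ N) (hL : 0 ≤ L)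
    (h₁ : x₁ ≤ M * (s * b)) (hA : p + s ≤ A) (h₂ : x₃ ≤ g * (p * a)) (h₃ : x₄ ≤ N * a)
    (hy : y ≤ M * (k * b)) (h₄ : x₂ ≤ L * y) (hk : 0 ≤ k) :
    x₁ + x₂ + x₃ + x₄ ≤ ((M + g) * A + M * (k * L) + N) * (a + b) := by
  have k1 : M * (s * b) ≤ M * A * b := by
    rw [mul_assoc]
    exact mul_le_mul_of_nonneg_left (mul_le_mul_of_nonneg_right (by linarith) hb) hM
  have k2 : g * (p * a) ≤ g * A * a := by
    rw [mul_assoc]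
    exact mul_le_mul_of_nonneg_left (mul_le_mul_of_nonneg_right (by linarith) ha) hg
  have k3 : L * y ≤ M * (k * L) * b :=
    (mul_le_mul_of_nonneg_left hy hL).trans (le_of_eq (by ring))
  have A0 : 0 ≤ A := by linarith
  have r1 : 0 ≤ M * A * a := by positivity
  have r2 : 0 ≤ g * A * b := by positivity
  have r3 : 0 ≤ M * (k * L) * a := by positivity
  have r4 : 0 ≤ N * b := by positivity
  have e : ((M + g) * A + M * (k * L) + N) * (a + b)
      = M * A * a + M * A * b + g * A * a + g * A * b
        + M * (k * L) * a + M * (k * L) * b + N * a + N * b := by ring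
  rw [e]
  linarith

/-- Discrete stability, applied to the error equation. -/
lemma discrete_error_le (H : Hypotheses G P 𝒯 M normS normC f ψ u iV iW rV cs t κ CV) (hM : 0 < M)
    {i : ι} (hh : 0 < (𝒯 i).h) {δψ : E d → ℝ} (hδ : MemLp δψ 2 ((surf d).restrict G.ΓN))
    {δl : H1 G.Ω →L[ℝ] ℝ} {uh zh : (𝒯 i).X} (hs : Solves G P (𝒯 i) f ψ u δl δψ uh zh) :
    cs * normL G P (𝒯 i) (disc (uh - iV i (toH1 u))) (disc zh) ≤
      (M + (2 * P.γD + P.γS)) * (CV u * (𝒯 i).h ^ t) + M * ((𝒯 i).h ^ (-κ) * ‖δl‖)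
        + √(𝒯 i).h * G.normN δψ := by
  refine H.discrete_stability i _ _ _ fun v w => ?_
  rw [error_equation hs _ (H.consistency i), normL_eq]
  have hc := H.continuity_ah i u w
  have hap := H.iV_approx i u
  rw [normL_disc_zero_left] at hc
  rw [normL_disc_zero_right] at hap
  have hS := sV_le (P := P) hh ((u, - iV i (toH1 u)) : (𝒯 i).Broken) (disc v)
  have hI := ip_data_le (P := P) hh hδ (disc v)
  have hn := H.norm_le i w
  rw [normL_disc_zero_left] at hn
  have hδl : δl w ≤ ‖δl‖ * ‖(w : H1 G.Ω)‖ := (le_abs_self _).trans (δl.le_opNorm _)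
  have hγ : 0 ≤ 2 * P.γD + P.γS := by
    have := P.γD_pos
    have := P.γS_pos
    positivity
  exact discrete_error_arith hM.le hγ (primalNorm_nonneg hh _) (starV_nonneg hh u _)
    (primalNorm_nonneg hh _) (adjointNorm_nonneg hh _)
    (mul_nonneg (Real.sqrt_nonneg _) (Real.sqrt_nonneg _)) (norm_nonneg δl)
    hc hap hS hI hn hδl (Real.rpow_nonneg hh.le _)

/-- The quantity `η + σ + L'`, where `η` is controlled by the primal norm `q` of the error, and
`a`, `b` are the primal and adjoint norms of the discrete error. -/
lemma eta_arith {M cs g c p s q a b A k N L L' η σ : ℝ} (hM : 0 ≤ M) (hcs : 0 < cs) (hg : 0 ≤ g)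
    (hc : 0 ≤ c) (hp : 0 ≤ p) (hs : 0 ≤ s) (ha : 0 ≤ a) (hb : 0 ≤ b) (hN : 0 ≤ N) (hL : 0 ≤ L)
    (hk : 0 ≤ k) (hst : cs * (a + b) ≤ (M + g) * A + M * (k * L) + N) (hη : η ≤ M * q)
    (hq : q ≤ p + a) (hA : p + s ≤ A) (hσ : σ ≤ c * b) (hL' : L' ≤ L) :
    η + σ + L' ≤ (M + (M + c) * (M + g + 1 + M) + 1) *
      ((1 + cs⁻¹) * A + cs⁻¹ * N + (1 + cs⁻¹ * k) * L) := by
  have hr : 0 < cs⁻¹ := inv_pos.2 hcs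
  have A0 : 0 ≤ A := by linarith
  have hab : a + b ≤ cs⁻¹ * ((M + g) * A + M * (k * L) + N) := by
    rw [inv_mul_eq_div, le_div_iff₀ hcs, mul_comm]; exact hst
  generalize cs⁻¹ = r at *
  have h1 : η ≤ M * (A + a) := hη.trans (mul_le_mul_of_nonneg_left (by linarith) hM)
  have h2 : M * a + c * b ≤ (M + c) * (a + b) := by
    have := mul_nonneg hM hb
    have := mul_nonneg hc ha
    linarith
  have h3 := mul_le_mul_of_nonneg_left hab (by positivity : 0 ≤ M + c)
  have h4 : r * ((M + g) * A + M * (k * L) + N)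
      ≤ (M + g + 1 + M) * (r * A + r * N + r * k * L) := by
    have t1 : 0 ≤ (1 + M) * (r * A) := by positivity
    have t2 : 0 ≤ (M + g + M) * (r * N) := by positivity
    have t3 : 0 ≤ (M + g + 1) * (r * k * L) := by positivity
    linarith
  have h5 := mul_le_mul_of_nonneg_left h4 (by positivity : 0 ≤ M + c)
  have h7 : 0 ≤ (M + c) * (M + g + 1 + M) * (A + L) := by positivity
  have h8 : 0 ≤ M * L + A + M * (r * A + r * N + r * k * L) + (r * A + r * N + r * k * L) := by
    positivity
  have e : (M + (M + c) * (M + g + 1 + M) + 1) * ((1 + r) * A + r * N + (1 + r * k) * L)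
      = M * A + L + (M * L + A + M * (r * A + r * N + r * k * L) + (r * A + r * N + r * k * L))
        + (M + c) * (M + g + 1 + M) * (A + L)
        + (M + c) * ((M + g + 1 + M) * (r * A + r * N + r * k * L)) := by ring
  rw [e]
  linarith

/-- The a posteriori quantity is bounded by the interpolation error and the perturbations. -/
lemma ηδ_le (H : Hypotheses G P 𝒯 M normS normC f ψ u iV iW rV cs t κ CV) (hM : 0 < M)
    {i : ι} (hh : 0 < (𝒯 i).h) {δψ : E d → ℝ} (hδ : MemLp δψ 2 ((surf d).restrict G.ΓN))
    {δl : H1 G.Ω →L[ℝ] ℝ} {uh zh : (𝒯 i).X} (hs : Solves G P (𝒯 i) f ψ u δl δψ uh zh) :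
    ηδ G P (𝒯 i) f ψ δl uh zh ≤
      (M + (M + (√P.γD + √P.γS)) * (M + (2 * P.γD + P.γS) + 1 + M) + 1) *
        (CV u * (1 + cs⁻¹) * (𝒯 i).h ^ t + cs⁻¹ * √(𝒯 i).h * G.normN δψ
          + (1 + cs⁻¹ * (𝒯 i).h ^ (-κ)) * ‖δl‖) := by
  have hst := discrete_error_le H hM hh hδ hs
  rw [normL_eq] at hst
  have hη := H.ηV_le i uh
  rw [normL_disc_zero_right] at hη
  have htri := primalNorm_sub_le (P := P) hh u (- iV i (toH1 u)) (uh - iV i (toH1 u))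
  have hneg : - iV i (toH1 u) - (uh - iV i (toH1 u)) = - uh := by abel
  rw [hneg] at htri
  have hap := H.iV_approx i u
  rw [normL_disc_zero_right] at hap
  have s0 := starV_nonneg hh u (iV i (toH1 u))
  have hz := sqrt_sW_self_le (P := P) hh (disc zh)
  have hγ : 0 ≤ 2 * P.γD + P.γS := by
    have := P.γD_pos
    have := P.γS_pos
    positivity
  have eN : cs⁻¹ * √(𝒯 i).h * G.normN δψ = cs⁻¹ * (√(𝒯 i).h * G.normN δψ) := by ring
  have eA : CV u * (1 + cs⁻¹) * (𝒯 i).h ^ t = (1 + cs⁻¹) * (CV u * (𝒯 i).h ^ t) := by ring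
  unfold ηδ
  rw [eN, eA]
  exact eta_arith hM.le H.cs_pos hγ (add_nonneg (Real.sqrt_nonneg _) (Real.sqrt_nonneg _))
    (primalNorm_nonneg hh _) (starV_nonneg hh u _) (primalNorm_nonneg hh _)
    (adjointNorm_nonneg hh _) (mul_nonneg (Real.sqrt_nonneg _) (Real.sqrt_nonneg _))
    (norm_nonneg δl) (Real.rpow_nonneg hh.le _) hst hη htri hap hz
    (norm_comp_subtypeL_le δl G.W)

/-- The interpolant `i_W` is stable in `H¹(Ω)`. -/
lemma norm_iW_le (H : Hypotheses G P 𝒯 M normS normC f ψ u iV iW rV cs t κ CV)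
    (hh : ∀ i, 0 < (𝒯 i).h) {C : ℝ} (hC : 0 ≤ C)
    (hinv : ∀ i (v : (𝒯 i).X) (w : H1 G.Ω), ‖(v : H1 G.Ω)‖
      ≤ C * ((𝒯 i).h⁻¹ * √(∫ x in G.Ω, fn (w - (v : H1 G.Ω)) x ^ 2) + ‖w‖)) (i : ι) (w : G.W) :
    ‖(iW i w : H1 G.Ω)‖ ≤ C * (M + 1) * ‖w‖ := by
  have h1 := hinv i (iW i w) w
  have h2 := le_starW (w : H1 G.Ω) (iW i w)
  have h3 := H.iW_stable i w
  rw [normL_disc_zero_left] at h3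
  have h4 := adjointNorm_nonneg (P := P) (hh i) (disc (iW i w))
  have h5 : ‖(w : H1 G.Ω)‖ = ‖w‖ := rfl
  rw [h5] at h1
  refine h1.trans ?_
  rw [mul_assoc]
  exact mul_le_mul_of_nonneg_left (by linarith) hC

/-- The splitting of the residual into the residual of the discrete solution, the error of the
interpolant of the test function, and the error of the lifting `r_V`. -/
lemma residual_arith {m M c C η σ L W n₁ n₂ e₁ s b y l x a₀ a₁ a₂ a₃ a₄ a₅ ah sw δ : ℝ}
    (hM : 0 ≤ M) (hC : 0 ≤ C) (hm : 0 ≤ m) (hc : 0 ≤ c) (hη : 0 ≤ η) (hσ : 0 ≤ σ) (hL : 0 ≤ L)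
    (hW : 0 ≤ W) (hn₁ : 0 ≤ n₁) (hn₂ : 0 ≤ n₂) (hb : 0 ≤ b) (hs : 0 ≤ s)
    (hr : l - ah = -sw - δ) (hsol : a₃ = l) (d1 : x = a₀ - a₁) (d2 : a₂ = a₃ - a₄)
    (d3 : a₀ = a₅ + a₂) (b1 : |a₁| ≤ m * (e₁ * W)) (b2 : n₁ + n₂ + e₁ ≤ M * η)
    (b3 : a₅ ≤ M * (s * η)) (b4 : |ah - a₄| ≤ M * (η * W)) (b5 : |sw| ≤ c * (σ * b))
    (b6 : b + s ≤ M * W) (b7 : |δ| ≤ L * y) (b8 : y ≤ C * (M + 1) * W) :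
    x ≤ (m * M + M * M + c * M + C * (M + 1) + M) * (η + σ + L) * W := by
  have f1 : -a₁ ≤ m * M * η * W := by
    refine (neg_le_abs _).trans (b1.trans ?_)
    calc m * (e₁ * W) ≤ m * ((M * η) * W) :=
          mul_le_mul_of_nonneg_left (mul_le_mul_of_nonneg_right (by linarith) hW) hm
      _ = _ := by ring
  have f2 : a₅ ≤ M * M * η * W := by
    refine b3.trans ?_
    calc M * (s * η) ≤ M * ((M * W) * η) :=
          mul_le_mul_of_nonneg_left (mul_le_mul_of_nonneg_right (by linarith) hη) hM
      _ = _ := by ring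
  have f3 : -sw ≤ c * M * σ * W := by
    refine (neg_le_abs _).trans (b5.trans ?_)
    calc c * (σ * b) ≤ c * (σ * (M * W)) :=
          mul_le_mul_of_nonneg_left (mul_le_mul_of_nonneg_left (by linarith) hσ) hc
      _ = _ := by ring
  have f4 : -δ ≤ C * (M + 1) * L * W := by
    refine (neg_le_abs _).trans (b7.trans ?_)
    calc L * y ≤ L * (C * (M + 1) * W) := mul_le_mul_of_nonneg_left b8 hL
      _ = _ := by ring
  have f5 := (le_abs_self _).trans b4
  have f6 : M * (η * W) = M * η * W := by ring
  have g1 : 0 ≤ m * M * (σ + L) * W := by positivity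
  have g2 : 0 ≤ M * M * (σ + L) * W := by positivity
  have g3 : 0 ≤ c * M * (η + L) * W := by positivity
  have g4 : 0 ≤ C * (M + 1) * (η + σ) * W := by positivity
  have g5 : 0 ≤ M * (σ + L) * W := by positivity
  have e : (m * M + M * M + c * M + C * (M + 1) + M) * (η + σ + L) * W
      = m * M * η * W + M * M * η * W + c * M * σ * W + C * (M + 1) * L * W + M * η * W
        + m * M * (σ + L) * W + M * M * (σ + L) * W + c * M * (η + L) * W
        + C * (M + 1) * (η + σ) * W + M * (σ + L) * W := by ring
  rw [e]
  linarith

/-- The residual of `u - r_V u_h` in the dual space of `W` is bounded by the a posteriori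
quantity. -/
lemma residual_le (H : Hypotheses G P 𝒯 M normS normC f ψ u iV iW rV cs t κ CV) (hM : 0 < M)
    (hu : IsSolution G P f ψ u) (hh : ∀ i, 0 < (𝒯 i).h) {C : ℝ} (hC : 0 ≤ C)
    (hinv : ∀ i (v : (𝒯 i).X) (w : H1 G.Ω), ‖(v : H1 G.Ω)‖
      ≤ C * ((𝒯 i).h⁻¹ * √(∫ x in G.Ω, fn (w - (v : H1 G.Ω)) x ^ 2) + ‖w‖)) {i : ι}
    {δψ : E d → ℝ} {δl : H1 G.Ω →L[ℝ] ℝ} {uh zh : (𝒯 i).X}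
    (hs : Solves G P (𝒯 i) f ψ u δl δψ uh zh) (w : G.W) :
    G.a P.c (toH1 u - rV i uh) w ≤
      (max 1 |P.c| * M + M * M + (√P.γD + √P.γS) * M + C * (M + 1) + M) *
        ηδ G P (𝒯 i) f ψ δl uh zh * ‖w‖ := by
  have hr := residual_equation hs (iW i w)
  have hsol := hu.2 _ (H.iW_mem i w)
  have e1 : toH1 u - (rV i uh : H1 G.Ω)
      = (toH1 u - (uh : H1 G.Ω)) - ((rV i uh : H1 G.Ω) - uh) := by abel
  have d1 := G.a_sub_left P.c (toH1 u - (uh : H1 G.Ω)) ((rV i uh : H1 G.Ω) - uh) w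
  rw [← e1] at d1
  have d2 := G.a_sub_left P.c (toH1 u) uh (iW i w)
  have d3 : G.a P.c (toH1 u - (uh : H1 G.Ω)) w
      = G.a P.c (toH1 u - (uh : H1 G.Ω)) ((w : H1 G.Ω) - iW i w)
        + G.a P.c (toH1 u - (uh : H1 G.Ω)) (iW i w) := by
    rw [← G.a_add_right, sub_add_cancel]
  have b1 := G.abs_a_le P.c ((rV i uh : H1 G.Ω) - uh) w
  have b2 := H.rV_bound i uh
  have b3 := H.continuity_a i uh w
  have b4 := H.nonconformity i uh w
  have b5 := abs_sW_le (P := P) (hh i) (disc zh) (disc (iW i w))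
  have b6 := H.iW_stable i w
  rw [normL_disc_zero_left] at b6
  have a0 := adjointNorm_nonneg (P := P) (hh i) (disc (iW i w))
  have st0 := starW_nonneg (hh i) (w : H1 G.Ω) (iW i w)
  have b7 : |δl (iW i w)| ≤ ‖δl.comp G.W.subtypeL‖ * ‖(iW i w : H1 G.Ω)‖ :=
    abs_le_norm_comp_subtypeL δl G.W (H.iW_mem i w)
  have b8 := norm_iW_le H hh hC hinv i w
  have η0 := ηV_nonneg (P := P) (hh i) f ψ uh
  have n1 := apply_nonneg normS ((rV i uh : H1 G.Ω) - uh)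
  have n2 := apply_nonneg normC ((rV i uh : H1 G.Ω) - uh)
  have hw : ‖(w : H1 G.Ω)‖ = ‖w‖ := rfl
  rw [hw] at b1
  unfold ηδ
  exact residual_arith hM.le hC (by positivity) (by positivity) η0 (Real.sqrt_nonneg _)
    (norm_nonneg (δl.comp G.W.subtypeL)) (norm_nonneg w) n1 n2 a0 st0 hr hsol d1 d2 d3 b1 b2 b3
    b4 b5 b6 b7 b8

/-- A bound of the error in `H¹(Ω)` that does not depend on the mesh and the perturbations, as
long as these are at most of the order of the mesh size. -/
lemma norm_error_le (H : Hypotheses G P 𝒯 M normS normC f ψ u iV iW rV cs t κ CV) (hM : 0 < M)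
    (hh : ∀ i, 0 < (𝒯 i).h) {C C' : ℝ} (hC : 0 ≤ C) (hC' : 0 ≤ C')
    (hinv : ∀ i (v : (𝒯 i).X) (w : H1 G.Ω), ‖(v : H1 G.Ω)‖
      ≤ C * ((𝒯 i).h⁻¹ * √(∫ x in G.Ω, fn (w - (v : H1 G.Ω)) x ^ 2) + ‖w‖))
    (hpoin : ∀ i (v : (𝒯 i).X), (𝒯 i).h * ‖(v : H1 G.Ω)‖ ≤ C' * primalNorm G P (𝒯 i) (disc v))
    {i : ι} {δψ : E d → ℝ} (hδ : MemLp δψ 2 ((surf d).restrict G.ΓN)) {δl : H1 G.Ω →L[ℝ] ℝ}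
    {uh zh : (𝒯 i).X} (hs : Solves G P (𝒯 i) f ψ u δl δψ uh zh) {Cδ : ℝ}
    (hdata : (𝒯 i).h ^ (-κ) * ‖δl‖ + √(𝒯 i).h * G.normN δψ ≤ Cδ * (𝒯 i).h) :
    ‖toH1 u - (uh : H1 G.Ω)‖ ≤ ‖toH1 u‖
      + C * (CV u * Metric.diam (closure G.Ω) ^ t + ‖toH1 u‖)
      + C' * (cs⁻¹ * ((M + (2 * P.γD + P.γS)) * (CV u * Metric.diam (closure G.Ω) ^ (t - 1))
          + (M + 1) * Cδ)) := by
  have hT := hh i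
  set D := Metric.diam (closure G.Ω)
  have hTD : (𝒯 i).h ≤ D := (𝒯 i).h_le
  have hcs := H.cs_pos
  have hCV := H.CV_pos u
  have ht := H.one_le_t
  have hst := discrete_error_le H hM hT hδ hs
  rw [normL_eq] at hst
  have z0 := adjointNorm_nonneg (P := P) hT (disc zh)
  have hp := hpoin i (uh - iV i (toH1 u))
  have hi := hinv i (iV i (toH1 u)) (toH1 u)
  have hap := H.iV_approx i u
  rw [normL_disc_zero_right] at hap
  have p0 := primalNorm_nonneg (P := P) hT ((u, - iV i (toH1 u)) : (𝒯 i).Broken)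
  have hsv := le_starV u (iV i (toH1 u))
  have hpow : (𝒯 i).h ^ t ≤ D ^ t := Real.rpow_le_rpow hT.le hTD (by linarith)
  have hpow1 : (𝒯 i).h ^ t ≤ D ^ (t - 1) * (𝒯 i).h := by
    have e : (𝒯 i).h ^ t = (𝒯 i).h ^ (t - 1) * (𝒯 i).h := by
      rw [← Real.rpow_add_one hT.ne']; congr 1; ring
    rw [e]
    exact mul_le_mul_of_nonneg_right (Real.rpow_le_rpow hT.le hTD (by linarith)) hT.le
  have N0 : 0 ≤ √(𝒯 i).h * G.normN δψ := mul_nonneg (Real.sqrt_nonneg _) (Real.sqrt_nonneg _)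
  have L0 : 0 ≤ (𝒯 i).h ^ (-κ) * ‖δl‖ := mul_nonneg (Real.rpow_nonneg hT.le _) (norm_nonneg δl)
  have g0 : 0 ≤ M + (2 * P.γD + P.γS) := by
    have := P.γD_pos
    have := P.γS_pos
    positivity
  -- the interpolant
  have hI : ‖(iV i (toH1 u) : H1 G.Ω)‖ ≤ C * (CV u * D ^ t + ‖toH1 u‖) := by
    refine hi.trans (mul_le_mul_of_nonneg_left ?_ hC)
    have := mul_le_mul_of_nonneg_left hpow hCV.le
    linarith
  -- the discrete error
  have hE : ‖(uh : H1 G.Ω) - iV i (toH1 u)‖ ≤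
      C' * (cs⁻¹ * ((M + (2 * P.γD + P.γS)) * (CV u * D ^ (t - 1)) + (M + 1) * Cδ)) := by
    have h1 : cs * primalNorm G P (𝒯 i) (disc (uh - iV i (toH1 u)))
        ≤ ((M + (2 * P.γD + P.γS)) * (CV u * D ^ (t - 1)) + (M + 1) * Cδ) * (𝒯 i).h := by
      have k1 : (M + (2 * P.γD + P.γS)) * (CV u * (𝒯 i).h ^ t)
          ≤ (M + (2 * P.γD + P.γS)) * (CV u * (D ^ (t - 1) * (𝒯 i).h)) :=
        mul_le_mul_of_nonneg_left (mul_le_mul_of_nonneg_left hpow1 hCV.le) g0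
      have k2 := mul_le_mul_of_nonneg_left hdata (by linarith : 0 ≤ M + 1)
      have k3 := mul_nonneg hcs.le z0
      have k4 := mul_nonneg hM.le N0
      linarith
    have h2 : primalNorm G P (𝒯 i) (disc (uh - iV i (toH1 u)))
        ≤ cs⁻¹ * ((M + (2 * P.γD + P.γS)) * (CV u * D ^ (t - 1)) + (M + 1) * Cδ) * (𝒯 i).h := by
      rw [mul_assoc, inv_mul_eq_div, le_div_iff₀ hcs, mul_comm]
      exact h1
    have h3 := hp.trans (mul_le_mul_of_nonneg_left h2 hC')
    rw [← mul_assoc C', mul_comm ((𝒯 i).h)] at h3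
    exact le_of_mul_le_mul_right h3 hT
  have e : toH1 u - (uh : H1 G.Ω)
      = toH1 u - (iV i (toH1 u) : H1 G.Ω) - ((uh : H1 G.Ω) - iV i (toH1 u)) := by abel
  rw [e]
  have t1 := norm_sub_le (toH1 u - (iV i (toH1 u) : H1 G.Ω)) ((uh : H1 G.Ω) - iV i (toH1 u))
  have t2 := norm_sub_le (toH1 u) (iV i (toH1 u) : H1 G.Ω)
  linarith

end Method
end CauchyFEM
end

noncomputable section
namespace CauchyFEM
variable {d : ℕ}

namespace Method

variable {G : Domain d} {P : Params} {ι : Type*} {𝒯 : ι → Mesh G.Ω} {M : ℝ}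
  {normS normC : Seminorm ℝ (H1 G.Ω)} {f : Lp ℝ 2 (vol G.Ω)} {ψ : E d → ℝ} {u : H2 G.Ω}
  {iV : ∀ i, H1 G.Ω → (𝒯 i).X} {iW : ∀ i, G.W → (𝒯 i).X} {rV : ∀ i, H1 G.Ω → (𝒯 i).X}
  {cs t κ : ℝ} {CV : H2 G.Ω → ℝ}

/-- Conditional stability, applied to `u - r_V u_h`. -/
lemma error_le_of_residual_le (H : Hypotheses G P 𝒯 M normS normC f ψ u iV iW rV cs t κ CV)
    (hu : IsSolution G P f ψ u) {Ξ : ℝ → ℝ → ℝ} (hΞ : G.ConditionallyStable P.c normS normC Ξ)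
    {i : ι} {v : (𝒯 i).X} {ε E₀ : ℝ} (hε : 0 ≤ ε) (hε' : ε < 1) (hE₀ : 0 < E₀)
    (hE : normC (toH1 u - (v : H1 G.Ω)) + M * ηV G P (𝒯 i) f ψ v ≤ E₀)
    (hr : ∀ w : G.W, G.a P.c (toH1 u - rV i v) w ≤ ε * ‖w‖) :
    0 ≤ Ξ E₀ ε ∧ normS (toH1 u - v) ≤ Ξ E₀ ε + M * ηV G P (𝒯 i) f ψ v := by
  have b := H.rV_bound i v
  have nS := apply_nonneg normS ((rV i v : H1 G.Ω) - v)
  have nC := apply_nonneg normC ((rV i v : H1 G.Ω) - v)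
  have n0 := norm_nonneg ((rV i v : H1 G.Ω) - v)
  have e : toH1 u - (rV i v : H1 G.Ω)
      = (toH1 u - (v : H1 G.Ω)) - ((rV i v : H1 G.Ω) - v) := by abel
  have e' : toH1 u - (v : H1 G.Ω)
      = (toH1 u - (rV i v : H1 G.Ω)) + ((rV i v : H1 G.Ω) - v) := by abel
  have hC : normC (toH1 u - (rV i v : H1 G.Ω)) ≤ E₀ := by
    rw [e]
    have := map_sub_le_add normC (toH1 u - (v : H1 G.Ω)) ((rV i v : H1 G.Ω) - v)
    linarith
  have hS : normS (toH1 u - (rV i v : H1 G.Ω)) ≤ Ξ E₀ ε :=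
    (hΞ E₀ hE₀).2.2.2 _ (G.V0.sub_mem hu.1 (H.rV_mem i v)) hC ε hε hε'
      ((G.aL P.c (toH1 u - rV i v)).comp G.W.subtypeL) (fun _ => rfl)
      (norm_comp_subtypeL_le_of_forall _ _ hε hr)
  refine ⟨(apply_nonneg normS _).trans hS, ?_⟩
  have := map_add_le_add normS (toH1 u - (rV i v : H1 G.Ω)) ((rV i v : H1 G.Ω) - v)
  rw [← e'] at this
  linarith

end Method
end CauchyFEM
end

set_option maxHeartbeats 600000 in
open CauchyFEM CauchyFEM.Method in
theorem mainTheorem10 {d : ℕ} (hd : d = 2 ∨ d = 3) (G : CauchyFEM.Domain d) (P : Params)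
    {ι : Type*} (𝒯 : ι → Mesh G.Ω) (h𝒯 : QuasiUniform G 𝒯) (M : ℝ) (hM : 0 < M) :
    ∃ cδa > 0, ∃ C > 0,
    ∀ (normS normC : Seminorm ℝ (H1 G.Ω)), (∃ K, ∀ v, normC v ≤ K * ‖v‖) →
    ∀ (Ξ : ℝ → ℝ → ℝ), G.ConditionallyStable P.c normS normC Ξ →
    ∀ (f : Lp ℝ 2 (vol G.Ω)) (ψ : E d → ℝ), MemLp ψ 2 ((surf d).restrict G.ΓN) →
    ∀ (u : H2 G.Ω), IsSolution G P f ψ u →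
    ∀ (iV : ∀ i, H1 G.Ω → (𝒯 i).X) (iW : ∀ i, G.W → (𝒯 i).X)
      (rV : ∀ i, H1 G.Ω → (𝒯 i).X) (cs t κ : ℝ) (CV : H2 G.Ω → ℝ),
    Hypotheses G P 𝒯 M normS normC f ψ u iV iW rV cs t κ CV →
    ∀ Cδ > 0, ∃ E₀ > 0,
    ∀ (δf : H1 G.Ω →L[ℝ] ℝ) (δψ : E d → ℝ), MemLp δψ 2 ((surf d).restrict G.ΓN) →
    ∀ (δl : H1 G.Ω →L[ℝ] ℝ), (∀ w, δl w = δf w + G.neumannTerm δψ w) →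
    ∀ hmin > 0, ∀ hmax > 0,
    (∀ i, hmin < (𝒯 i).h →
      hmin ^ (-κ) * ‖δl‖ + √(𝒯 i).h * G.normN δψ ≤ Cδ * (𝒯 i).h) →
    ∀ (uh zh : ∀ i, (𝒯 i).X), (∀ i, hmin < (𝒯 i).h → (𝒯 i).h < hmax →
      Solves G P (𝒯 i) f ψ u δl δψ (uh i) (zh i)) →
    (∀ i, hmin < (𝒯 i).h → (𝒯 i).h < hmax →
      ηδ G P (𝒯 i) f ψ δl (uh i) (zh i) < cδa⁻¹) →
    ∀ i, hmin < (𝒯 i).h → (𝒯 i).h < hmax →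
      normS (toH1 u - uh i)
        ≤ C * (Ξ E₀ (cδa * ηδ G P (𝒯 i) f ψ δl (uh i) (zh i)) + ηV G P (𝒯 i) f ψ (uh i)) ∧
      ηδ G P (𝒯 i) f ψ δl (uh i) (zh i)
        ≤ C * (CV u * (1 + cs⁻¹) * (𝒯 i).h ^ t + cs⁻¹ * √(𝒯 i).h * G.normN δψ
          + (1 + cs⁻¹ * (𝒯 i).h ^ (-κ)) * ‖δl‖) := by
  obtain ⟨hfit, ρ, hρ, hb⟩ := h𝒯
  have h2 : 2 ≤ d := by omega
  have hh : ∀ i, 0 < (𝒯 i).h := fun i => Mesh.h_pos (by omega) G.isConnected.nonempty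
  obtain ⟨C, hC, hinv⟩ := exists_inverse_estimate (𝒯 := 𝒯) G.regular hρ hh hb
  obtain ⟨C', hC', hpoin⟩ := exists_discrete_poincare (G := G) (𝒯 := 𝒯) h2 hρ hh hb hfit
  have hpoin' : ∀ i (v : (𝒯 i).X),
      (𝒯 i).h * ‖(v : H1 G.Ω)‖ ≤ C' * primalNorm G P (𝒯 i) (Mesh.disc v) := fun i v => by
    refine (hpoin i v).trans (mul_le_mul_of_nonneg_left ?_ hC')
    have := mul_nonneg (hh i).le
      (Real.sqrt_nonneg (∫ x in G.Ω, Mesh.bop P.c (Mesh.disc v) x ^ 2))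
    unfold primalNorm
    linarith
  have hγD := P.γD_pos
  have hγS := P.γS_pos
  set cδ := max 1 |P.c| * M + M * M + (√P.γD + √P.γS) * M + C * (M + 1) + M with hcδ
  have hcδ0 : 0 < cδ := by positivity
  set Kη := M + (M + (√P.γD + √P.γS)) * (M + (2 * P.γD + P.γS) + 1 + M) + 1 with hKη
  have hKη0 : 0 < Kη := by positivity
  refine ⟨cδ, hcδ0, 1 + M + Kη, by positivity, ?_⟩
  intro normS normC hK Ξ hΞ f ψ hψ u hu iV iW rV cs t κ CV H Cδ hCδ
  obtain ⟨K, hK⟩ := hK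
  have hcs := H.cs_pos
  have hCV := H.CV_pos u
  -- the bound of the error in `H¹(Ω)`
  set R := ‖toH1 u‖ + C * (CV u * Metric.diam (closure G.Ω) ^ t + ‖toH1 u‖)
    + C' * (cs⁻¹ * ((M + (2 * P.γD + P.γS)) * (CV u * Metric.diam (closure G.Ω) ^ (t - 1))
          + (M + 1) * Cδ)) with hR
  have hR0 : 0 ≤ R := by
    have := Real.rpow_nonneg (Metric.diam_nonneg (s := closure G.Ω)) t
    have := Real.rpow_nonneg (Metric.diam_nonneg (s := closure G.Ω)) (t - 1)
    positivity
  -- `|K| * R` bounds `‖u - u_h‖_C`, and `M * cδ⁻¹` bounds `‖r_V u_h - u_h‖_C`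
  refine ⟨|K| * R + M * cδ⁻¹ + 1, by positivity, ?_⟩
  intro δf δψ hδψ δl hδl hmin hhmin hmax hhmax hdata uh zh hs hη i hi hi'
  have hsi := hs i hi hi'
  have hηi := hη i hi hi'
  have hV := ηV_le_ηδ (G := G) (P := P) f ψ δl (uh i) (zh i)
  have hV0 := ηV_nonneg (G := G) (P := P) (hh i) f ψ (uh i)
  have hηδ := ηδ_le H hM (hh i) hδψ hsi
  have hpow : (𝒯 i).h ^ (-κ) ≤ hmin ^ (-κ) :=
    Real.rpow_le_rpow_of_nonpos hhmin hi.le (neg_nonpos.2 H.κ_nonneg)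
  have hdi : (𝒯 i).h ^ (-κ) * ‖δl‖ + √(𝒯 i).h * G.normN δψ ≤ Cδ * (𝒯 i).h :=
    le_trans (add_le_add_left (mul_le_mul_of_nonneg_right hpow (norm_nonneg δl)) _) (hdata i hi)
  have hE := norm_error_le H hM hh hC hC' hinv hpoin' hδψ hsi hdi
  have hNC : normC (toH1 u - (uh i : H1 G.Ω)) ≤ |K| * R :=
    (hK _).trans ((mul_le_mul_of_nonneg_right (le_abs_self K) (norm_nonneg _)).trans
      (mul_le_mul_of_nonneg_left hE (abs_nonneg K)))
  have hMη : M * ηV G P (𝒯 i) f ψ (uh i) ≤ M * cδ⁻¹ :=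
    mul_le_mul_of_nonneg_left (hV.trans hηi.le) hM.le
  have hε' : cδ * ηδ G P (𝒯 i) f ψ δl (uh i) (zh i) < 1 := by
    have := mul_lt_mul_of_pos_left hηi hcδ0
    rwa [mul_inv_cancel₀ hcδ0.ne'] at this
  obtain ⟨hΞ0, hS⟩ := error_le_of_residual_le (ε := cδ * ηδ G P (𝒯 i) f ψ δl (uh i) (zh i))
    (E₀ := |K| * R + M * cδ⁻¹ + 1) (v := uh i) H hu hΞ
    (mul_nonneg hcδ0.le (hV0.trans hV)) hε' (by positivity) (by linarith)
    (fun w => residual_le H hM hu hh hC hinv hsi w)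
  constructor
  · refine hS.trans ?_
    have h1 := mul_nonneg (add_nonneg hM.le hKη0.le) hΞ0
    have h2 := mul_nonneg (add_nonneg zero_le_one hKη0.le) hV0
    linarith
  · refine hηδ.trans (mul_le_mul_of_nonneg_right (by linarith) ?_)
    have h1 := Real.rpow_nonneg (hh i).le t
    have h2 := Real.rpow_nonneg (hh i).le (-κ)
    have h3 : 0 ≤ G.normN δψ := Real.sqrt_nonneg _
    have h4 := norm_nonneg δl
    have h5 := Real.sqrt_nonneg (𝒯 i).h
    positivity
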